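/- Let $0<\gamma_1<\gamma_2$ and put $$C(p)=\sqrt{\gamma_1^2+\gamma_2^2+2\gamma_1\gamma_2\cos p},\quad G(p)=\gamma_2-\gamma_1+C(p),\quad J(p)=G^2(2p)+4\gamma_1\gamma_2\cos^2p,\quad \omega_2(p)=\sqrt{\gamma_1+\gamma_2+C(2p)},$$ $$\mathcal B(p)=\frac1{J(p)}\begin{pmatrix}4\gamma_1\gamma_2\cos^2p&-2\gamma_1G(2p)\cos p\\-2\gamma_2G(2p)\cos p&G^2(2p)\end{pmatrix}.$$ For a real-valued Schwartz function $W$ on $\mathbb R$ let $\tilde V^0(p)=\bigl(\sum_{k\in\mathbb Z}W(2k)e^{-2ikp},\ \sum_{k\in\mathbb Z}W(2k+1)e^{-i(2k+1)p}\bigr)^T$ (the case $\delta=h/\mu=1$), and for $\mu>0$ $$I^{opt}(x,t)=\frac1\pi\int_{-\pi/2}^{\pi/2}\mathcal B(p)\tilde V^0(p)e^{\frac i\mu(px+\omega_2(p)t)}\,dp .$$ Then there is a point $p^*\in(0,\pi/2)$ with $\omega_2''(p^*)=0$, $\omega_2''<0$ on $(0,p^*)$, $\omega_2''>0$ on $(p^*,\pi/2)$,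 $c^*:=-\omega_2'(p^*)>0$ and $q^*:=\omega_2'''(p^*)/2>0$, and the following holds. For $\eta>0$ let $$F_1(\eta)=\tfrac12\bigl(\tilde V^0(p^*-\sqrt\eta)+\tilde V^0(p^*+\sqrt\eta)\bigr),\qquad F_2(\eta)=\tfrac1{2\sqrt\eta}\bigl(\tilde V^0(p^*-\sqrt\eta)-\tilde V^0(p^*+\sqrt\eta)\bigr),$$ let $F_{1,2}(0)$ be the limits for $\eta\to0+$, and continue by $F_{1,2}(z)=3F_{1,2}(0)-3F_{1,2}(-z)+F_{1,2}(-2z)$ for $z<0$. Let $\Phi_1=p^*x+\omega_2(p^*)t$, $\Phi_2=p^*x-\omega_2(p^*)t$, $\varepsilon=(\mu/(q^*t))^{1/3}$, let $\mathrm{Ai}(z)=\frac1\pi\int_0^{\infty}\cos(zs+s^3/3)\,ds$ be the Airy function, and put $$a_1=e^{\frac i\mu\Phi_1}\mathcal B(p^*)\Bigl(F_1\bigl(-\tfrac{x-c^*t}{q^*t}\bigr)\mathrm{Ai}\bigl(\tfrac{x-c^*t}{\mu^{2/3}(q^*t)^{1/3}}\bigr)+i\varepsilon F_2\bigl(-\tfrac{x-c^*t}{q^*t}\bigr)\mathrm{Ai}'\bigl(\tfrac{x-c^*t}{\mu^{2/3}(q^*t)^{1/3}}\bigr)\Bigr),$$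 $$a_2=e^{\frac i\mu\Phi_2}\mathcal B(p^*)\Bigl(F_1\bigl(\tfrac{x+c^*t}{q^*t}\bigr)\mathrm{Ai}\bigl(-\tfrac{x+c^*t}{\mu^{2/3}(q^*t)^{1/3}}\bigr)-i\varepsilon F_2\bigl(\tfrac{x+c^*t}{q^*t}\bigr)\mathrm{Ai}'\bigl(-\tfrac{x+c^*t}{\mu^{2/3}(q^*t)^{1/3}}\bigr)\Bigr).$$ For every $W$, $0<t_0\le t_1$ and $K>0$ there are $C,\mu_0>0$ such that for all $0<\mu<\mu_0$ and $t\in[t_0,t_1]$, and with $a=a_1$ if $|x-c^*t|\le K\mu^{2/3}$, $a=a_2$ if $|x+c^*t|\le K\mu^{2/3}$, each of the two components ($j=1,2$) satisfies $$\bigl|\mathrm{Re}\,I^{opt}_j(x,t)-2\varepsilon\,\mathrm{Re}\,a_j\bigr|\le C\mu^{1/3}\,\varepsilon\,\bigl(N+\varepsilon\bigr),\qquad N=\max_k|\tilde V^0_k(p^*)| .$$ That is, $\mathrm{Re}\,I^{opt}$ equals $2(\mu/(q^*t))^{1/3}\,\mathrm{Re}\,a$ with an error that is $O(\mu^{1/3})$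 relative to the size of the amplitude: for every $\kappa>0$, wherever $|a_j|\ge\kappa(N+\varepsilon)$, one has $\mathrm{Re}\,I^{opt}_j=2\varepsilon\,\mathrm{Re}\,\bigl(a_j(1+\rho)\bigr)$ with some $\rho\in\mathbb C$, $|\rho|\le \frac C\kappa\mu^{1/3}$. -/

import Mathlib

namespace DiatomicLattice

open Complex Filter

noncomputable section

/-- The Airy function `Ai z = (1/π) ∫_0^∞ cos (z s + s³/3) ds`. The integral converges only
conditionally, so it is the limit of the integrals over `[0, R]`, `R → ∞`. -/
def airyAi (z : ℝ) : ℝ :=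
  limUnder atTop (fun R : ℝ => (1 / Real.pi) * ∫ s in (0 : ℝ)..R, Real.cos (z * s + s ^ 3 / 3))

/-- The derivative `Ai'`. -/
def airyAiDeriv (z : ℝ) : ℝ := deriv airyAi z

/-- `C(p) = √(γ₁² + γ₂² + 2 γ₁ γ₂ cos p)`. -/
def auxC (γ₁ γ₂ p : ℝ) : ℝ := Real.sqrt (γ₁ ^ 2 + γ₂ ^ 2 + 2 * γ₁ * γ₂ * Real.cos p)

/-- `G(p) = γ₂ - γ₁ + C(p)`. -/
def auxG (γ₁ γ₂ p : ℝ) : ℝ := γ₂ - γ₁ + auxC γ₁ γ₂ p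

/-- `J(p) = G(2p)² + 4 γ₁ γ₂ cos² p`. -/
def auxJ (γ₁ γ₂ p : ℝ) : ℝ := auxG γ₁ γ₂ (2 * p) ^ 2 + 4 * γ₁ * γ₂ * Real.cos p ^ 2

/-- The optical branch of the dispersion relation, `ω₂(p) = √(γ₁ + γ₂ + C(2p))`. -/
def omega₂ (γ₁ γ₂ p : ℝ) : ℝ := Real.sqrt (γ₁ + γ₂ + auxC γ₁ γ₂ (2 * p))

/-- The spectral projection `ℬ(p)` onto the optical mode. -/
def matB (γ₁ γ₂ p : ℝ) : Matrix (Fin 2) (Fin 2) ℝ :=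
  (1 / auxJ γ₁ γ₂ p) •
    !![4 * γ₁ * γ₂ * Real.cos p ^ 2, -(2 * γ₁ * auxG γ₁ γ₂ (2 * p) * Real.cos p);
       -(2 * γ₂ * auxG γ₁ γ₂ (2 * p) * Real.cos p), auxG γ₁ γ₂ (2 * p) ^ 2]

/-- `ℬ(p)` acting on complex vectors. -/
def applyB (γ₁ γ₂ p : ℝ) (v : Fin 2 → ℂ) : Fin 2 → ℂ :=
  ((matB γ₁ γ₂ p).map (fun r : ℝ => (r : ℂ))).mulVec v

/-- The vector `Ṽ⁰(p)` of the semi-discrete Fourier transforms of the initial perturbation on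
the even and on the odd sites of the lattice, for `δ = h / μ = 1`. -/
def tildeV (W : SchwartzMap ℝ ℝ) (p : ℝ) : Fin 2 → ℂ :=
  ![∑' k : ℤ, (W (2 * (k : ℝ)) : ℂ) * cexp (-I * (p : ℂ) * (2 * (k : ℂ))),
    ∑' k : ℤ, (W (2 * (k : ℝ) + 1) : ℂ) * cexp (-I * (p : ℂ) * (2 * (k : ℂ) + 1))]

/-- The optical part of the solution,
`I^opt(x,t) = (1/π) ∫_{-π/2}^{π/2} ℬ(p) Ṽ⁰(p) exp (i (p x + ω₂(p) t) / μ) dp`. -/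
def Iopt (γ₁ γ₂ : ℝ) (W : SchwartzMap ℝ ℝ) (μ x t : ℝ) : Fin 2 → ℂ := fun j =>
  (1 / (Real.pi : ℂ)) * ∫ p in (-(Real.pi / 2))..(Real.pi / 2),
    applyB γ₁ γ₂ p (tildeV W p) j * cexp (I * (((p * x + omega₂ γ₁ γ₂ p * t) / μ : ℝ) : ℂ))

/-- `c* = -ω₂'(p*)`. -/
def cStar (γ₁ γ₂ pstar : ℝ) : ℝ := -deriv (omega₂ γ₁ γ₂) pstar

/-- `q* = ω₂'''(p*) / 2`. -/
def qStar (γ₁ γ₂ pstar : ℝ) : ℝ := iteratedDeriv 3 (omega₂ γ₁ γ₂) pstar / 2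

/-- The three-point continuation to `z < 0` of a function given for `z ≥ 0`. -/
def threePointExt (F : ℝ → Fin 2 → ℂ) (z : ℝ) : Fin 2 → ℂ :=
  if 0 ≤ z then F z else (3 : ℂ) • F 0 - (3 : ℂ) • F (-z) + F (-2 * z)

/-- `F₁(η) = (Ṽ⁰(p* - √η) + Ṽ⁰(p* + √η)) / 2`, continued to `η < 0`. -/
def F₁ (W : SchwartzMap ℝ ℝ) (pstar : ℝ) : ℝ → Fin 2 → ℂ :=
  threePointExt fun η =>
    (1 / 2 : ℂ) • (tildeV W (-Real.sqrt η + pstar) + tildeV W (Real.sqrt η + pstar))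

/-- `F₂(η) = (Ṽ⁰(p* - √η) - Ṽ⁰(p* + √η)) / (2 √η)`, continued to `η < 0`. At `η = 0` the value
is the limit for `η → 0+`, which is `-(Ṽ⁰)'(p*)`. -/
def F₂ (W : SchwartzMap ℝ ℝ) (pstar : ℝ) : ℝ → Fin 2 → ℂ :=
  threePointExt fun η =>
    if η = 0 then -deriv (tildeV W) pstar
    else (1 / (2 * (Real.sqrt η : ℂ))) •
      (tildeV W (-Real.sqrt η + pstar) - tildeV W (Real.sqrt η + pstar))

/-- `Φ₁(p; x, t) = p x + ω₂(p) t`. -/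
def Phi₁ (γ₁ γ₂ p x t : ℝ) : ℝ := p * x + omega₂ γ₁ γ₂ p * t

/-- `Φ₂(p; x, t) = p x - ω₂(p) t`. -/
def Phi₂ (γ₁ γ₂ p x t : ℝ) : ℝ := p * x - omega₂ γ₁ γ₂ p * t

/-- The small parameter `ε = (μ / (q* t))^{1/3}`. -/
def eps (γ₁ γ₂ pstar μ t : ℝ) : ℝ := (μ / (qStar γ₁ γ₂ pstar * t)) ^ (1 / 3 : ℝ)

/-- The complex amplitude at the front `x = c* t`:
`e^{iΦ₁(p*)/μ} ℬ(p*) (F₁(-y/(q*t)) Ai(z) + i ε F₂(-y/(q*t)) Ai'(z))` with `y = x - c* t` and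
`z = y / (μ^{2/3} (q*t)^{1/3})`. -/
def ampRight (γ₁ γ₂ : ℝ) (W : SchwartzMap ℝ ℝ) (pstar μ x t : ℝ) : Fin 2 → ℂ :=
  let q := qStar γ₁ γ₂ pstar
  let y := x - cStar γ₁ γ₂ pstar * t
  let z := y / (μ ^ (2 / 3 : ℝ) * (q * t) ^ (1 / 3 : ℝ))
  cexp (I * ((Phi₁ γ₁ γ₂ pstar x t / μ : ℝ) : ℂ)) •
    applyB γ₁ γ₂ pstar
      ((airyAi z : ℂ) • F₁ W pstar (-(y / (q * t))) +
        (I * (eps γ₁ γ₂ pstar μ t : ℂ) * (airyAiDeriv z : ℂ)) • F₂ W pstar (-(y / (q * t))))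

/-- The complex amplitude at the front `x = -c* t`:
`e^{iΦ₂(p*)/μ} ℬ(p*) (F₁(y/(q*t)) Ai(-z) - i ε F₂(y/(q*t)) Ai'(-z))` with `y = x + c* t` and
`z = y / (μ^{2/3} (q*t)^{1/3})`. -/
def ampLeft (γ₁ γ₂ : ℝ) (W : SchwartzMap ℝ ℝ) (pstar μ x t : ℝ) : Fin 2 → ℂ :=
  let q := qStar γ₁ γ₂ pstar
  let y := x + cStar γ₁ γ₂ pstar * t
  let z := y / (μ ^ (2 / 3 : ℝ) * (q * t) ^ (1 / 3 : ℝ))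
  cexp (I * ((Phi₂ γ₁ γ₂ pstar x t / μ : ℝ) : ℂ)) •
    applyB γ₁ γ₂ pstar
      ((airyAi (-z) : ℂ) • F₁ W pstar (y / (q * t)) -
        (I * (eps γ₁ γ₂ pstar μ t : ℂ) * (airyAiDeriv (-z) : ℂ)) • F₂ W pstar (y / (q * t)))

/-- `Re u = 2 ε Re (a (1 + O(μ^{1/3})))` with constant `C`, where `ε` is the small parameter and
`N + ε` is the size of the amplitude `a` (`N` bounds its Airy part, `ε` its part with `Ai'`).
Both `Re u` and `Re a` change sign at different points, so the error is measured against
`N + ε`, and it is a factor `1 + ρ` wherever `|a|` is not small compared with `N + ε`. -/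
def FactorApprox (C μ ε N : ℝ) (u a : ℂ) : Prop :=
  |u.re - 2 * ε * a.re| ≤ C * μ ^ (1 / 3 : ℝ) * (ε * (N + ε)) ∧
    ∀ κ : ℝ, 0 < κ → κ * (N + ε) ≤ ‖a‖ →
      ∃ ρ : ℂ, ‖ρ‖ ≤ C / κ * μ ^ (1 / 3 : ℝ) ∧ u.re = 2 * ε * (a * (1 + ρ)).re

end

end DiatomicLattice

namespace DiatomicLattice

open Complex Filter Topology Set MeasureTheory
open scoped ContDiff ComplexConjugate

/-! ### Calculus of integrals over compact intervals -/

/-! At the right front write `x = c* t + y` and `p = p* + s`. The phase `(p x + ω₂(p) t) / μ`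
becomes `Φ₁ / μ + z s / ε + Θ(s) / ε³`, where `Θ(s) = (ω₂(p* + s) - ω₂(p*) + c* s) / q*` and `z`
stays bounded because `|y| ≤ K μ^{2/3}`. On `[-π/2, π/2]` the derivative `ω₂'` has its strict
minimum `-c*` at `p*` (`exists_inflection`). Hence `Θ' > 0` except at the origin, where `Θ(s) = s³/3
+ O(s⁴)`: the integral has a single stationary point, a degenerate one.

The analytic core is the moment bound `∫ sⁿ b(s) exp(i(z s/ε + Θ/ε³)) ds = O(ε^{n+1})`, uniform over
compact families of phases (`exists_norm_integral_pow_mul_scaledExp_le`). It lets one deform `Θ`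
linearly into `s³/3`. The derivative along the deformation carries a factor `ε⁻³ s⁴`, so with the
amplitude `g = g(0) + O(s)` the deformation costs `O(ε² |g(0)| + ε³)`
(`exists_norm_integral_cutoff_sub_cube_le`). For the cubic phase, the Taylor terms `g(0)` and `s
g'(0)` give `Ai` and `Ai'`, the rest is a second moment of size `ε³`, and the range away from the
stationary point contributes `O(ε³)` after one integration by parts. The result is
`exists_norm_integral_sub_airy_le`.

Here `g = ℬ Ṽ⁰`, while the stated amplitude uses `ℬ(p*)` with `F₁` and `F₂` at `η = O(ε²)`. Since
`F₁(η) = Ṽ⁰(p*) + O(η)` and `F₂(η) = -(Ṽ⁰)'(p*) + O(√η)`, the two differ by `O(ε²)` and by the term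
`ε ℬ'(p*) Ṽ⁰(p*)`, which is `O(ε N)` (`exists_norm_amplitude_sub_le`). This is why the error is
measured against `N + ε`. As `t` is bounded below, `ε` is at most a constant times `μ^{1/3}`.

The left front follows by `p ↦ -p`: `ω₂` and `ℬ` are even and `Ṽ⁰(-p)` is the conjugate of `Ṽ⁰(p)`.
The asymptotics there hold for the conjugate of `I^opt`, which has the same real part. -/

theorem hasDerivAt_intervalIntegral_of_continuous {E : Type*} [NormedAddCommGroup E]
    [NormedSpace ℝ E] {F F' : ℝ → ℝ → E} (a b : ℝ)
    (hF : Continuous (Function.uncurry F)) (hF' : Continuous (Function.uncurry F'))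
    (h : ∀ x s, HasDerivAt (fun x => F x s) (F' x s) x) (x₀ : ℝ) :
    HasDerivAt (fun x => ∫ s in a..b, F x s) (∫ s in a..b, F' x₀ s) x₀ := by
  obtain ⟨C, hC⟩ := ((isCompact_closedBall x₀ 1).prod
    (isCompact_uIcc (a := a) (b := b))).exists_bound_of_continuousOn hF'.continuousOn
  have hc : ∀ x, Continuous (F x) := fun x => hF.comp (by fun_prop : Continuous fun s => (x, s))
  have hc' : ∀ x, Continuous (F' x) := fun x => hF'.comp (by fun_prop : Continuous fun s => (x, s))
  refine (intervalIntegral.hasDerivAt_integral_of_dominated_loc_of_deriv_le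
    (bound := fun _ => C) (s := Metric.ball x₀ 1) (Metric.ball_mem_nhds _ one_pos)
    (Eventually.of_forall fun x => (hc x).aestronglyMeasurable)
    ((hc x₀).intervalIntegrable _ _) (hc' x₀).aestronglyMeasurable
    (Eventually.of_forall fun s hs x hx => ?_) (by simp)
    (Eventually.of_forall fun s _ x _ => h x s)).2
  exact hC (x, s) ⟨Metric.ball_subset_closedBall hx, uIoc_subset_uIcc hs⟩

/-- The averages `s ↦ ∫₀¹ vⁿ h(s v) dv` which occur in Taylor remainders. -/
noncomputable def taylorMean {E : Type*} [NormedAddCommGroup E] [NormedSpace ℝ E]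
    (n : ℕ) (h : ℝ → E) (s : ℝ) : E := ∫ v in (0 : ℝ)..1, v ^ n • h (s * v)

section TaylorMean

variable {E : Type*} [NormedAddCommGroup E] [NormedSpace ℝ E]

/-- Each derivative falling on `h (s * v)` releases one factor `v`. The weights `v ^ n` thus make
the class of means closed under differentiation, which yields smoothness by induction. -/
theorem hasDerivAt_taylorMean (n : ℕ) {h : ℝ → E} (hh : ContDiff ℝ ∞ h) (s : ℝ) :
    HasDerivAt (taylorMean n h) (taylorMean (n + 1) (deriv h) s) s := by
  have hd : Continuous (deriv h) := hh.continuous_deriv (by simp)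
  have hc := hh.continuous
  refine hasDerivAt_intervalIntegral_of_continuous (F := fun s v => v ^ n • h (s * v))
    (F' := fun s v => v ^ (n + 1) • deriv h (s * v)) 0 1 ?_ ?_ (fun x v => ?_) s
  · simp only [Function.uncurry_def]; fun_prop
  · simp only [Function.uncurry_def]; fun_prop
  · have h1 : HasDerivAt h (deriv h (x * v)) (x * v) :=
      (hh.differentiable (by simp) _).hasDerivAt
    have h2 := h1.scomp x ((hasDerivAt_id x).mul_const v)
    have h3 : HasDerivAt (fun x => v ^ n • h (x * v)) (v ^ n • ((1 * v) • deriv h (x * v))) x :=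
      h2.const_smul (v ^ n)
    rwa [one_mul, smul_smul, ← pow_succ] at h3

theorem contDiff_taylorMean (n : ℕ) {h : ℝ → E} (hh : ContDiff ℝ ∞ h) :
    ContDiff ℝ ∞ (taylorMean n h) := by
  rw [contDiff_infty]
  intro m
  induction m generalizing n h with
  | zero =>
    rw [Nat.cast_zero, contDiff_zero]
    exact continuous_iff_continuousAt.2 fun s => (hasDerivAt_taylorMean n hh s).continuousAt
  | succ m ih =>
    rw [Nat.cast_succ, contDiff_succ_iff_deriv]
    refine ⟨fun s => (hasDerivAt_taylorMean n hh s).differentiableAt, by simp, ?_⟩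
    rw [show deriv (taylorMean n h) = taylorMean (n + 1) (deriv h) from
      funext fun s => (hasDerivAt_taylorMean n hh s).deriv]
    exact ih (n + 1) (contDiff_infty_iff_deriv.1 hh).2

variable [CompleteSpace E]

/-- Hadamard's lemma on the real line. -/
theorem sub_eq_smul_taylorMean {h : ℝ → E} (hh : ContDiff ℝ ∞ h) (s : ℝ) :
    h s - h 0 = s • taylorMean 0 (deriv h) s := by
  have hd : Continuous (deriv h) := hh.continuous_deriv (by simp)
  have key : ∀ v ∈ uIcc (0 : ℝ) 1, HasDerivAt (fun v => h (s * v)) (s • deriv h (s * v)) v := by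
    intro v _
    have h1 : HasDerivAt h (deriv h (s * v)) (s * v) :=
      (hh.differentiable (by simp) _).hasDerivAt
    have h2 : HasDerivAt (fun v => h (s * v)) ((s * 1) • deriv h (s * v)) v :=
      h1.scomp v ((hasDerivAt_id v).const_mul s)
    rwa [mul_one] at h2
  have := intervalIntegral.integral_eq_sub_of_hasDerivAt key
    ((by fun_prop : Continuous fun v => s • deriv h (s * v)).intervalIntegrable _ _)
  rw [intervalIntegral.integral_smul] at this
  simp only [mul_one, mul_zero] at this
  simp [taylorMean, this]

theorem taylorMean_zero (n : ℕ) (h : ℝ → E) : taylorMean n h 0 = (1 / (n + 1 : ℝ)) • h 0 := by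
  simp [taylorMean, intervalIntegral.integral_smul_const]

/-- An antiderivative of `u^n • l u` vanishing at the origin is divisible by `s ^ (n + 1)`. -/
theorem eq_pow_smul_taylorMean {n : ℕ} {F l : ℝ → E} (hl : ContDiff ℝ ∞ l)
    (hF : ∀ s, HasDerivAt F (s ^ n • l s) s) (h0 : F 0 = 0) (s : ℝ) :
    F s = s ^ (n + 1) • taylorMean n l s := by
  have hc := hl.continuous
  have key : ∀ v ∈ uIcc (0 : ℝ) 1,
      HasDerivAt (fun v => F (s * v)) (s ^ (n + 1) • (v ^ n • l (s * v))) v := by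
    intro v _
    have h2 : HasDerivAt (fun v => F (s * v)) ((s * 1) • ((s * v) ^ n • l (s * v))) v :=
      (hF (s * v)).scomp v ((hasDerivAt_id v).const_mul s)
    rw [smul_smul] at h2 ⊢
    rwa [show s ^ (n + 1) * v ^ n = s * 1 * (s * v) ^ n by ring]
  have := intervalIntegral.integral_eq_sub_of_hasDerivAt key
    ((by fun_prop : Continuous fun v => s ^ (n + 1) • (v ^ n • l (s * v))).intervalIntegrable _ _)
  rw [intervalIntegral.integral_smul] at this
  simp only [mul_one, mul_zero, h0, sub_zero] at this
  rw [← this]; rfl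

end TaylorMean

/-! ### Integration by parts for oscillatory integrals -/

theorem hasDerivAt_cexp_phase {ψ : ℝ → ℝ} {ψ' s : ℝ} (h : HasDerivAt ψ ψ' s) :
    HasDerivAt (fun s => cexp (I * (ψ s : ℂ))) (I * (ψ' : ℂ) * cexp (I * (ψ s : ℂ))) s := by
  have := ((h.ofReal_comp).const_mul I).cexp
  rwa [mul_comm] at this

theorem norm_cexp_phase (x : ℝ) : ‖cexp (I * (x : ℂ))‖ = 1 := norm_exp_I_mul_ofReal x

theorem integral_mul_deriv_cexp_phase {a b : ℝ} {u u' : ℝ → ℂ} {ψ ψ' : ℝ → ℝ}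
    (hu : ∀ s ∈ uIcc a b, HasDerivAt u (u' s) s) (hψ : ∀ s ∈ uIcc a b, HasDerivAt ψ (ψ' s) s)
    (hu' : ContinuousOn u' (uIcc a b)) (hψ' : ContinuousOn ψ' (uIcc a b)) :
    ∫ s in a..b, u s * (I * (ψ' s : ℂ) * cexp (I * (ψ s : ℂ))) =
      u b * cexp (I * (ψ b : ℂ)) - u a * cexp (I * (ψ a : ℂ)) -
        ∫ s in a..b, u' s * cexp (I * (ψ s : ℂ)) := by
  refine intervalIntegral.integral_mul_deriv_eq_deriv_mul hu
    (fun s hs => hasDerivAt_cexp_phase (hψ s hs)) hu'.intervalIntegrable ?_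
  have h1 : ContinuousOn ψ (uIcc a b) := fun s hs => (hψ s hs).continuousAt.continuousWithinAt
  exact ContinuousOn.intervalIntegrable (by fun_prop)

/-- One integration by parts in an oscillatory integral without stationary points. -/
theorem norm_integral_mul_cexp_phase_le {a b : ℝ} (hab : a ≤ b) {v v' : ℝ → ℂ}
    {ψ ψ' ψ'' B : ℝ → ℝ} (hv : ∀ s ∈ Icc a b, HasDerivAt v (v' s) s)
    (hψ : ∀ s ∈ Icc a b, HasDerivAt ψ (ψ' s) s) (hψ' : ∀ s ∈ Icc a b, HasDerivAt ψ' (ψ'' s) s)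
    (hv'c : ContinuousOn v' (Icc a b)) (hψ''c : ContinuousOn ψ'' (Icc a b))
    (hpos : ∀ s ∈ Icc a b, 0 < ψ' s) (hB : ContinuousOn B (Icc a b))
    (hbound : ∀ s ∈ Icc a b, ‖v' s‖ / ψ' s + ‖v s‖ * |ψ'' s| / ψ' s ^ 2 ≤ B s) :
    ‖∫ s in a..b, v s * cexp (I * (ψ s : ℂ))‖ ≤
      ‖v a‖ / ψ' a + ‖v b‖ / ψ' b + ∫ s in a..b, B s := by
  rw [← uIcc_of_le hab] at hv hψ hψ' hv'c hψ''c hpos hB hbound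
  have hvc : ContinuousOn v (uIcc a b) := fun s hs => (hv s hs).continuousAt.continuousWithinAt
  have hψc : ContinuousOn ψ (uIcc a b) := fun s hs => (hψ s hs).continuousAt.continuousWithinAt
  have hψ'c : ContinuousOn ψ' (uIcc a b) := fun s hs => (hψ' s hs).continuousAt.continuousWithinAt
  have hne : ∀ s ∈ uIcc a b, (I * (ψ' s : ℂ)) ≠ 0 := fun s hs =>
    mul_ne_zero I_ne_zero (ofReal_ne_zero.2 (hpos s hs).ne')
  -- Dividing by `I ψ'` turns the integrand into `u` times the derivative of the exponential.
  set u : ℝ → ℂ := fun s => v s / (I * (ψ' s : ℂ)) with hu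
  set u' : ℝ → ℂ := fun s =>
    (v' s * (I * (ψ' s : ℂ)) - v s * (I * (ψ'' s : ℂ))) / (I * (ψ' s : ℂ)) ^ 2 with hu'
  have hud : ∀ s ∈ uIcc a b, HasDerivAt u (u' s) s := fun s hs =>
    (hv s hs).div ((hψ' s hs).ofReal_comp.const_mul I) (hne s hs)
  have hu'c : ContinuousOn u' (uIcc a b) := by
    refine ContinuousOn.div (by fun_prop) (by fun_prop) fun s hs => pow_ne_zero 2 (hne s hs)
  have hunorm : ∀ s ∈ uIcc a b, ‖u s‖ = ‖v s‖ / ψ' s := fun s hs => by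
    simp [hu, abs_of_pos (hpos s hs)]
  have key : ∫ s in a..b, v s * cexp (I * (ψ s : ℂ)) =
      ∫ s in a..b, u s * (I * (ψ' s : ℂ) * cexp (I * (ψ s : ℂ))) := by
    refine intervalIntegral.integral_congr fun s hs => ?_
    have := hne s hs
    simp only [hu]
    rw [← mul_assoc, div_mul_cancel₀ _ this]
  rw [key, integral_mul_deriv_cexp_phase hud hψ hu'c hψ'c]
  have hlast : ‖∫ s in a..b, u' s * cexp (I * (ψ s : ℂ))‖ ≤ ∫ s in a..b, B s := by
    refine intervalIntegral.norm_integral_le_of_norm_le hab (ae_of_all _ fun s hs => ?_)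
      hB.intervalIntegrable
    have hs' : s ∈ uIcc a b := by rw [uIcc_of_le hab]; exact Ioc_subset_Icc_self hs
    rw [norm_mul, norm_cexp_phase, mul_one]
    refine le_trans ?_ (hbound s hs')
    have hp := hpos s hs'
    rw [hu', norm_div, norm_pow, norm_mul I, norm_I, one_mul, norm_real, Real.norm_eq_abs,
      abs_of_pos hp]
    have : ‖v' s * (I * (ψ' s : ℂ)) - v s * (I * (ψ'' s : ℂ))‖ ≤
        ‖v' s‖ * ψ' s + ‖v s‖ * |ψ'' s| := by
      refine (norm_sub_le _ _).trans (le_of_eq ?_)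
      simp [abs_of_pos hp]
    refine (div_le_div_of_nonneg_right this (by positivity)).trans (le_of_eq ?_)
    field_simp
  have ha := hunorm a left_mem_uIcc
  have hb := hunorm b right_mem_uIcc
  calc _ ≤ ‖u b * cexp (I * (ψ b : ℂ)) - u a * cexp (I * (ψ a : ℂ))‖ + _ := norm_sub_le _ _
    _ ≤ (‖u b * cexp (I * (ψ b : ℂ))‖ + ‖u a * cexp (I * (ψ a : ℂ))‖) + ∫ s in a..b, B s :=
        add_le_add (norm_sub_le _ _) hlast
    _ = _ := by rw [norm_mul, norm_mul, norm_cexp_phase, norm_cexp_phase, ha, hb]; ring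

/-! ### The Airy function -/

/-- The exponential `exp (i (z σ + σ³ / 3))`. -/
noncomputable def airyExp (z σ : ℝ) : ℂ := cexp (I * ((z * σ + σ ^ 3 / 3 : ℝ) : ℂ))

theorem continuous_airyExp : Continuous (Function.uncurry airyExp) := by
  simp only [Function.uncurry_def, airyExp]; fun_prop

theorem continuous_airyExp_right (z : ℝ) : Continuous (airyExp z) := by
  unfold airyExp; fun_prop

theorem airyExp_neg (z σ : ℝ) : airyExp z (-σ) = conj (airyExp z σ) := by
  rw [airyExp, airyExp, ← exp_conj, map_mul, conj_I, conj_ofReal]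
  congr 1
  push_cast
  ring

theorem integral_inv_sq_le {R R' : ℝ} (hR : 0 < R) (h : R ≤ R') :
    ∫ σ in R..R', 1 / σ ^ 2 ≤ 1 / R := by
  have hpos : ∀ σ ∈ uIcc R R', 0 < σ := fun σ hσ => by
    rw [uIcc_of_le h] at hσ; exact hR.trans_le hσ.1
  have hd : ∀ σ ∈ uIcc R R', HasDerivAt (fun σ : ℝ => -σ⁻¹) (1 / σ ^ 2) σ := fun σ hσ => by
    have := (hasDerivAt_inv (hpos σ hσ).ne').neg
    rw [neg_neg] at this
    rwa [one_div]
  rw [intervalIntegral.integral_eq_sub_of_hasDerivAt hd]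
  · have : 0 < R'⁻¹ := inv_pos.2 (hR.trans_le h)
    rw [one_div]; linarith
  · refine ContinuousOn.intervalIntegrable (ContinuousOn.div (by fun_prop) (by fun_prop) ?_)
    exact fun σ hσ => pow_ne_zero 2 (hpos σ hσ).ne'

/-- Tails of Airy type integrals, uniformly for bounded `z`. -/
theorem norm_integral_mul_airyExp_le {j : ℕ} (hj : j ≤ 1) {z K R R' M : ℝ} (hz : |z| ≤ K)
    (hR : 0 < R) (hKR : 2 * K ≤ R ^ 2) (hRR' : R ≤ R') {v v' : ℝ → ℂ}
    (hv : ∀ σ ∈ Icc R R', HasDerivAt v (v' σ) σ) (hv'c : ContinuousOn v' (Icc R R'))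
    (hvM : ∀ σ ∈ Icc R R', ‖v σ‖ ≤ M * σ ^ j)
    (hv'M : ∀ σ ∈ Icc R R', ‖v' σ‖ * σ ≤ M * σ ^ j) :
    ‖∫ σ in R..R', v σ * airyExp z σ‖ ≤ 14 * M * (R ^ j / R ^ 2) := by
  have hM : 0 ≤ M := by
    have := (norm_nonneg _).trans (hvM R (left_mem_Icc.2 hRR'))
    exact nonneg_of_mul_nonneg_left this (by positivity)
  have hR' : 0 < R' := hR.trans_le hRR'
  have hpos : ∀ σ ∈ Icc R R', 0 < σ := fun σ hσ => hR.trans_le hσ.1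
  have hψ : ∀ σ ∈ Icc R R', σ ^ 2 / 2 ≤ z + σ ^ 2 := fun σ hσ => by
    have h1 : R ^ 2 ≤ σ ^ 2 := pow_le_pow_left₀ hR.le hσ.1 2
    have := neg_abs_le z
    linarith
  have hjR : ∀ σ ∈ Icc R R', σ ^ j / σ ≤ R ^ j / R := fun σ hσ => by
    have := hpos σ hσ
    interval_cases j
    · simpa using inv_anti₀ hR hσ.1
    · simp [hR.ne', this.ne']
  -- Since `z + σ² ≥ σ²/2`, the term with `v'` contributes 2 and the term with `ψ'' = 2σ`
  -- contributes 8 to the factor 10. The two boundary terms add 2 each, which makes 14.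
  have hB0 := norm_integral_mul_cexp_phase_le (ψ := fun σ => z * σ + σ ^ 3 / 3)
    (ψ' := fun σ => z + σ ^ 2) (ψ'' := fun σ => 2 * σ) (v := v) (v' := v')
    (B := fun σ => 10 * M * (R ^ j / R) * (1 / σ ^ 2)) hRR' hv
    (fun σ _ => by
      exact (((hasDerivAt_id' σ).const_mul z).fun_add
        (((hasDerivAt_id' σ).fun_pow 3).div_const 3)).congr_deriv (by push_cast; ring))
    (fun σ _ => by
      exact (((hasDerivAt_id' σ).fun_pow 2).const_add z).congr_deriv (by push_cast; ring)) hv'c (by fun_prop)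
    (fun σ hσ => lt_of_lt_of_le (by have := hpos σ hσ; positivity) (hψ σ hσ))
    (ContinuousOn.mul (by fun_prop) (ContinuousOn.div (by fun_prop) (by fun_prop)
      fun σ hσ => pow_ne_zero 2 (hpos σ hσ).ne'))
    (fun σ hσ => by
      have h0 := hpos σ hσ
      have h1 := hψ σ hσ
      have h2 : ‖v' σ‖ / (z + σ ^ 2) ≤ (M * σ ^ j / σ) / (σ ^ 2 / 2) :=
        div_le_div₀ (by positivity) ((le_div_iff₀ h0).2 (hv'M σ hσ)) (by positivity) h1
      have h3 : ‖v σ‖ * |2 * σ| / (z + σ ^ 2) ^ 2 ≤ (M * σ ^ j) * (2 * σ) / (σ ^ 2 / 2) ^ 2 := by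
        rw [abs_of_pos (by positivity : 0 < 2 * σ)]
        exact div_le_div₀ (by positivity) (mul_le_mul_of_nonneg_right (hvM σ hσ) (by positivity))
          (by positivity) (pow_le_pow_left₀ (by positivity) h1 2)
      have h4 : (M * σ ^ j / σ) / (σ ^ 2 / 2) + (M * σ ^ j) * (2 * σ) / (σ ^ 2 / 2) ^ 2 =
          10 * M * (σ ^ j / σ) * (1 / σ ^ 2) := by field_simp; ring
      have h5 : 10 * M * (σ ^ j / σ) * (1 / σ ^ 2) ≤ 10 * M * (R ^ j / R) * (1 / σ ^ 2) := by
        have := hjR σ hσ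
        gcongr
      linarith)
  refine hB0.trans ?_
  have hend : ∀ σ ∈ Icc R R', ‖v σ‖ / (z + σ ^ 2) ≤ 2 * M * (R ^ j / R ^ 2) := fun σ hσ => by
    have h0 := hpos σ hσ
    calc ‖v σ‖ / (z + σ ^ 2) ≤ (M * σ ^ j) / (σ ^ 2 / 2) :=
          div_le_div₀ (by positivity) (hvM σ hσ) (by positivity) (hψ σ hσ)
      _ = 2 * M * (σ ^ j / σ * (1 / σ)) := by field_simp
      _ ≤ 2 * M * (R ^ j / R * (1 / R)) := by
          have := hjR σ hσ
          have := hσ.1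
          gcongr
      _ = _ := by field_simp
  have hint : ∫ σ in R..R', 10 * M * (R ^ j / R) * (1 / σ ^ 2) ≤ 10 * M * (R ^ j / R ^ 2) := by
    rw [intervalIntegral.integral_const_mul]
    calc _ ≤ 10 * M * (R ^ j / R) * (1 / R) :=
          mul_le_mul_of_nonneg_left (integral_inv_sq_le hR hRR') (by positivity)
      _ = _ := by field_simp
  linarith [hend R (left_mem_Icc.2 hRR'), hend R' (right_mem_Icc.2 hRR')]

/-- The truncated moments `∫₀ᴿ σ^j exp (i (z σ + σ³ / 3)) dσ`. -/
noncomputable def airyCut (j : ℕ) (z R : ℝ) : ℂ := ∫ σ in (0 : ℝ)..R, (σ : ℂ) ^ j * airyExp z σ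

theorem intervalIntegrable_pow_mul_airyExp (j : ℕ) (z a b : ℝ) :
    IntervalIntegrable (fun σ : ℝ => (σ : ℂ) ^ j * airyExp z σ) volume a b := by
  have := continuous_airyExp_right z
  exact Continuous.intervalIntegrable (by fun_prop) _ _

theorem norm_airyCut_sub_le {j : ℕ} (hj : j ≤ 1) {z K R R' : ℝ} (hz : |z| ≤ K)
    (hR : 0 < R) (hKR : 2 * K ≤ R ^ 2) (hRR' : R ≤ R') :
    ‖airyCut j z R' - airyCut j z R‖ ≤ 14 * (R ^ j / R ^ 2) := by
  rw [airyCut, airyCut, intervalIntegral.integral_interval_sub_left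
    (intervalIntegrable_pow_mul_airyExp j z _ _) (intervalIntegrable_pow_mul_airyExp j z _ _)]
  have := norm_integral_mul_airyExp_le (M := 1) hj hz hR hKR hRR' (v := fun σ => (σ : ℂ) ^ j)
    (v' := fun σ => j * (σ : ℂ) ^ (j - 1))
    (fun σ _ => ((hasDerivAt_id' σ).ofReal_comp.fun_pow j).congr_deriv (by simp)) (by fun_prop)
    (fun σ hσ => by
      have : 0 < σ := hR.trans_le hσ.1
      simp [abs_of_pos this])
    (fun σ hσ => by
      have : 0 < σ := hR.trans_le hσ.1
      interval_cases j <;> simp)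
  simpa using this

/-- The tail bound `14 R^j / R²` decays for `j ≤ 1` without absolute integrability. This is what
makes the improper integrals behind `Ai` and `Ai'` converge. -/
theorem cauchySeq_airyCut {j : ℕ} (hj : j ≤ 1) (z : ℝ) : CauchySeq (airyCut j z) := by
  rw [Metric.cauchySeq_iff']
  intro δ hδ
  set N : ℝ := 1 + 2 * |z| + 14 / δ with hN
  have hz := abs_nonneg z
  have h14 : 0 < 14 / δ := by positivity
  refine ⟨N, fun R hR => ?_⟩
  have hN1 : 1 ≤ N := by linarith
  rw [dist_eq_norm]
  refine (norm_airyCut_sub_le hj (le_refl |z|) (by linarith) (by nlinarith) hR).trans_lt ?_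
  have h1 : N ^ j / N ^ 2 ≤ 1 / N := by
    rw [div_le_div_iff₀ (by positivity) (by linarith)]
    interval_cases j <;> nlinarith
  have h2 : 14 * (1 / N) < δ := by
    rw [mul_one_div, div_lt_iff₀ (by linarith)]
    have : δ * (14 / δ) = 14 := by field_simp
    nlinarith
  linarith

/-- The moments `∫₀^∞ σ^j exp (i (z σ + σ³ / 3)) dσ`, `j ≤ 1`, as improper integrals. -/
noncomputable def airyMoment (j : ℕ) (z : ℝ) : ℂ := limUnder atTop (airyCut j z)

theorem tendsto_airyCut {j : ℕ} (hj : j ≤ 1) (z : ℝ) :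
    Tendsto (airyCut j z) atTop (𝓝 (airyMoment j z)) :=
  (cauchySeq_airyCut hj z).tendsto_limUnder

theorem norm_airyMoment_sub_le {j : ℕ} (hj : j ≤ 1) {z K R : ℝ} (hz : |z| ≤ K)
    (hR : 0 < R) (hKR : 2 * K ≤ R ^ 2) :
    ‖airyMoment j z - airyCut j z R‖ ≤ 14 * (R ^ j / R ^ 2) := by
  refine le_of_tendsto ((tendsto_airyCut hj z).sub_const _).norm ?_
  filter_upwards [eventually_ge_atTop R] with R' hR'
  exact norm_airyCut_sub_le hj hz hR hKR hR'

theorem exists_norm_airyMoment_le {j : ℕ} (hj : j ≤ 1) (K : ℝ) :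
    ∃ C, ∀ z, |z| ≤ K → ‖airyMoment j z‖ ≤ C := by
  set R : ℝ := 1 + 2 * |K| with hR
  have hK := abs_nonneg K
  have hR1 : 1 ≤ R := by linarith
  refine ⟨14 * (R ^ j / R ^ 2) + R ^ j * R, fun z hz => ?_⟩
  have h1 := norm_airyMoment_sub_le hj hz (R := R) (by linarith) (by
    have := le_abs_self K; nlinarith)
  have h2 : ‖airyCut j z R‖ ≤ R ^ j * |R - 0| := by
    refine intervalIntegral.norm_integral_le_of_norm_le_const fun σ hσ => ?_
    rw [uIoc_of_le (by linarith)] at hσ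
    rw [norm_mul, airyExp, norm_cexp_phase, mul_one, norm_pow, norm_real, Real.norm_eq_abs,
      abs_of_pos hσ.1]
    exact pow_le_pow_left₀ hσ.1.le hσ.2 j
  rw [sub_zero, abs_of_pos (by linarith)] at h2
  calc ‖airyMoment j z‖ = ‖(airyMoment j z - airyCut j z R) + airyCut j z R‖ := by simp
    _ ≤ _ := (norm_add_le _ _).trans (add_le_add h1 h2)

theorem hasDerivAt_airyCut (R z : ℝ) :
    HasDerivAt (fun z => airyCut 0 z R) (I * airyCut 1 z R) z := by
  have h := continuous_airyExp
  simp only [Function.uncurry_def] at h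
  have := hasDerivAt_intervalIntegral_of_continuous (F := fun z σ : ℝ => (σ : ℂ) ^ 0 * airyExp z σ)
    (F' := fun z σ : ℝ => I * ((σ : ℂ) ^ 1 * airyExp z σ)) 0 R
    (by simp only [Function.uncurry_def]; fun_prop)
    (by simp only [Function.uncurry_def]; fun_prop) (fun z σ => by
      have h1 : HasDerivAt (fun z : ℝ => z * σ + σ ^ 3 / 3) σ z := by
        simpa using ((hasDerivAt_id z).mul_const σ).add_const (σ ^ 3 / 3)
      have h2 := hasDerivAt_cexp_phase h1
      simp only [pow_zero, one_mul, pow_one, airyExp]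
      rwa [← mul_assoc]) z
  rwa [intervalIntegral.integral_const_mul] at this

/-- The integrals converge only conditionally, so domination is not available. Instead the
derivatives of the truncated integrals converge uniformly on balls, because the tail bound depends
on `z` only through a bound for `|z|`. -/
theorem hasDerivAt_airyMoment (z : ℝ) : HasDerivAt (airyMoment 0) (I * airyMoment 1 z) z := by
  set K : ℝ := |z| + 1 with hK
  have hz0 := abs_nonneg z
  have hunif : TendstoUniformlyOn (fun R z => I * airyCut 1 z R) (fun z => I * airyMoment 1 z)
      atTop (Metric.ball 0 K) := by
    rw [Metric.tendstoUniformlyOn_iff]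
    intro δ hδ
    have h14 : 0 < 14 / δ := by positivity
    filter_upwards [eventually_ge_atTop (1 + 2 * K + 14 / δ)] with R hR w hw
    have hw' : |w| ≤ K := by simpa using (mem_ball_zero_iff.1 hw).le
    have hR1 : 1 ≤ R := by linarith
    have h := norm_airyMoment_sub_le le_rfl hw' (R := R) (by linarith) (by nlinarith)
    rw [dist_eq_norm, ← mul_sub, norm_mul, norm_I, one_mul]
    refine h.trans_lt ?_
    rw [pow_one, sq, div_mul_cancel_left₀ (by linarith), ← div_eq_mul_inv,
      div_lt_iff₀ (by linarith)]
    have : δ * (14 / δ) = 14 := by field_simp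
    nlinarith
  refine hasDerivAt_of_tendstoUniformlyOn Metric.isOpen_ball hunif
    (Eventually.of_forall fun R w _ => hasDerivAt_airyCut R w)
    (fun w _ => tendsto_airyCut zero_le_one w) ?_
  simp [hK]

theorem re_airyExp (z σ : ℝ) : (airyExp z σ).re = Real.cos (z * σ + σ ^ 3 / 3) := by
  rw [airyExp, mul_comm, exp_ofReal_mul_I_re]

theorem airyAi_eq (z : ℝ) : airyAi z = (1 / Real.pi) * (airyMoment 0 z).re := by
  refine Tendsto.limUnder_eq (Tendsto.const_mul _ ?_)
  have h := (continuous_re.tendsto _).comp (tendsto_airyCut zero_le_one z)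
  refine h.congr fun R => ?_
  have h2 := intervalIntegrable_pow_mul_airyExp 0 z 0 R
  have h3 : (airyCut 0 z R).re = ∫ σ in (0 : ℝ)..R, ((σ : ℂ) ^ 0 * airyExp z σ).re :=
    (reCLM.intervalIntegral_comp_comm h2).symm
  simp only [Function.comp_apply, h3, pow_zero, one_mul, re_airyExp]

theorem airyAiDeriv_eq (z : ℝ) : airyAiDeriv z = -((1 / Real.pi) * (airyMoment 1 z).im) := by
  have h1 : HasDerivAt (fun z => (airyMoment 0 z).re) (I * airyMoment 1 z).re z :=
    reCLM.hasFDerivAt.comp_hasDerivAt z (hasDerivAt_airyMoment z)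
  have h2 := h1.const_mul (1 / Real.pi)
  rw [airyAiDeriv, show airyAi = fun z => (1 / Real.pi) * (airyMoment 0 z).re from
    funext airyAi_eq, h2.deriv]
  simp

theorem exists_abs_airyAi_le (K : ℝ) :
    ∃ C, ∀ z, |z| ≤ K → |airyAi z| ≤ C ∧ |airyAiDeriv z| ≤ C := by
  obtain ⟨C₀, h₀⟩ := exists_norm_airyMoment_le zero_le_one K
  obtain ⟨C₁, h₁⟩ := exists_norm_airyMoment_le le_rfl K
  have hπ : (0 : ℝ) ≤ 1 / Real.pi := by positivity
  refine ⟨(1 / Real.pi) * max C₀ C₁, fun z hz => ⟨?_, ?_⟩⟩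
  · rw [airyAi_eq, abs_mul, abs_of_nonneg hπ]
    exact mul_le_mul_of_nonneg_left
      ((abs_re_le_norm _).trans ((h₀ z hz).trans (le_max_left _ _))) hπ
  · rw [airyAiDeriv_eq, abs_neg, abs_mul, abs_of_nonneg hπ]
    exact mul_le_mul_of_nonneg_left
      ((abs_im_le_norm _).trans ((h₁ z hz).trans (le_max_right _ _))) hπ

/-! ### Oscillatory integrals with a degenerate stationary point -/

/-- The exponential `exp (i (z s / ε + Θ(s) / ε³))`. -/
noncomputable def scaledExp (Θ : ℝ → ℝ) (z ε s : ℝ) : ℂ :=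
  cexp (I * ((z * (s / ε) + Θ s / ε ^ 3 : ℝ) : ℂ))

theorem norm_scaledExp (Θ : ℝ → ℝ) (z ε s : ℝ) : ‖scaledExp Θ z ε s‖ = 1 := norm_cexp_phase _

theorem continuousOn_scaledExp {Θ : ℝ → ℝ} {S : Set ℝ} (h : ContinuousOn Θ S) (z ε : ℝ) :
    ContinuousOn (scaledExp Θ z ε) S := by
  unfold scaledExp; fun_prop

/-- Integration by parts against `scaledExp` for a function vanishing at both ends. -/
theorem integral_mul_scaledExp_by_parts {r z ε : ℝ} (hε : 0 < ε) {Θ f : ℝ → ℝ}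
    {u u' : ℝ → ℂ} (hΘ : ∀ s ∈ uIcc (-r) r, HasDerivAt Θ (f s) s)
    (hf : ContinuousOn f (uIcc (-r) r)) (hu : ∀ s ∈ uIcc (-r) r, HasDerivAt u (u' s) s)
    (hu' : ContinuousOn u' (uIcc (-r) r)) (hl : u (-r) = 0) (hr : u r = 0) :
    ∫ s in (-r)..r, (f s : ℂ) * u s * scaledExp Θ z ε s =
      I * ε ^ 3 * (∫ s in (-r)..r, u' s * scaledExp Θ z ε s) -
        z * ε ^ 2 * ∫ s in (-r)..r, u s * scaledExp Θ z ε s := by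
  have hΘc : ContinuousOn Θ (uIcc (-r) r) := fun s hs => (hΘ s hs).continuousAt.continuousWithinAt
  have huc : ContinuousOn u (uIcc (-r) r) := fun s hs => (hu s hs).continuousAt.continuousWithinAt
  have hE := continuousOn_scaledExp hΘc z ε
  have h := integral_mul_deriv_cexp_phase (ψ := fun s => z * (s / ε) + Θ s / ε ^ 3)
    (ψ' := fun s => z * (1 / ε) + f s / ε ^ 3) hu
    (fun s hs => (((hasDerivAt_id' s).div_const ε).const_mul z).fun_add
      ((hΘ s hs).div_const (ε ^ 3))) hu' (by fun_prop)
  rw [hl, hr] at h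
  simp only [zero_mul, sub_zero, zero_sub] at h
  have h1 : ∫ s in (-r)..r, u s * (I * ((z * (1 / ε) + f s / ε ^ 3 : ℝ) : ℂ) *
      cexp (I * ((z * (s / ε) + Θ s / ε ^ 3 : ℝ) : ℂ))) =
      (I * z / ε) * (∫ s in (-r)..r, u s * scaledExp Θ z ε s) +
      (I / ε ^ 3) * ∫ s in (-r)..r, (f s : ℂ) * u s * scaledExp Θ z ε s := by
    rw [← intervalIntegral.integral_const_mul, ← intervalIntegral.integral_const_mul,
      ← intervalIntegral.integral_add]
    · refine intervalIntegral.integral_congr fun s _ => ?_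
      simp only [scaledExp]
      push_cast
      ring
    · exact ContinuousOn.intervalIntegrable (by fun_prop)
    · exact ContinuousOn.intervalIntegrable (by fun_prop)
  rw [h1] at h
  have hε' : (ε : ℂ) ≠ 0 := ofReal_ne_zero.2 hε.ne'
  set X := ∫ s in (-r)..r, (f s : ℂ) * u s * scaledExp Θ z ε s
  set Y := ∫ s in (-r)..r, u s * scaledExp Θ z ε s
  have h2 : ∫ s in (-r)..r, u' s * scaledExp Θ z ε s = -(I * z / ε * Y + I / ε ^ 3 * X) := by
    rw [h, neg_neg]; rfl
  rw [h2]
  field_simp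
  linear_combination (X + ε ^ 2 * z * Y) * I_sq

/-- An integrable profile of width `ε`: it supplies one factor `ε` in the moment bounds. -/
theorem integral_one_div_one_add_sq_le {κ ε r : ℝ} (hκ : 0 < κ) (hε : 0 < ε) :
    ∫ s in (-r)..r, 1 / (1 + κ * (s / ε) ^ 2) ≤ Real.pi / Real.sqrt κ * ε := by
  set c := Real.sqrt κ / ε with hc
  have hc0 : 0 < c := div_pos (Real.sqrt_pos.2 hκ) hε
  have hd : ∀ s ∈ uIcc (-r) r, HasDerivAt (fun s => Real.arctan (c * s) / c)
      (1 / (1 + κ * (s / ε) ^ 2)) s := fun s _ => by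
    have := (((hasDerivAt_id' s).const_mul c).arctan).div_const c
    refine this.congr_deriv ?_
    have h1 : (c * s) ^ 2 = κ * (s / ε) ^ 2 := by
      rw [hc, mul_pow, div_pow, Real.sq_sqrt hκ.le]; ring
    rw [h1]; field_simp
  rw [intervalIntegral.integral_eq_sub_of_hasDerivAt hd]
  · have h1 := Real.arctan_lt_pi_div_two (c * r)
    have h2 := Real.neg_pi_div_two_lt_arctan (c * -r)
    have h3 : Real.pi / Real.sqrt κ * ε = Real.pi / c := by rw [hc]; field_simp
    rw [h3, ← sub_div]
    exact div_le_div_of_nonneg_right (by linarith) hc0.le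
  · refine Continuous.intervalIntegrable (Continuous.div (by fun_prop) (by fun_prop) ?_) _ _
    intro s; positivity

set_option maxHeartbeats 1000000 in
/-- Uniform bounds `O(ε)` and `O(ε²)` for the first two moments of an oscillatory integral with a
phase which is degenerate at the origin. -/
theorem exists_norm_integral_scaledExp_le {κ M K r : ℝ} (hκ : 0 < κ) (hM : 0 ≤ M) (hK : 0 ≤ K)
    (hr : 0 < r) :
    ∃ C, ∀ (b b' : ℝ → ℂ) (k k' Θ : ℝ → ℝ) (z ε : ℝ),
      (∀ s ∈ uIcc (-r) r, HasDerivAt b (b' s) s) → (∀ s ∈ uIcc (-r) r, HasDerivAt k (k' s) s) →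
      (∀ s ∈ uIcc (-r) r, HasDerivAt Θ (s ^ 2 * k s) s) → ContinuousOn b' (uIcc (-r) r) →
      ContinuousOn k' (uIcc (-r) r) → (∀ s ∈ uIcc (-r) r, κ ≤ k s ∧ k s ≤ M ∧ |k' s| ≤ M) →
      (∀ s ∈ uIcc (-r) r, ‖b s‖ ≤ M ∧ ‖b' s‖ ≤ M) → b (-r) = 0 → b r = 0 → 0 < ε → ε ≤ 1 →
      |z| ≤ K →
      ‖∫ s in (-r)..r, b s * scaledExp Θ z ε s‖ ≤ C * ε ∧
      ‖∫ s in (-r)..r, (s : ℂ) * b s * scaledExp Θ z ε s‖ ≤ C * ε ^ 2 := by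
  set A : ℝ := K + 1 with hA
  set L : ℝ := 1 + 1 / κ with hL
  set C₁ : ℝ := M * (2 + r) * L with hC₁
  set C₂ : ℝ := M * (2 + r) * (1 / κ) with hC₂
  set D₀ : ℝ := A * M + (M + M * C₁) with hD₀
  set D₁ : ℝ := M + r * M + M * C₂ with hD₁
  set D₂ : ℝ := A * (A * M * L + (D₁ + M * C₁ * L)) + D₁ with hD₂
  set P : ℝ := Real.pi / Real.sqrt κ with hP
  have hA0 : 0 < A := by positivity
  have hL0 : 0 < L := by positivity
  have hC₁0 : 0 ≤ C₁ := by positivity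
  have hC₂0 : 0 ≤ C₂ := by positivity
  have hP0 : 0 ≤ P := by positivity
  have hD₁0 : 0 ≤ D₁ := by positivity
  refine ⟨max (D₀ * P) (D₂ * P), ?_⟩
  intro b b' k k' Θ z ε hb hk hΘ hb'c hk'c hkb hbb hbl hbr hε hε1 hz
  have hbc : ContinuousOn b (uIcc (-r) r) := fun s hs => (hb s hs).continuousAt.continuousWithinAt
  have hkc : ContinuousOn k (uIcc (-r) r) := fun s hs => (hk s hs).continuousAt.continuousWithinAt
  have hΘc : ContinuousOn Θ (uIcc (-r) r) := fun s hs => (hΘ s hs).continuousAt.continuousWithinAt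
  have hE := continuousOn_scaledExp hΘc z ε
  -- With `ψ` the full phase, `ε ψ' = z + (s/ε)² k`, so `den = A + ε ψ'`. The shift `A = K + 1`
  -- keeps `den ≥ 1` even where `ψ'` vanishes, as it may when `z ≤ 0`.
  set den : ℝ → ℝ := fun s => A + z + (s / ε) ^ 2 * k s with hden
  set den' : ℝ → ℝ := fun s => (2 * s * k s + s ^ 2 * k' s) / ε ^ 2 with hden'
  set ρ : ℝ → ℝ := fun s => (den s)⁻¹ with hρ
  set ρ' : ℝ → ℝ := fun s => -den' s / den s ^ 2 with hρ'
  have hdl : ∀ s ∈ uIcc (-r) r, 1 + κ * (s / ε) ^ 2 ≤ den s := fun s hs => by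
    have h1 := neg_abs_le z
    have h2 := mul_le_mul_of_nonneg_left (hkb s hs).1 (sq_nonneg (s / ε))
    simp only [hden]; linarith
  have hdpos : ∀ s ∈ uIcc (-r) r, 0 < den s := fun s hs =>
    lt_of_lt_of_le (by positivity) (hdl s hs)
  have hd1 : ∀ s ∈ uIcc (-r) r, 1 ≤ den s := fun s hs => by
    have := hdl s hs
    have h2 : 0 ≤ κ * (s / ε) ^ 2 := by positivity
    linarith
  have hdd : ∀ s ∈ uIcc (-r) r, HasDerivAt den (den' s) s := fun s hs =>
    (((((hasDerivAt_id' s).div_const ε).fun_pow 2).fun_mul (hk s hs)).const_add (A + z)).congr_deriv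
      (by simp only [hden']; push_cast; field_simp)
  have hρd : ∀ s ∈ uIcc (-r) r, HasDerivAt ρ (ρ' s) s := fun s hs =>
    (hdd s hs).fun_inv (hdpos s hs).ne'
  have hdc : ContinuousOn den (uIcc (-r) r) := by fun_prop
  have hρc : ContinuousOn ρ (uIcc (-r) r) := hdc.inv₀ fun s hs => (hdpos s hs).ne'
  have hρ'c : ContinuousOn ρ' (uIcc (-r) r) :=
    ContinuousOn.div (by fun_prop) (by fun_prop) fun s hs => pow_ne_zero 2 (hdpos s hs).ne'
  have hρ0 : ∀ s ∈ uIcc (-r) r, 0 < ρ s := fun s hs => inv_pos.2 (hdpos s hs)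
  have hρ1 : ∀ s ∈ uIcc (-r) r, ρ s ≤ 1 := fun s hs => inv_le_one_of_one_le₀ (hd1 s hs)
  have hρw : ∀ s ∈ uIcc (-r) r, ρ s ≤ 1 / (1 + κ * (s / ε) ^ 2) := fun s hs => by
    rw [one_div]; exact inv_anti₀ (by positivity) (hdl s hs)
  have hσ : ∀ s ∈ uIcc (-r) r, |s| / ε ≤ L * den s := fun s hs => by
    have h1 : |s| / ε ≤ L * (1 + κ * (s / ε) ^ 2) := by
      have h2 : (s / ε) ^ 2 = (|s| / ε) ^ 2 := by rw [div_pow, div_pow, sq_abs]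
      rw [h2, hL]
      have h3 : (1 + 1 / κ) * (1 + κ * (|s| / ε) ^ 2) =
        1 + 1 / κ + κ * (|s| / ε) ^ 2 + (|s| / ε) ^ 2 := by field_simp; ring
      rw [h3]
      have : 0 < 1 / κ := by positivity
      have : 0 ≤ κ * (|s| / ε) ^ 2 := by positivity
      nlinarith [sq_nonneg (|s| / ε - 1)]
    exact h1.trans (mul_le_mul_of_nonneg_left (hdl s hs) hL0.le)
  have hσ2 : ∀ s ∈ uIcc (-r) r, (|s| / ε) ^ 2 ≤ 1 / κ * den s := fun s hs => by
    have h2 : (s / ε) ^ 2 = (|s| / ε) ^ 2 := by rw [div_pow, div_pow, sq_abs]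
    rw [one_div, ← div_eq_inv_mul, le_div_iff₀ hκ, ← h2]
    linarith [hdl s hs]
  have hsr : ∀ s ∈ uIcc (-r) r, |s| ≤ r := fun s hs => by
    rw [uIcc_of_le (by linarith)] at hs
    exact abs_le.2 hs
  have hεd : ∀ s ∈ uIcc (-r) r, ε * |den' s| ≤ M * (2 + r) * (|s| / ε) := fun s hs => by
    obtain ⟨h1, h2, h3⟩ := hkb s hs
    have h4 : |2 * s * k s + s ^ 2 * k' s| ≤ M * (2 + r) * |s| := by
      have h5 : |2 * s * k s| ≤ 2 * |s| * M := by
        rw [abs_mul, abs_mul, abs_two, abs_of_pos (hκ.trans_le h1)]; gcongr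
      have h6 : |s ^ 2 * k' s| ≤ (r * |s|) * M := by
        rw [abs_mul, abs_pow, sq]
        have := hsr s hs
        gcongr
      linarith [abs_add_le (2 * s * k s) (s ^ 2 * k' s)]
    rw [hden', abs_div, abs_of_pos (by positivity : 0 < ε ^ 2)]
    calc ε * (|2 * s * k s + s ^ 2 * k' s| / ε ^ 2) ≤ ε * (M * (2 + r) * |s| / ε ^ 2) := by gcongr
      _ = _ := by field_simp
  have hρ'abs : ∀ s ∈ uIcc (-r) r, ε * |ρ' s| = ε * |den' s| * ρ s * ρ s := fun s hs => by
    have := hdpos s hs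
    simp only [hρ', hρ, abs_div, abs_neg, abs_of_pos (pow_pos this 2)]
    field_simp
  have hdρ : ∀ s ∈ uIcc (-r) r, den s * ρ s = 1 := fun s hs => mul_inv_cancel₀ (hdpos s hs).ne'
  -- One scaled derivative `ε d/ds` of `ρ` is no larger than a constant times `ρ`, because `ε
  -- |den'|` is of order `|s|/ε`, which `den` dominates.
  have f1 : ∀ s ∈ uIcc (-r) r, ε * |ρ' s| ≤ C₁ * ρ s := fun s hs => by
    rw [hρ'abs s hs]
    have h0 := hρ0 s hs
    calc ε * |den' s| * ρ s * ρ s ≤ (M * (2 + r) * (L * den s)) * ρ s * ρ s := by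
          have := (hεd s hs).trans (mul_le_mul_of_nonneg_left (hσ s hs) (by positivity))
          gcongr
      _ = C₁ * (den s * ρ s) * ρ s := by rw [hC₁]; ring
      _ = _ := by rw [hdρ s hs, mul_one]
  have f2 : ∀ s ∈ uIcc (-r) r, |s| * (ε * |ρ' s|) ≤ C₂ * ε * ρ s := fun s hs => by
    rw [hρ'abs s hs]
    have h0 := hρ0 s hs
    calc |s| * (ε * |den' s| * ρ s * ρ s) ≤ |s| * ((M * (2 + r) * (|s| / ε)) * ρ s * ρ s) := by
          have := hεd s hs
          gcongr
      _ = M * (2 + r) * ε * (|s| / ε) ^ 2 * ρ s * ρ s := by field_simp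
      _ ≤ M * (2 + r) * ε * (1 / κ * den s) * ρ s * ρ s := by
          have := hσ2 s hs
          gcongr
      _ = C₂ * ε * (den s * ρ s) * ρ s := by rw [hC₂]; ring
      _ = _ := by rw [hdρ s hs, mul_one]
  have f3 : ∀ s ∈ uIcc (-r) r, |s| * ρ s ≤ L * ε := fun s hs => by
    have h0 := hρ0 s hs
    calc |s| * ρ s = ε * (|s| / ε) * ρ s := by field_simp
      _ ≤ ε * (L * den s) * ρ s := by
          have := hσ s hs
          gcongr
      _ = L * ε * (den s * ρ s) := by ring
      _ = _ := by rw [hdρ s hs, mul_one]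
  have hle : -r ≤ r := by linarith
  have hmain : ∀ (g : ℝ → ℂ) (B : ℝ), ContinuousOn g (uIcc (-r) r) → 0 ≤ B →
      (∀ s ∈ uIcc (-r) r, ‖g s‖ ≤ B * ρ s) →
      ‖∫ s in (-r)..r, g s * scaledExp Θ z ε s‖ ≤ B * (P * ε) := by
    intro g B hg hB hgB
    calc ‖∫ s in (-r)..r, g s * scaledExp Θ z ε s‖
        ≤ ∫ s in (-r)..r, B * (1 / (1 + κ * (s / ε) ^ 2)) := by
          refine intervalIntegral.norm_integral_le_of_norm_le hle (ae_of_all _ fun s hs => ?_) ?_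
          · have hs' : s ∈ uIcc (-r) r := by rw [uIcc_of_le hle]; exact Ioc_subset_Icc_self hs
            rw [norm_mul, norm_scaledExp, mul_one]
            exact (hgB s hs').trans (mul_le_mul_of_nonneg_left (hρw s hs') hB)
          · refine Continuous.intervalIntegrable (Continuous.mul (by fun_prop)
              (Continuous.div (by fun_prop) (by fun_prop) fun s => ?_)) _ _
            positivity
      _ ≤ B * (P * ε) := by
          rw [intervalIntegral.integral_const_mul]
          exact mul_le_mul_of_nonneg_left (integral_one_div_one_add_sq_le hκ hε) hB
  -- Insert `1 = den ρ = A ρ + ε ψ' ρ` and integrate the second term by parts. The amplitude `a` is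
  -- replaced by `a ρ` and `ε (a ρ)'`, a gain of one factor `ρ`.
  have hstep : ∀ (a a' : ℝ → ℂ), (∀ s ∈ uIcc (-r) r, HasDerivAt a (a' s) s) →
      ContinuousOn a' (uIcc (-r) r) → a (-r) = 0 → a r = 0 →
      ‖∫ s in (-r)..r, a s * scaledExp Θ z ε s‖ ≤
        A * ‖∫ s in (-r)..r, (a s * ρ s) * scaledExp Θ z ε s‖ +
        ‖∫ s in (-r)..r, (ε * (a' s * ρ s + a s * ρ' s)) * scaledExp Θ z ε s‖ := by
    intro a a' ha ha'c hal har
    have hac : ContinuousOn a (uIcc (-r) r) :=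
      fun s hs => (ha s hs).continuousAt.continuousWithinAt
    have key := integral_mul_scaledExp_by_parts (z := z) hε (u := fun s => a s * ρ s)
      (u' := fun s => a' s * ρ s + a s * ρ' s) hΘ (by fun_prop)
      (fun s hs => (ha s hs).fun_mul (hρd s hs).ofReal_comp) (by fun_prop) (by simp [hal])
      (by simp [har])
    have hε' : (ε : ℂ) ≠ 0 := ofReal_ne_zero.2 hε.ne'
    have heq : ∫ s in (-r)..r, a s * scaledExp Θ z ε s =
        (A + z : ℂ) * (∫ s in (-r)..r, (a s * ρ s) * scaledExp Θ z ε s) +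
        (1 / ε ^ 2 : ℂ) * ∫ s in (-r)..r, ((s ^ 2 * k s : ℝ) : ℂ) * (a s * ρ s) *
          scaledExp Θ z ε s := by
      rw [← intervalIntegral.integral_const_mul, ← intervalIntegral.integral_const_mul,
        ← intervalIntegral.integral_add]
      · refine intervalIntegral.integral_congr fun s hs => ?_
        have h1 : (((A + z + (s / ε) ^ 2 * k s) * ρ s : ℝ) : ℂ) = 1 := by
          exact_mod_cast hdρ s hs
        have h2 : (A + z : ℂ) * (a s * ρ s * scaledExp Θ z ε s) +
            (1 / ε ^ 2 : ℂ) * (((s ^ 2 * k s : ℝ) : ℂ) * (a s * ρ s) * scaledExp Θ z ε s) =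
            (((A + z + (s / ε) ^ 2 * k s) * ρ s : ℝ) : ℂ) * (a s * scaledExp Θ z ε s) := by
          push_cast
          field_simp
        simp only [h2, h1, one_mul]
      · exact ContinuousOn.intervalIntegrable (by fun_prop)
      · exact ContinuousOn.intervalIntegrable (by fun_prop)
    have heq2 : ∫ s in (-r)..r, a s * scaledExp Θ z ε s =
        A * (∫ s in (-r)..r, (a s * ρ s) * scaledExp Θ z ε s) +
        I * ∫ s in (-r)..r, (ε * (a' s * ρ s + a s * ρ' s)) * scaledExp Θ z ε s := by
      rw [heq, key]
      simp only [mul_assoc (ε : ℂ)]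
      rw [intervalIntegral.integral_const_mul]
      field_simp
      ring
    rw [heq2]
    refine (norm_add_le _ _).trans (le_of_eq ?_)
    rw [norm_mul, norm_mul, norm_I, one_mul, norm_real, Real.norm_eq_abs, abs_of_pos hA0]
  have nρ : ∀ s ∈ uIcc (-r) r, ‖(ρ s : ℂ)‖ = ρ s := fun s hs => by
    rw [norm_real, Real.norm_eq_abs, abs_of_pos (hρ0 s hs)]
  have nε : ‖(ε : ℂ)‖ = ε := by rw [norm_real, Real.norm_eq_abs, abs_of_pos hε]
  have nρ' : ∀ s, ‖(ρ' s : ℂ)‖ = |ρ' s| := fun s => by rw [norm_real, Real.norm_eq_abs]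
  have ns : ∀ s : ℝ, ‖(s : ℂ)‖ = |s| := fun s => by rw [norm_real, Real.norm_eq_abs]
  constructor
  · have h1 := hmain (fun s => b s * ρ s) M (by fun_prop) hM fun s hs => by
      rw [norm_mul, nρ s hs]
      exact mul_le_mul_of_nonneg_right (hbb s hs).1 (hρ0 s hs).le
    have h2 := hmain (fun s => ε * (b' s * ρ s + b s * ρ' s)) (M + M * C₁) (by fun_prop)
      (by positivity) fun s hs => by
        have h0 := hρ0 s hs
        obtain ⟨hb1, hb2⟩ := hbb s hs
        rw [norm_mul, nε]
        calc ε * ‖b' s * ρ s + b s * ρ' s‖ ≤ ε * (‖b' s‖ * ρ s + ‖b s‖ * |ρ' s|) := by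
              refine mul_le_mul_of_nonneg_left ((norm_add_le _ _).trans (le_of_eq ?_)) hε.le
              rw [norm_mul, norm_mul, nρ s hs, nρ']
          _ = ε * ‖b' s‖ * ρ s + ‖b s‖ * (ε * |ρ' s|) := by ring
          _ ≤ 1 * M * ρ s + M * (C₁ * ρ s) := by
              have := f1 s hs
              gcongr
          _ = _ := by ring
    calc _ ≤ _ := hstep b b' hb hb'c hbl hbr
      _ ≤ A * (M * (P * ε)) + (M + M * C₁) * (P * ε) := by gcongr
      _ = D₀ * P * ε := by rw [hD₀]; ring
      _ ≤ _ := mul_le_mul_of_nonneg_right (le_max_left _ _) hε.le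
  -- One gain is not enough here: `|s| ρ` is `O(ε)` pointwise but decays only like `ε / (s/ε)`,
  -- whose integral diverges logarithmically. A second application of `hstep` restores an integrable
  -- profile.
  · have hs1 : ∀ s ∈ uIcc (-r) r, HasDerivAt (fun s : ℝ => (s : ℂ) * b s) (b s + s * b' s) s :=
      fun s hs => ((hasDerivAt_id' s).ofReal_comp.fun_mul (hb s hs)).congr_deriv (by simp)
    have hs2 : ∀ s ∈ uIcc (-r) r, HasDerivAt (fun s : ℝ => (s : ℂ) * b s * ρ s)
        ((b s + s * b' s) * ρ s + s * b s * ρ' s) s :=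
      fun s hs => (hs1 s hs).fun_mul (hρd s hs).ofReal_comp
    have hE1 : ∀ s ∈ uIcc (-r) r, ‖(ε : ℂ) * ((b s + s * b' s) * ρ s + s * b s * ρ' s)‖ ≤
        D₁ * ε * ρ s := fun s hs => by
      have h0 := hρ0 s hs
      obtain ⟨hb1, hb2⟩ := hbb s hs
      have hsr' := hsr s hs
      rw [norm_mul, nε]
      calc ε * ‖(b s + s * b' s) * ρ s + s * b s * ρ' s‖
          ≤ ε * ((‖b s‖ + |s| * ‖b' s‖) * ρ s + |s| * ‖b s‖ * |ρ' s|) := by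
            refine mul_le_mul_of_nonneg_left ((norm_add_le _ _).trans ?_) hε.le
            rw [norm_mul, norm_mul, norm_mul, nρ s hs, nρ', ns]
            have : ‖b s + s * b' s‖ ≤ ‖b s‖ + |s| * ‖b' s‖ :=
              (norm_add_le _ _).trans (le_of_eq (by rw [norm_mul, ns]))
            gcongr
        _ = ε * (‖b s‖ + |s| * ‖b' s‖) * ρ s + ‖b s‖ * (|s| * (ε * |ρ' s|)) := by ring
        _ ≤ ε * (M + r * M) * ρ s + M * (C₂ * ε * ρ s) := by
            have := f2 s hs
            gcongr
        _ = _ := by rw [hD₁]; ring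
    have h2 := hmain (fun s => ε * ((b s + s * b' s) * ρ s + s * b s * ρ' s)) (D₁ * ε)
      (by fun_prop) (by positivity) hE1
    have hsb : ∀ s ∈ uIcc (-r) r, ‖(s : ℂ) * b s * ρ s‖ ≤ M * (L * ε) := fun s hs => by
      have h0 := hρ0 s hs
      rw [norm_mul, norm_mul, ns, nρ s hs]
      calc |s| * ‖b s‖ * ρ s = ‖b s‖ * (|s| * ρ s) := by ring
        _ ≤ M * (L * ε) := mul_le_mul (hbb s hs).1 (f3 s hs) (by positivity) hM
    have h3 := hmain (fun s => (s * b s * ρ s) * ρ s) (M * (L * ε)) (by fun_prop) (by positivity)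
      fun s hs => by
        rw [norm_mul, nρ s hs]
        exact mul_le_mul_of_nonneg_right (hsb s hs) (hρ0 s hs).le
    have h4 := hmain (fun s => ε * (((b s + s * b' s) * ρ s + s * b s * ρ' s) * ρ s +
      (s * b s * ρ s) * ρ' s)) (D₁ * ε + M * C₁ * (L * ε)) (by fun_prop) (by positivity)
      fun s hs => by
        have h0 := hρ0 s hs
        rw [mul_add, ← mul_assoc]
        refine (norm_add_le _ _).trans ?_
        have h5 : ‖(ε : ℂ) * ((b s + s * b' s) * ρ s + s * b s * ρ' s) * ρ s‖ ≤
            D₁ * ε * ρ s := by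
          rw [norm_mul, nρ s hs]
          calc _ ≤ D₁ * ε * ρ s * 1 :=
                mul_le_mul (hE1 s hs) (hρ1 s hs) h0.le (by positivity)
            _ = _ := mul_one _
        have h6 : ‖(ε : ℂ) * (s * b s * ρ s * ρ' s)‖ ≤ M * (L * ε) * (C₁ * ρ s) := by
          rw [norm_mul, norm_mul, nε, nρ']
          calc ε * (‖(s : ℂ) * b s * ρ s‖ * |ρ' s|) = ‖(s : ℂ) * b s * ρ s‖ * (ε * |ρ' s|) := by
                ring
            _ ≤ _ := mul_le_mul (hsb s hs) (f1 s hs) (by positivity) (by positivity)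
        linarith
    have h5 := hstep (fun s => s * b s * ρ s) _ hs2 (by fun_prop) (by simp [hbl]) (by simp [hbr])
    have h6 := hstep (fun s => s * b s) _ hs1 (by fun_prop) (by simp [hbl]) (by simp [hbr])
    calc _ ≤ _ := h6
      _ ≤ A * (A * (M * (L * ε) * (P * ε)) + (D₁ * ε + M * C₁ * (L * ε)) * (P * ε)) +
          D₁ * ε * (P * ε) := by
          refine add_le_add (mul_le_mul_of_nonneg_left (h5.trans ?_) hA0.le) h2
          exact add_le_add (mul_le_mul_of_nonneg_left h3 hA0.le) h4
      _ = D₂ * P * ε ^ 2 := by rw [hD₂]; ring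
      _ ≤ _ := mul_le_mul_of_nonneg_right (le_max_right _ _) (by positivity)

/-! ### Smooth families of amplitudes and phases -/

section Families

variable {F : Type*} [NormedAddCommGroup F] [NormedSpace ℝ F]

/-- The partial derivative with respect to the second variable. -/
noncomputable def derivSnd (b : ℝ × ℝ → F) (p : ℝ × ℝ) : F := fderiv ℝ b p (0, 1)

theorem contDiff_derivSnd {b : ℝ × ℝ → F} (hb : ContDiff ℝ ∞ b) : ContDiff ℝ ∞ (derivSnd b) :=
  (hb.fderiv_right (m := ∞) (by simp)).clm_apply contDiff_const

theorem hasDerivAt_derivSnd {b : ℝ × ℝ → F} (hb : ContDiff ℝ ∞ b) (θ s : ℝ) :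
    HasDerivAt (fun s => b (θ, s)) (derivSnd b (θ, s)) s :=
  ((hb.differentiable (by simp)) (θ, s)).hasFDerivAt.comp_hasDerivAt s
    ((hasDerivAt_const s θ).prodMk (hasDerivAt_id s))

theorem derivSnd_eq_zero {b : ℝ × ℝ → F} (hb : ContDiff ℝ ∞ b) {r : ℝ}
    (h0 : ∀ θ s, r < |s| → b (θ, s) = 0) (θ s : ℝ) (hs : r < |s|) : derivSnd b (θ, s) = 0 := by
  have h1 : (fun s => b (θ, s)) =ᶠ[𝓝 s] fun _ => 0 := by
    filter_upwards [(isOpen_lt continuous_const continuous_abs).mem_nhds hs] with y hy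
    exact h0 θ y hy
  exact (hasDerivAt_derivSnd hb θ s).unique ((hasDerivAt_const s (0 : F)).congr_of_eventuallyEq h1)

end Families

/-- Moments of oscillatory integrals with a degenerate stationary point, uniformly for compact
families of amplitudes and phases. -/
theorem exists_norm_integral_pow_mul_scaledExp_le {T : Set ℝ} (hT : IsCompact T) {r r' K : ℝ}
    (hr' : 0 < r') (hr'r : r' < r) (hK : 0 ≤ K) {k : ℝ × ℝ → ℝ} (hk : ContDiff ℝ ∞ k)
    (hkpos : ∀ p, 0 < k p) {Θ : ℝ → ℝ → ℝ}
    (hΘ : ∀ θ, ∀ s ∈ uIcc (-r) r, HasDerivAt (Θ θ) (s ^ 2 * k (θ, s)) s) (n : ℕ) :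
    ∀ b : ℝ × ℝ → ℂ, ContDiff ℝ ∞ b → (∀ θ s, r' < |s| → b (θ, s) = 0) →
      ∃ C, 0 ≤ C ∧ ∀ θ ∈ T, ∀ z ε : ℝ, 0 < ε → ε ≤ 1 → |z| ≤ K →
        ‖∫ s in (-r)..r, (s : ℂ) ^ n * b (θ, s) * scaledExp (Θ θ) z ε s‖ ≤ C * ε ^ (n + 1) := by
  have hr : 0 < r := hr'.trans hr'r
  have hcomp : IsCompact (T ×ˢ uIcc (-r) r) := hT.prod isCompact_uIcc
  have hslice : ∀ θ : ℝ, Continuous fun s : ℝ => (θ, s) := fun θ => by fun_prop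
  have hkc := hk.continuous
  have hk'c := (contDiff_derivSnd hk).continuous
  have hbase : ∀ b : ℝ × ℝ → ℂ, ContDiff ℝ ∞ b → (∀ θ s, r' < |s| → b (θ, s) = 0) →
      ∃ C, 0 ≤ C ∧ ∀ θ ∈ T, ∀ z ε : ℝ, 0 < ε → ε ≤ 1 → |z| ≤ K →
        ‖∫ s in (-r)..r, b (θ, s) * scaledExp (Θ θ) z ε s‖ ≤ C * ε ∧
        ‖∫ s in (-r)..r, (s : ℂ) * b (θ, s) * scaledExp (Θ θ) z ε s‖ ≤ C * ε ^ 2 := by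
    intro b hb hb0
    have hbc := hb.continuous
    have hb'c := (contDiff_derivSnd hb).continuous
    obtain ⟨M₁, hM₁⟩ := hcomp.exists_bound_of_continuousOn hbc.continuousOn
    obtain ⟨M₂, hM₂⟩ := hcomp.exists_bound_of_continuousOn hb'c.continuousOn
    obtain ⟨M₃, hM₃⟩ := hcomp.exists_bound_of_continuousOn hkc.continuousOn
    obtain ⟨M₄, hM₄⟩ := hcomp.exists_bound_of_continuousOn hk'c.continuousOn
    obtain ⟨M₅, hM₅⟩ := hcomp.exists_bound_of_continuousOn
      (hkc.inv₀ fun p => (hkpos p).ne').continuousOn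
    set M := |M₁| + |M₂| + |M₃| + |M₄| with hM
    have a₁ := abs_nonneg M₁
    have a₂ := abs_nonneg M₂
    have a₃ := abs_nonneg M₃
    have a₄ := abs_nonneg M₄
    obtain ⟨C, hC⟩ := exists_norm_integral_scaledExp_le (κ := (|M₅| + 1)⁻¹) (M := M)
      (by positivity) (by positivity) hK hr
    refine ⟨|C|, abs_nonneg C, fun θ hθ z ε hε hε1 hz => ?_⟩
    have hmem : ∀ s ∈ uIcc (-r) r, (θ, s) ∈ T ×ˢ uIcc (-r) r := fun s hs => ⟨hθ, hs⟩
    have h := hC (fun s => b (θ, s)) (fun s => derivSnd b (θ, s)) (fun s => k (θ, s))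
      (fun s => derivSnd k (θ, s)) (Θ θ) z ε (fun s _ => hasDerivAt_derivSnd hb θ s)
      (fun s _ => hasDerivAt_derivSnd hk θ s) (hΘ θ)
      (hb'c.comp (hslice θ)).continuousOn (hk'c.comp (hslice θ)).continuousOn
      (fun s hs => by
        have h3 := hM₃ _ (hmem s hs)
        have h4 := hM₄ _ (hmem s hs)
        have h5 := hM₅ _ (hmem s hs)
        have hp := hkpos (θ, s)
        rw [Real.norm_eq_abs] at h3 h4
        rw [Pi.inv_apply, norm_inv, Real.norm_eq_abs, abs_of_pos hp] at h5
        have l3 := le_abs_self M₃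
        have l4 := le_abs_self M₄
        have l5 := le_abs_self M₅
        refine ⟨?_, by linarith [le_abs_self (k (θ, s))], by linarith⟩
        rw [inv_le_comm₀ (by positivity) hp]
        linarith)
      (fun s hs => by
        have h1 := hM₁ _ (hmem s hs)
        have h2 := hM₂ _ (hmem s hs)
        have l1 := le_abs_self M₁
        have l2 := le_abs_self M₂
        exact ⟨by linarith, by linarith⟩)
      (hb0 _ _ (by rw [abs_neg, abs_of_pos hr]; exact hr'r))
      (hb0 _ _ (by rw [abs_of_pos hr]; exact hr'r)) hε hε1 hz
    exact ⟨h.1.trans (mul_le_mul_of_nonneg_right (le_abs_self C) hε.le),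
      h.2.trans (mul_le_mul_of_nonneg_right (le_abs_self C) (by positivity))⟩
  induction n using Nat.strong_induction_on with
  | _ n ih =>
    intro b hb hb0
    rcases n with _ | _ | n
    · obtain ⟨C, hC0, hC⟩ := hbase b hb hb0
      refine ⟨C, hC0, fun θ hθ z ε hε hε1 hz => ?_⟩
      simpa using (hC θ hθ z ε hε hε1 hz).1
    · obtain ⟨C, hC0, hC⟩ := hbase b hb hb0
      refine ⟨C, hC0, fun θ hθ z ε hε hε1 hz => ?_⟩
      simpa using (hC θ hθ z ε hε hε1 hz).2
    -- Write `s^{n+2} b = (s² k) sⁿ c` with `c = b / k` and integrate by parts against `Θ' = s² k`.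
    -- The resulting terms have orders `ε³ εⁿ`, `ε³ ε^{n+1}` and `ε² ε^{n+1}`, all at most of order
    -- `ε^{n+3}`.
    · have hkne : ∀ p, (k p : ℂ) ≠ 0 := fun p => ofReal_ne_zero.2 (hkpos p).ne'
      set c : ℝ × ℝ → ℂ := fun p => (((k p)⁻¹ : ℝ) : ℂ) * b p with hc
      have hcs : ContDiff ℝ ∞ c := 
        (ofRealCLM.contDiff.comp (hk.inv fun p => (hkpos p).ne')).mul hb
      have hc0 : ∀ θ s, r' < |s| → c (θ, s) = 0 := fun θ s hs => by simp [hc, hb0 θ s hs]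
      have hc's := contDiff_derivSnd hcs
      have hc'0 := derivSnd_eq_zero hcs hc0
      obtain ⟨C₁, hC₁0, hC₁⟩ := ih n (by omega) c hcs hc0
      obtain ⟨C₂, hC₂0, hC₂⟩ := ih n (by omega) (derivSnd c) hc's hc'0
      -- For `n = 0` the truncated index is harmless, since the moment enters with the factor `n`.
      obtain ⟨C₃, hC₃0, hC₃⟩ := ih (n - 1) (by omega) c hcs hc0
      refine ⟨n * C₃ + C₂ + K * C₁, by positivity, fun θ hθ z ε hε hε1 hz => ?_⟩
      have hccont := hcs.continuous
      have hc'cont := hc's.continuous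
      have hΘc : ContinuousOn (Θ θ) (uIcc (-r) r) :=
        fun s hs => (hΘ θ s hs).continuousAt.continuousWithinAt
      have hE := continuousOn_scaledExp hΘc z ε
      have key := integral_mul_scaledExp_by_parts (z := z) hε (hΘ θ) (by fun_prop)
        (u := fun s => (s : ℂ) ^ n * c (θ, s))
        (u' := fun s => n * ((s : ℂ) ^ (n - 1) * c (θ, s)) + (s : ℂ) ^ n * derivSnd c (θ, s))
        (fun s _ => (((hasDerivAt_id' s).ofReal_comp.fun_pow n).fun_mul
          (hasDerivAt_derivSnd hcs θ s)).congr_deriv (by push_cast; ring))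
        (by fun_prop)
        (by simp [hc0 θ (-r) (by rw [abs_neg, abs_of_pos hr]; exact hr'r)])
        (by simp [hc0 θ r (by rw [abs_of_pos hr]; exact hr'r)])
      have e1 : ∫ s in (-r)..r, (s : ℂ) ^ (n + 1 + 1) * b (θ, s) * scaledExp (Θ θ) z ε s =
          ∫ s in (-r)..r, ((s ^ 2 * k (θ, s) : ℝ) : ℂ) * ((s : ℂ) ^ n * c (θ, s)) *
            scaledExp (Θ θ) z ε s := by
        refine intervalIntegral.integral_congr fun s _ => ?_
        have : b (θ, s) = k (θ, s) * c (θ, s) := by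
          simp only [hc, ofReal_inv]; rw [mul_inv_cancel_left₀ (hkne _)]
        simp only [this]
        push_cast
        ring
      have e2 : ∫ s in (-r)..r, (n * ((s : ℂ) ^ (n - 1) * c (θ, s)) +
            (s : ℂ) ^ n * derivSnd c (θ, s)) * scaledExp (Θ θ) z ε s =
          n * (∫ s in (-r)..r, (s : ℂ) ^ (n - 1) * c (θ, s) * scaledExp (Θ θ) z ε s) +
          ∫ s in (-r)..r, (s : ℂ) ^ n * derivSnd c (θ, s) * scaledExp (Θ θ) z ε s := by
        rw [← intervalIntegral.integral_const_mul, ← intervalIntegral.integral_add]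
        · refine intervalIntegral.integral_congr fun s _ => ?_
          ring
        · exact ContinuousOn.intervalIntegrable (by fun_prop)
        · exact ContinuousOn.intervalIntegrable (by fun_prop)
      rw [e1, key, e2]
      have b1 := hC₁ θ hθ z ε hε hε1 hz
      have b2 := hC₂ θ hθ z ε hε hε1 hz
      have b3 := hC₃ θ hθ z ε hε hε1 hz
      set X₁ := ∫ s in (-r)..r, (s : ℂ) ^ n * c (θ, s) * scaledExp (Θ θ) z ε s
      set X₂ := ∫ s in (-r)..r, (s : ℂ) ^ n * derivSnd c (θ, s) * scaledExp (Θ θ) z ε s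
      set X₃ := ∫ s in (-r)..r, (s : ℂ) ^ (n - 1) * c (θ, s) * scaledExp (Θ θ) z ε s
      have nε : ‖(ε : ℂ)‖ = ε := by rw [norm_real, Real.norm_eq_abs, abs_of_pos hε]
      have b3' : (n : ℝ) * ‖X₃‖ ≤ n * (C₃ * ε ^ n) := by
        rcases n with _ | n
        · simp
        · exact mul_le_mul_of_nonneg_left b3 (by positivity)
      have b2' : ‖X₂‖ ≤ C₂ * ε ^ n := b2.trans (by
        gcongr C₂ * ?_
        exact pow_le_pow_of_le_one hε.le hε1 (by omega))
      calc ‖I * ε ^ 3 * (n * X₃ + X₂) - z * ε ^ 2 * X₁‖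
          ≤ ε ^ 3 * (n * ‖X₃‖ + ‖X₂‖) + |z| * ε ^ 2 * ‖X₁‖ := by
            refine (norm_sub_le _ _).trans (add_le_add ?_ (le_of_eq ?_))
            · rw [norm_mul, norm_mul, norm_I, one_mul, norm_pow, nε]
              refine mul_le_mul_of_nonneg_left ((norm_add_le _ _).trans (le_of_eq ?_))
                (by positivity)
              rw [norm_mul, Complex.norm_natCast]
            · rw [norm_mul, norm_mul, norm_pow, nε, norm_real, Real.norm_eq_abs]
        _ ≤ ε ^ 3 * (n * (C₃ * ε ^ n) + C₂ * ε ^ n) + K * ε ^ 2 * (C₁ * ε ^ (n + 1)) := by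
            gcongr
        _ = _ := by ring

/-! ### Comparison of cut off cubic phases with Airy moments -/

theorem scaledExp_cube (z ε s : ℝ) : scaledExp (fun s => s ^ 3 / 3) z ε s = airyExp z (s / ε) := by
  rw [scaledExp, airyExp]
  congr 3
  ring

/-- After `s = ε σ` the cutoff equals 1 up to `R = r₀/ε`, so it alters only the tail of the Airy
integral, which is `O(R^{j-2})`. Multiplied by `ε^{j+1}`, this is `O(ε³)` for both values of `j`. -/
theorem exists_norm_integral_cutoff_sub_airyMoment_le {j : ℕ} (hj : j ≤ 1) {r₀ r : ℝ}
    (hr₀ : 0 < r₀) (hr₀r : r₀ ≤ r) {χ : ℝ → ℝ} (hχ : ContDiff ℝ ∞ χ)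
    (hχe : ∀ s, χ (-s) = χ s) (hχ1 : ∀ s, |s| ≤ r₀ → χ s = 1) (hχ01 : ∀ s, χ s ∈ Icc (0 : ℝ) 1)
    (K : ℝ) :
    ∃ C, 0 ≤ C ∧ ∃ ε₀ > 0, ∀ z ε : ℝ, 0 < ε → ε ≤ ε₀ → |z| ≤ K →
      ‖(∫ s in (-r)..r, (s : ℂ) ^ j * χ s * scaledExp (fun s => s ^ 3 / 3) z ε s) -
        ε ^ (j + 1) * (airyMoment j z + (-1) ^ j * conj (airyMoment j z))‖ ≤ C * ε ^ 3 := by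
  have hχc := hχ.continuous
  have hχd : Continuous (deriv χ) := hχ.continuous_deriv (by simp)
  -- A bound for `u χ'(u)` is scale invariant: it controls `σ d/dσ χ(εσ)` uniformly in `ε`, as the
  -- tail estimate requires.
  obtain ⟨Q, hQ⟩ := (isCompact_Icc (a := r₀) (b := r)).exists_bound_of_continuousOn
    (f := fun u => u * deriv χ u) (by fun_prop)
  set M : ℝ := 1 + |Q| with hM
  have hM1 : 1 ≤ M := by have := abs_nonneg Q; linarith
  refine ⟨2 * (14 * M + 14) * (r₀ ^ j / r₀ ^ 2), by positivity, r₀ / (1 + 2 * |K|),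
    by positivity, fun z ε hε hε₀ hz => ?_⟩
  set R : ℝ := r₀ / ε with hR
  set X : ℝ := r / ε with hX
  have hR0 : 0 < R := by positivity
  have hRX : R ≤ X := div_le_div_of_nonneg_right hr₀r hε.le
  have hX0 : 0 < X := hR0.trans_le hRX
  have hR1 : 1 + 2 * |K| ≤ R := by
    rw [hR, le_div_iff₀ hε]
    rw [le_div_iff₀ (by positivity)] at hε₀
    linarith
  have hKR : 2 * K ≤ R ^ 2 := by
    have := le_abs_self K
    have := abs_nonneg K
    nlinarith
  have hKX : 2 * K ≤ X ^ 2 := hKR.trans (pow_le_pow_left₀ hR0.le hRX 2)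
  have hAc := continuous_airyExp_right z
  set h : ℝ → ℂ := fun σ => (σ : ℂ) ^ j * χ (ε * σ) * airyExp z σ with hh
  have hhc : Continuous h := by fun_prop
  set Y : ℂ := ∫ σ in (0 : ℝ)..X, h σ with hY
  have hscale : ∫ s in (-r)..r, (s : ℂ) ^ j * χ s * scaledExp (fun s => s ^ 3 / 3) z ε s =
      ε ^ (j + 1) * ∫ σ in (-X)..X, h σ := by
    have h1 : ∀ s : ℝ, (s : ℂ) ^ j * χ s * scaledExp (fun s => s ^ 3 / 3) z ε s =
        ε ^ j * h (s / ε) := fun s => by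
      have hε' : (ε : ℂ) ≠ 0 := ofReal_ne_zero.2 hε.ne'
      rw [scaledExp_cube, hh]
      simp only []
      rw [mul_div_cancel₀ _ hε.ne']
      push_cast
      rw [div_pow]
      field_simp
    simp_rw [h1]
    rw [intervalIntegral.integral_const_mul, intervalIntegral.integral_comp_div _ hε.ne',
      neg_div, real_smul]
    ring
  have hneg : ∀ σ, h (-σ) = (-1) ^ j * conj (h σ) := fun σ => by
    simp only [hh, mul_neg, hχe, airyExp_neg, map_mul, map_pow, conj_ofReal, ofReal_neg]
    rw [neg_pow]
    ring
  -- The evenness of `χ` and the oddness of the phase fold the negative half line onto the positive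
  -- one. The sign `(-1)^j` later selects the real part for `j = 0` and the imaginary part for `j =
  -- 1`.
  have hsym : ∫ σ in (-X)..X, h σ = Y + (-1) ^ j * conj Y := by
    rw [← intervalIntegral.integral_add_adjacent_intervals (b := 0) (hhc.intervalIntegrable _ _)
      (hhc.intervalIntegrable _ _), add_comm]
    congr 1
    have h1 : ∫ σ in (-X)..0, h σ = ∫ σ in (0 : ℝ)..X, h (-σ) := by
      rw [intervalIntegral.integral_comp_neg, neg_zero]
    rw [h1]
    simp_rw [hneg]
    rw [intervalIntegral.integral_const_mul, hY, intervalIntegral.intervalIntegral_conj]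
  have hYX : ‖Y - airyCut j z X‖ ≤ 14 * M * (R ^ j / R ^ 2) := by
    have h0 := intervalIntegrable_pow_mul_airyExp j z
    have h1 : airyCut j z X - Y =
        ∫ σ in R..X, ((σ : ℂ) ^ j * (1 - χ (ε * σ))) * airyExp z σ := by
      rw [airyCut, hY, ← intervalIntegral.integral_sub (h0 _ _) (hhc.intervalIntegrable _ _),
        ← intervalIntegral.integral_add_adjacent_intervals (b := R)
        (((h0 _ _).sub (hhc.intervalIntegrable _ _))) (((h0 _ _).sub (hhc.intervalIntegrable _ _)))]
      have h2 : ∫ σ in (0 : ℝ)..R, ((σ : ℂ) ^ j * airyExp z σ - h σ) = 0 := by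
        rw [intervalIntegral.integral_congr (g := fun _ => 0), intervalIntegral.integral_zero]
        intro σ hσ
        rw [uIcc_of_le hR0.le] at hσ
        have h3 : χ (ε * σ) = 1 := by
          refine hχ1 _ ?_
          rw [abs_of_nonneg (mul_nonneg hε.le hσ.1), mul_comm, ← le_div_iff₀ hε]
          exact hσ.2
        simp [hh, h3]
      rw [h2, zero_add]
      refine intervalIntegral.integral_congr fun σ _ => ?_
      simp only [hh]
      ring
    rw [norm_sub_rev, h1]
    refine norm_integral_mul_airyExp_le hj hz hR0 hKR hRX
      (v' := fun σ => j * (σ : ℂ) ^ (j - 1) * (1 - χ (ε * σ)) +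
        (σ : ℂ) ^ j * (-((deriv χ (ε * σ) * ε : ℝ) : ℂ))) (fun σ _ => ?_) (by fun_prop)
      (fun σ hσ => ?_) (fun σ hσ => ?_)
    · have h2 : HasDerivAt χ (deriv χ (ε * σ)) (ε * σ) :=
        (hχ.differentiable (by simp) _).hasDerivAt
      have h3 : HasDerivAt (fun σ => χ (ε * σ)) (deriv χ (ε * σ) * ε) σ :=
        (h2.comp σ ((hasDerivAt_id' σ).const_mul ε)).congr_deriv (by simp)
      exact (((hasDerivAt_id' σ).ofReal_comp.fun_pow j).fun_mul
        (h3.ofReal_comp.const_sub 1)).congr_deriv (by push_cast; ring)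
    · have hσ0 : 0 < σ := hR0.trans_le hσ.1
      obtain ⟨h2, h3⟩ := hχ01 (ε * σ)
      have h4 : ‖(1 - χ (ε * σ) : ℂ)‖ ≤ 1 := by
        rw [← ofReal_one, ← ofReal_sub, norm_real, Real.norm_eq_abs, abs_le]
        constructor <;> linarith
      rw [norm_mul, norm_pow, norm_real, Real.norm_eq_abs, abs_of_pos hσ0, mul_comm]
      exact mul_le_mul_of_nonneg_right (h4.trans hM1) (by positivity)
    · have hσ0 : 0 < σ := hR0.trans_le hσ.1
      obtain ⟨h2, h3⟩ := hχ01 (ε * σ)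
      have h4 : ‖(1 - χ (ε * σ) : ℂ)‖ ≤ 1 := by
        rw [← ofReal_one, ← ofReal_sub, norm_real, Real.norm_eq_abs, abs_le]
        constructor <;> linarith
      have h5 : |ε * σ * deriv χ (ε * σ)| ≤ |Q| := by
        refine (hQ (ε * σ) ⟨?_, ?_⟩).trans (le_abs_self Q)
        · rw [mul_comm, ← div_le_iff₀ hε]; exact hσ.1
        · rw [mul_comm, ← le_div_iff₀ hε]; exact hσ.2
      have h6 : ‖(j : ℂ) * (σ : ℂ) ^ (j - 1) * (1 - χ (ε * σ))‖ * σ ≤ σ ^ j := by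
        rw [norm_mul, norm_mul, norm_pow, norm_real, Real.norm_eq_abs, abs_of_pos hσ0]
        have : ‖(j : ℂ)‖ * σ ^ (j - 1) * σ ≤ σ ^ j := by
          interval_cases j <;> simp
        calc _ = ‖(j : ℂ)‖ * σ ^ (j - 1) * σ * ‖(1 - χ (ε * σ) : ℂ)‖ := by ring
          _ ≤ σ ^ j * 1 := mul_le_mul this h4 (norm_nonneg _) (by positivity)
          _ = _ := mul_one _
      have h7 : ‖(σ : ℂ) ^ j * (-((deriv χ (ε * σ) * ε : ℝ) : ℂ))‖ * σ ≤ |Q| * σ ^ j := by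
        rw [norm_mul, norm_neg, norm_pow, norm_real, norm_real, Real.norm_eq_abs,
          Real.norm_eq_abs, abs_of_pos hσ0]
        have : |deriv χ (ε * σ) * ε| * σ = |ε * σ * deriv χ (ε * σ)| := by
          rw [← abs_of_pos hσ0, ← abs_mul, abs_of_pos hσ0]; ring_nf
        rw [mul_assoc, this, mul_comm]
        exact mul_le_mul_of_nonneg_right h5 (by positivity)
      calc _ ≤ (‖(j : ℂ) * (σ : ℂ) ^ (j - 1) * (1 - χ (ε * σ))‖ +
              ‖(σ : ℂ) ^ j * (-((deriv χ (ε * σ) * ε : ℝ) : ℂ))‖) * σ :=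
            mul_le_mul_of_nonneg_right (norm_add_le _ _) hσ0.le
        _ ≤ σ ^ j + |Q| * σ ^ j := by rw [add_mul]; exact add_le_add h6 h7
        _ = M * σ ^ j := by rw [hM]; ring
  have hXM : ‖airyMoment j z - airyCut j z X‖ ≤ 14 * (R ^ j / R ^ 2) := by
    refine (norm_airyMoment_sub_le hj hz hX0 hKX).trans ?_
    gcongr 14 * ?_
    rw [div_le_div_iff₀ (by positivity) (by positivity)]
    interval_cases j
    · simpa using pow_le_pow_left₀ hR0.le hRX 2
    · nlinarith [mul_le_mul_of_nonneg_left hRX (mul_pos hR0 hX0).le]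
  have hYM : ‖Y - airyMoment j z‖ ≤ (14 * M + 14) * (R ^ j / R ^ 2) := by
    calc ‖Y - airyMoment j z‖ = ‖(Y - airyCut j z X) - (airyMoment j z - airyCut j z X)‖ := by
          congr 1; ring
      _ ≤ _ := (norm_sub_le _ _).trans (add_le_add hYX hXM)
      _ = _ := by ring
  rw [hscale, hsym, ← mul_sub]
  have h1 : Y + (-1) ^ j * conj Y - (airyMoment j z + (-1) ^ j * conj (airyMoment j z)) =
      (Y - airyMoment j z) + (-1) ^ j * conj (Y - airyMoment j z) := by
    rw [map_sub]; ring
  rw [h1, norm_mul, norm_pow, norm_real, Real.norm_eq_abs, abs_of_pos hε]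
  have h2 : ‖(Y - airyMoment j z) + (-1) ^ j * conj (Y - airyMoment j z)‖ ≤
      2 * ‖Y - airyMoment j z‖ := by
    refine (norm_add_le _ _).trans (le_of_eq ?_)
    rw [norm_mul, norm_pow, norm_neg, norm_one, one_pow, one_mul, RCLike.norm_conj]
    ring
  calc ε ^ (j + 1) * _ ≤ ε ^ (j + 1) * (2 * ((14 * M + 14) * (R ^ j / R ^ 2))) :=
        mul_le_mul_of_nonneg_left (h2.trans (by gcongr)) (by positivity)
    _ = _ := by
        rw [hR]
        interval_cases j
        · field_simp
          ring
        · field_simp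

/-! ### Airy asymptotics of an integral with a degenerate stationary point -/

/-- Without stationary points `Θ'/ε³` dominates the linear term `z/ε`, so one integration by parts
gains `ε³`, boundary terms included. -/
theorem exists_norm_integral_scaledExp_le_of_pos {c d K : ℝ} (hcd : c ≤ d) (hK : 0 ≤ K)
    {Θ f : ℝ → ℝ} (hΘ : ∀ s, HasDerivAt Θ (f s) s) (hf : ContDiff ℝ ∞ f)
    (hpos : ∀ s ∈ Icc c d, 0 < f s) {v : ℝ → ℂ} (hv : ContDiff ℝ ∞ v) :
    ∃ C, 0 ≤ C ∧ ∃ ε₀ > 0, ∀ z ε : ℝ, 0 < ε → ε ≤ ε₀ → |z| ≤ K →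
      ‖∫ s in c..d, v s * scaledExp Θ z ε s‖ ≤ C * ε ^ 3 := by
  have hfc := hf.continuous
  have hf'c : Continuous (deriv f) := hf.continuous_deriv (by simp)
  have hvc := hv.continuous
  have hv'c : Continuous (deriv v) := hv.continuous_deriv (by simp)
  obtain ⟨s₀, hs₀, hmin⟩ := isCompact_Icc.exists_isMinOn (nonempty_Icc.2 hcd) hfc.continuousOn
  set m := f s₀ with hm
  have hm0 : 0 < m := hpos s₀ hs₀
  have hmf : ∀ s ∈ Icc c d, m ≤ f s := fun s hs => hmin hs
  obtain ⟨M₁, hM₁⟩ := (isCompact_Icc (a := c) (b := d)).exists_bound_of_continuousOn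
    hvc.continuousOn
  obtain ⟨M₂, hM₂⟩ := (isCompact_Icc (a := c) (b := d)).exists_bound_of_continuousOn
    hv'c.continuousOn
  obtain ⟨M₃, hM₃⟩ := (isCompact_Icc (a := c) (b := d)).exists_bound_of_continuousOn
    hf'c.continuousOn
  have hc : c ∈ Icc c d := left_mem_Icc.2 hcd
  have hd : d ∈ Icc c d := right_mem_Icc.2 hcd
  have p₁ : 0 ≤ M₁ := (norm_nonneg _).trans (hM₁ c hc)
  have p₂ : 0 ≤ M₂ := (norm_nonneg _).trans (hM₂ c hc)
  have p₃ : 0 ≤ M₃ := (norm_nonneg _).trans (hM₃ c hc)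
  set B : ℝ := 2 * M₂ / m + 4 * M₁ * M₃ / m ^ 2 with hB
  have hB0 : 0 ≤ B := by positivity
  -- The threshold on `ε` forces `K ε² ≤ m/2`, so the derivative of the phase is at least `m / (2
  -- ε³)`.
  refine ⟨4 * M₁ / m + (d - c) * B, add_nonneg (by positivity)
    (mul_nonneg (by linarith) hB0), min 1 (m / (2 * (K + 1))), by positivity, ?_⟩
  intro z ε hε hε₀ hz
  have hε1 : ε ≤ 1 := hε₀.trans (min_le_left _ _)
  have hε2 : 2 * (K + 1) * ε ≤ m := by
    have := hε₀.trans (min_le_right _ _)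
    rw [le_div_iff₀ (by positivity)] at this
    linarith
  have hψ : ∀ s ∈ Icc c d, m / (2 * ε ^ 3) ≤ z * (1 / ε) + f s / ε ^ 3 := fun s hs => by
    have h1 := hmf s hs
    have h2 : z * (1 / ε) + f s / ε ^ 3 = (z * ε ^ 2 + f s) / ε ^ 3 := by field_simp
    rw [h2, show m / (2 * ε ^ 3) = (m / 2) / ε ^ 3 by field_simp]
    refine div_le_div_of_nonneg_right ?_ (by positivity)
    have h3 := neg_abs_le z
    have h4 : ε ^ 2 ≤ ε := by nlinarith
    have h5 : -(K * ε ^ 2) ≤ z * ε ^ 2 := by nlinarith [sq_nonneg ε]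
    nlinarith [mul_le_mul_of_nonneg_left h4 hK]
  have hlow : 0 < m / (2 * ε ^ 3) := by positivity
  have hend : ∀ s ∈ Icc c d, ‖v s‖ / (z * (1 / ε) + f s / ε ^ 3) ≤ 2 * M₁ / m * ε ^ 3 :=
    fun s hs => by
      calc _ ≤ M₁ / (m / (2 * ε ^ 3)) := div_le_div₀ p₁ (hM₁ s hs) hlow (hψ s hs)
        _ = _ := by field_simp
  have h := norm_integral_mul_cexp_phase_le hcd (v := v) (v' := deriv v)
    (ψ := fun s => z * (s / ε) + Θ s / ε ^ 3) (ψ' := fun s => z * (1 / ε) + f s / ε ^ 3)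
    (ψ'' := fun s => deriv f s / ε ^ 3) (B := fun _ => B * ε ^ 3)
    (fun s _ => (hv.differentiable (by simp) s).hasDerivAt)
    (fun s _ => (((hasDerivAt_id' s).div_const ε).const_mul z).fun_add
      ((hΘ s).div_const (ε ^ 3)))
    (fun s _ => (((hf.differentiable (by simp) s).hasDerivAt).div_const (ε ^ 3)).const_add _)
    hv'c.continuousOn (by fun_prop) (fun s hs => hlow.trans_le (hψ s hs)) continuousOn_const
    (fun s hs => by
      have h1 : ‖deriv v s‖ / (z * (1 / ε) + f s / ε ^ 3) ≤ M₂ / (m / (2 * ε ^ 3)) :=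
        div_le_div₀ p₂ (hM₂ s hs) hlow (hψ s hs)
      have h2 : ‖v s‖ * |deriv f s / ε ^ 3| / (z * (1 / ε) + f s / ε ^ 3) ^ 2 ≤
          M₁ * (M₃ / ε ^ 3) / (m / (2 * ε ^ 3)) ^ 2 := by
        refine div_le_div₀ (by positivity) (mul_le_mul (hM₁ s hs) ?_ (abs_nonneg _) p₁)
          (by positivity) (pow_le_pow_left₀ hlow.le (hψ s hs) 2)
        rw [abs_div, abs_of_pos (by positivity : 0 < ε ^ 3)]
        exact div_le_div_of_nonneg_right (hM₃ s hs) (by positivity)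
      refine (add_le_add h1 h2).trans (le_of_eq ?_)
      rw [hB]
      field_simp
      ring)
  rw [intervalIntegral.integral_const, smul_eq_mul] at h
  calc _ ≤ _ := h
    _ ≤ 2 * M₁ / m * ε ^ 3 + 2 * M₁ / m * ε ^ 3 + (d - c) * (B * ε ^ 3) :=
        add_le_add (add_le_add (hend c hc) (hend d hd)) le_rfl
    _ = _ := by ring

/-- Hadamard's lemma applied twice. The normalization `f''(0) = 2` is what gives the cubic model its
coefficient `1/3`. -/
theorem exists_eq_sq_mul {f : ℝ → ℝ} (hf : ContDiff ℝ ∞ f) (hf0 : f 0 = 0)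
    (hf1 : deriv f 0 = 0) (hf2 : deriv (deriv f) 0 = 2) :
    ∃ k : ℝ → ℝ, ContDiff ℝ ∞ k ∧ (∀ s, f s = s ^ 2 * k s) ∧ k 0 = 1 := by
  have hf' : ContDiff ℝ ∞ (deriv f) := (contDiff_infty_iff_deriv.1 hf).2
  set f₁ := taylorMean 0 (deriv f) with hf₁
  have hf₁s : ContDiff ℝ ∞ f₁ := contDiff_taylorMean 0 hf'
  have hf₁s' : ContDiff ℝ ∞ (deriv f₁) := (contDiff_infty_iff_deriv.1 hf₁s).2
  have h1 : f₁ 0 = 0 := by rw [hf₁, taylorMean_zero, hf1, smul_zero]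
  refine ⟨taylorMean 0 (deriv f₁), contDiff_taylorMean 0 hf₁s', fun s => ?_, ?_⟩
  · have h2 := sub_eq_smul_taylorMean hf s
    have h3 := sub_eq_smul_taylorMean hf₁s s
    rw [hf0, sub_zero, ← hf₁, smul_eq_mul] at h2
    rw [h1, sub_zero, smul_eq_mul] at h3
    rw [h2, h3]; ring
  · rw [taylorMean_zero, hf₁, (hasDerivAt_taylorMean 0 hf' 0).deriv, taylorMean_zero, hf2]
    norm_num

theorem exists_taylor_two {g : ℝ → ℂ} (hg : ContDiff ℝ ∞ g) :
    ∃ h₁ h₂ : ℝ → ℂ, ContDiff ℝ ∞ h₁ ∧ ContDiff ℝ ∞ h₂ ∧ (∀ s, g s = g 0 + s * h₁ s) ∧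
      ∀ s, g s = g 0 + s * deriv g 0 + s ^ 2 * h₂ s := by
  have hg' : ContDiff ℝ ∞ (deriv g) := (contDiff_infty_iff_deriv.1 hg).2
  set h₁ := taylorMean 0 (deriv g) with hh₁
  have h₁s : ContDiff ℝ ∞ h₁ := contDiff_taylorMean 0 hg'
  have h₁s' : ContDiff ℝ ∞ (deriv h₁) := (contDiff_infty_iff_deriv.1 h₁s).2
  have e0 : h₁ 0 = deriv g 0 := by rw [hh₁, taylorMean_zero]; norm_num
  have e1 : ∀ s : ℝ, g s = g 0 + s * h₁ s := fun s => by
    have := sub_eq_smul_taylorMean hg s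
    rw [real_smul, ← hh₁] at this
    linear_combination this
  refine ⟨h₁, taylorMean 0 (deriv h₁), h₁s, contDiff_taylorMean 0 h₁s', e1, fun s => ?_⟩
  have := sub_eq_smul_taylorMean h₁s s
  rw [real_smul, e0] at this
  rw [e1 s]
  linear_combination (s : ℂ) * this

/-- The smooth cutoff functions used to localize near the stationary point. -/
theorem exists_even_cutoff {r₀ r : ℝ} (hr₀ : 0 < r₀) (hr : r₀ < r) :
    ∃ χ : ℝ → ℝ, ContDiff ℝ ∞ χ ∧ (∀ s, χ (-s) = χ s) ∧ (∀ s, |s| ≤ r₀ → χ s = 1) ∧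
      (∀ s, r < |s| → χ s = 0) ∧ ∀ s, χ s ∈ Icc (0 : ℝ) 1 := by
  let B : ContDiffBump (0 : ℝ) := ⟨r₀, r, hr₀, hr⟩
  refine ⟨B, B.contDiff, fun s => B.neg s, fun s hs => ?_, fun s hs => ?_,
    fun s => ⟨B.nonneg, B.le_one⟩⟩
  · exact B.one_of_mem_closedBall (by simpa using hs)
  · exact B.zero_of_le_dist (by simpa using hs.le)

/-- Near the stationary point the phase may be replaced by its cubic Taylor polynomial. -/
theorem exists_norm_integral_cutoff_sub_cube_le {r r' K : ℝ} (hr' : 0 < r') (hr'r : r' < r)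
    (hK : 0 ≤ K) {Θ k : ℝ → ℝ} (hΘs : ∀ s, HasDerivAt Θ (s ^ 2 * k s) s) (hΘ0 : Θ 0 = 0)
    (hk : ContDiff ℝ ∞ k) (hk0 : k 0 = 1) {k₁ : ℝ → ℝ} (hk₁ : ContDiff ℝ ∞ k₁)
    (hk₁pos : ∀ s, 0 < k₁ s) (hkk₁ : ∀ s, |s| ≤ r → k₁ s = k s)
    {χ : ℝ → ℝ} (hχ : ContDiff ℝ ∞ χ) (hχ0 : ∀ s, r' < |s| → χ s = 0)
    {g : ℝ → ℂ} (hg : ContDiff ℝ ∞ g) :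
    ∃ C, 0 ≤ C ∧ ∀ z ε : ℝ, 0 < ε → ε ≤ 1 → |z| ≤ K →
      ‖(∫ s in (-r)..r, χ s * g s * scaledExp Θ z ε s) -
          ∫ s in (-r)..r, χ s * g s * scaledExp (fun s => s ^ 3 / 3) z ε s‖ ≤
        C * (ε ^ 2 * ‖g 0‖ + ε ^ 3) ∧
      ‖(∫ s in (-r)..r, χ s * g s * scaledExp (fun s => s ^ 3 / 3) z ε s) -
          (g 0 * (∫ s in (-r)..r, (s : ℂ) ^ 0 * χ s * scaledExp (fun s => s ^ 3 / 3) z ε s) +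
          deriv g 0 * ∫ s in (-r)..r, (s : ℂ) ^ 1 * χ s * scaledExp (fun s => s ^ 3 / 3) z ε s)‖ ≤
        C * ε ^ 3 := by
  have hr : 0 < r := hr'.trans hr'r
  have hΘc : Continuous Θ := continuous_iff_continuousAt.2 fun s => (hΘs s).continuousAt
  have hχc := hχ.continuous
  have hgc := hg.continuous
  obtain ⟨h₁, h₂, h₁s, h₂s, hg1, hg2⟩ := exists_taylor_two hg
  have hk' : ContDiff ℝ ∞ (deriv k) := (contDiff_infty_iff_deriv.1 hk).2
  set l := taylorMean 0 (deriv k) with hl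
  have hls : ContDiff ℝ ∞ l := contDiff_taylorMean 0 hk'
  have hkl : ∀ s, k s - 1 = s * l s := fun s => by
    have := sub_eq_smul_taylorMean hk s
    rwa [hk0, smul_eq_mul] at this
  -- The derivative of `Θ - s³/3` is `s² (k - 1) = s³ l`, hence the weight 3 and a remainder
  -- divisible by `s⁴`.
  set m := taylorMean 3 l with hm
  have hms : ContDiff ℝ ∞ m := contDiff_taylorMean 3 hls
  have hΘm : ∀ s, Θ s - s ^ 3 / 3 = s ^ 4 * m s := fun s => by
    have h1 : ∀ s, HasDerivAt (fun s => Θ s - s ^ 3 / 3) (s ^ 3 • l s) s := fun s =>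
      ((hΘs s).fun_sub (((hasDerivAt_id' s).fun_pow 3).div_const 3)).congr_deriv (by
        rw [smul_eq_mul]
        push_cast
        linear_combination s ^ 2 * hkl s)
    exact eq_pow_smul_taylorMean hls h1 (by simp [hΘ0]) s
  -- The linear deformation from the cubic model at `τ = 0` to the true phase at `τ = 1`.
  set Φ : ℝ → ℝ → ℝ := fun τ s => s ^ 3 / 3 + τ * (Θ s - s ^ 3 / 3) with hΦ
  -- With `τ = sin² θ` the coefficient `(1 - τ) + τ k₁` is smooth and positive for every real `θ`,
  -- as the moment bounds for families require; `τ` itself would have to stay in `[0, 1]`.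
  set kf : ℝ × ℝ → ℝ := fun p => Real.cos p.1 ^ 2 + Real.sin p.1 ^ 2 * k₁ p.2 with hkf
  have hkfs : ContDiff ℝ ∞ kf := by
    have h1 : ContDiff ℝ ∞ fun p : ℝ × ℝ => Real.cos p.1 := Real.contDiff_cos.comp contDiff_fst
    have h2 : ContDiff ℝ ∞ fun p : ℝ × ℝ => Real.sin p.1 := Real.contDiff_sin.comp contDiff_fst
    have h3 : ContDiff ℝ ∞ fun p : ℝ × ℝ => k₁ p.2 := hk₁.comp contDiff_snd
    exact (h1.pow 2).add ((h2.pow 2).mul h3)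
  have hkfpos : ∀ p, 0 < kf p := fun p => by
    have h1 := Real.sin_sq_add_cos_sq p.1
    have h2 := hk₁pos p.2
    have h3 := sq_nonneg (Real.sin p.1)
    have h4 := sq_nonneg (Real.cos p.1)
    rcases h3.eq_or_lt with h5 | h5
    · simp only [hkf, ← h5]; linarith
    · have := mul_pos h5 h2
      simp only [hkf]; linarith
  have hΦd : ∀ θ, ∀ s ∈ uIcc (-r) r,
      HasDerivAt (Φ (Real.sin θ ^ 2)) (s ^ 2 * kf (θ, s)) s := fun θ s hs => by
    rw [uIcc_of_le (by linarith)] at hs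
    have h1 := hkk₁ s (abs_le.2 hs)
    exact ((((hasDerivAt_id' s).fun_pow 3).div_const 3).fun_add
      (((hΘs s).fun_sub (((hasDerivAt_id' s).fun_pow 3).div_const 3)).const_mul
        (Real.sin θ ^ 2))).congr_deriv (by
          simp only [hkf, h1]
          push_cast
          linear_combination (-s ^ 2) * Real.sin_sq_add_cos_sq θ)
  have hT : IsCompact (Icc 0 (Real.pi / 2)) := isCompact_Icc
  have core := exists_norm_integral_pow_mul_scaledExp_le (Θ := fun θ => Φ (Real.sin θ ^ 2))
    hT hr' hr'r hK hkfs hkfpos hΦd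
  have hofR : ∀ {h : ℝ → ℝ}, ContDiff ℝ ∞ h → ContDiff ℝ ∞ fun s => (h s : ℂ) :=
    fun h => ofRealCLM.contDiff.comp h
  obtain ⟨C₄, hC₄0, hC₄⟩ := core 4 (fun p => (χ p.2 : ℂ) * m p.2)
    (((hofR hχ).comp contDiff_snd).mul ((hofR hms).comp contDiff_snd))
    (fun θ s hs => by simp [hχ0 s hs])
  obtain ⟨C₅, hC₅0, hC₅⟩ := core 5 (fun p => (χ p.2 : ℂ) * m p.2 * h₁ p.2)
    ((((hofR hχ).comp contDiff_snd).mul ((hofR hms).comp contDiff_snd)).mul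
      (h₁s.comp contDiff_snd)) (fun θ s hs => by simp [hχ0 s hs])
  obtain ⟨C₂, hC₂0, hC₂⟩ := core 2 (fun p => (χ p.2 : ℂ) * h₂ p.2)
    (((hofR hχ).comp contDiff_snd).mul (h₂s.comp contDiff_snd))
    (fun θ s hs => by simp [hχ0 s hs])
  have hmc := hms.continuous
  have hh₁c := h₁s.continuous
  have hh₂c := h₂s.continuous
  refine ⟨C₄ + C₅ + C₂, by positivity, fun z ε hε hε1 hz => ⟨?_, ?_⟩⟩
  · have hEc : Continuous (Function.uncurry fun τ s => scaledExp (Φ τ) z ε s) := by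
      simp only [Function.uncurry_def, scaledExp, hΦ]; fun_prop
    simp only [Function.uncurry_def] at hEc
    have hFd := hasDerivAt_intervalIntegral_of_continuous
      (F := fun τ s => χ s * g s * scaledExp (Φ τ) z ε s)
      (F' := fun τ s => χ s * g s * (I * (((Θ s - s ^ 3 / 3) / ε ^ 3 : ℝ) : ℂ) *
        scaledExp (Φ τ) z ε s)) (-r) r
      (by simp only [Function.uncurry_def]; fun_prop)
      (by simp only [Function.uncurry_def]; fun_prop)
      (fun τ s => by
        refine HasDerivAt.const_mul _ ?_
        have h1 : HasDerivAt (fun τ => z * (s / ε) + Φ τ s / ε ^ 3)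
            ((Θ s - s ^ 3 / 3) / ε ^ 3) τ :=
          ((((hasDerivAt_id' τ).mul_const (Θ s - s ^ 3 / 3)).const_add (s ^ 3 / 3)).div_const
            (ε ^ 3)).const_add (z * (s / ε)) |>.congr_deriv (by rw [one_mul])
        exact hasDerivAt_cexp_phase h1)
    have hbound : ∀ τ ∈ Ico (0 : ℝ) 1,
        ‖∫ s in (-r)..r, χ s * g s * (I * (((Θ s - s ^ 3 / 3) / ε ^ 3 : ℝ) : ℂ) *
          scaledExp (Φ τ) z ε s)‖ ≤ C₄ * (ε ^ 2 * ‖g 0‖) + C₅ * ε ^ 3 := by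
      intro τ hτ
      have hsq := Real.sqrt_nonneg τ
      have hs1 : Real.sqrt τ ≤ 1 := Real.sqrt_le_one.2 hτ.2.le
      set θ := Real.arcsin (Real.sqrt τ) with hθ
      have hθT : θ ∈ Icc 0 (Real.pi / 2) :=
        ⟨Real.arcsin_nonneg.2 hsq, Real.arcsin_le_pi_div_two _⟩
      have hsin : Real.sin θ ^ 2 = τ := by
        rw [hθ, Real.sin_arcsin (by linarith) hs1, Real.sq_sqrt hτ.1]
      have b4 := hC₄ θ hθT z ε hε hε1 hz
      have b5 := hC₅ θ hθT z ε hε hε1 hz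
      simp only [hsin] at b4 b5
      have hE : Continuous fun s => scaledExp (Φ τ) z ε s :=
        hEc.comp (by fun_prop : Continuous fun s => (τ, s))
      set X₄ := ∫ s in (-r)..r, (s : ℂ) ^ 4 * ((χ s : ℂ) * m s) * scaledExp (Φ τ) z ε s
      set X₅ := ∫ s in (-r)..r, (s : ℂ) ^ 5 * ((χ s : ℂ) * m s * h₁ s) * scaledExp (Φ τ) z ε s
      have heq : ∫ s in (-r)..r, χ s * g s * (I * (((Θ s - s ^ 3 / 3) / ε ^ 3 : ℝ) : ℂ) *
          scaledExp (Φ τ) z ε s) = I / ε ^ 3 * (g 0 * X₄ + X₅) := by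
        rw [← intervalIntegral.integral_const_mul, ← intervalIntegral.integral_add,
          ← intervalIntegral.integral_const_mul]
        · refine intervalIntegral.integral_congr fun s _ => ?_
          simp only [hΘm]
          rw [hg1 s]
          push_cast
          ring
        · exact Continuous.intervalIntegrable (by fun_prop) _ _
        · exact Continuous.intervalIntegrable (by fun_prop) _ _
      rw [heq, norm_mul, norm_div, norm_I, norm_pow, norm_real, Real.norm_eq_abs, abs_of_pos hε]
      -- The fourth moment comes with `g(0)` and the fifth with the rest of `g`. After division by
      -- `ε³` they leave `ε² |g(0)|` and `ε³`.
      calc 1 / ε ^ 3 * ‖g 0 * X₄ + X₅‖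
          ≤ 1 / ε ^ 3 * (‖g 0‖ * (C₄ * ε ^ (4 + 1)) + C₅ * ε ^ (5 + 1)) := by
            gcongr
            refine (norm_add_le _ _).trans (add_le_add ?_ b5)
            rw [norm_mul]
            exact mul_le_mul_of_nonneg_left b4 (norm_nonneg _)
        _ = _ := by
            field_simp
            ring
    have hmv := norm_image_sub_le_of_norm_deriv_le_segment_01'
      (fun τ _ => (hFd τ).hasDerivWithinAt) hbound
    have e1 : Φ 1 = Θ := by ext s; simp only [hΦ]; ring
    have e0 : Φ 0 = fun s => s ^ 3 / 3 := by ext s; simp only [hΦ]; ring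
    simp only [e1, e0] at hmv
    refine hmv.trans ?_
    have t1 : 0 ≤ ε ^ 2 * ‖g 0‖ := by positivity
    have t2 : 0 ≤ ε ^ 3 := by positivity
    nlinarith [mul_nonneg hC₄0 t2, mul_nonneg hC₅0 t1, mul_nonneg hC₂0 t1, mul_nonneg hC₂0 t2]
  · have b2 := hC₂ 0 ⟨le_rfl, by positivity⟩ z ε hε hε1 hz
    have e0 : Φ (Real.sin 0 ^ 2) = fun s => s ^ 3 / 3 := by
      ext s; simp only [hΦ, Real.sin_zero]; ring
    simp only [e0] at b2
    have hE : Continuous (scaledExp (fun s => s ^ 3 / 3) z ε) := by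
      unfold scaledExp; fun_prop
    have heq : (∫ s in (-r)..r, χ s * g s * scaledExp (fun s => s ^ 3 / 3) z ε s) -
          (g 0 * (∫ s in (-r)..r, (s : ℂ) ^ 0 * χ s * scaledExp (fun s => s ^ 3 / 3) z ε s) +
          deriv g 0 * ∫ s in (-r)..r, (s : ℂ) ^ 1 * χ s * scaledExp (fun s => s ^ 3 / 3) z ε s) =
        ∫ s in (-r)..r, (s : ℂ) ^ 2 * ((χ s : ℂ) * h₂ s) *
          scaledExp (fun s => s ^ 3 / 3) z ε s := by
      rw [← intervalIntegral.integral_const_mul, ← intervalIntegral.integral_const_mul,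
        ← intervalIntegral.integral_add, ← intervalIntegral.integral_sub]
      · refine intervalIntegral.integral_congr fun s _ => ?_
        rw [hg2 s]
        ring
      all_goals exact Continuous.intervalIntegrable (by fun_prop) _ _
    rw [heq]
    refine b2.trans ?_
    have t2 : 0 ≤ ε ^ 3 := by positivity
    have t3 : C₂ * ε ^ (2 + 1) = C₂ * ε ^ 3 := rfl
    linarith [mul_nonneg hC₄0 t2, mul_nonneg hC₅0 t2]

/-- Two-term Airy asymptotics for an oscillatory integral whose phase has one stationary point,
which is degenerate of order two. -/
theorem exists_norm_integral_sub_airy_le {a b K : ℝ} (ha : a < 0) (hb : 0 < b) (hK : 0 ≤ K)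
    {Θ f : ℝ → ℝ} (hΘ : ∀ s, HasDerivAt Θ (f s) s) (hΘ0 : Θ 0 = 0) (hf : ContDiff ℝ ∞ f)
    (hf0 : f 0 = 0) (hf1 : deriv f 0 = 0) (hf2 : deriv (deriv f) 0 = 2)
    (hpos : ∀ s ∈ Icc a b, s ≠ 0 → 0 < f s) {g : ℝ → ℂ} (hg : ContDiff ℝ ∞ g) :
    ∃ C, 0 ≤ C ∧ ∃ ε₀ > 0, ∀ z ε : ℝ, 0 < ε → ε ≤ ε₀ → |z| ≤ K →
      ‖(∫ s in a..b, g s * scaledExp Θ z ε s) -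
          2 * Real.pi * ε * (g 0 * airyAi z - I * ε * deriv g 0 * airyAiDeriv z)‖ ≤
        C * (ε ^ 2 * ‖g 0‖ + ε ^ 3) := by
  obtain ⟨k, hk, hfk, hk0⟩ := exists_eq_sq_mul hf hf0 hf1 hf2
  set R := min (-a) b with hR
  have hR0 : 0 < R := lt_min (by linarith) hb
  have hRa : R ≤ -a := min_le_left _ _
  have hRb : R ≤ b := min_le_right _ _
  -- Nested radii: `χ` is 1 up to `R/4` and 0 beyond `R/2`; the localized integral runs over `|s| ≤
  -- 3R/4`, where `ζ = 1`; and `ζ` vanishes beyond `R`.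
  obtain ⟨χ, hχ, hχe, hχ1, hχ0, hχ01⟩ :=
    exists_even_cutoff (r₀ := R / 4) (r := R / 2) (by linarith) (by linarith)
  obtain ⟨ζ, hζ, -, hζ1, hζ0, hζ01⟩ :=
    exists_even_cutoff (r₀ := 3 * R / 4) (r := R) (by linarith) (by linarith)
  have hkpos : ∀ s, |s| ≤ R → 0 < k s := fun s hs => by
    rcases eq_or_ne s 0 with rfl | h
    · rw [hk0]; exact one_pos
    · obtain ⟨h1, h2⟩ := abs_le.1 hs
      have h3 := hpos s ⟨by linarith, by linarith⟩ h
      rw [hfk] at h3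
      exact pos_of_mul_pos_right h3 (sq_nonneg s)
  -- The coefficient `k` is known to be positive only for `|s| ≤ R`. Its convex combination with 1
  -- is positive everywhere and unchanged for `|s| ≤ 3R/4`.
  have hk₁pos : ∀ s, 0 < 1 + ζ s * (k s - 1) := fun s => by
    rcases le_or_gt |s| R with h | h
    · obtain ⟨h1, h2⟩ := hζ01 s
      have h3 := hkpos s h
      rcases h1.eq_or_lt with h4 | h4
      · rw [← h4]; norm_num
      · nlinarith [mul_pos h4 h3]
    · rw [hζ0 s h]; norm_num
  obtain ⟨C₁, hC₁0, hC₁⟩ := exists_norm_integral_cutoff_sub_cube_le (r := 3 * R / 4)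
    (r' := R / 2) (K := K) (by linarith) (by linarith) hK (Θ := Θ) (k := k)
    (fun s => hfk s ▸ hΘ s) hΘ0 hk hk0 (k₁ := fun s => 1 + ζ s * (k s - 1))
    (contDiff_const.add (hζ.mul (hk.sub contDiff_const))) hk₁pos
    (fun s hs => by rw [hζ1 s hs]; ring) hχ hχ0 hg
  obtain ⟨A₀, hA₀0, ε₁, hε₁, hA₀⟩ := exists_norm_integral_cutoff_sub_airyMoment_le zero_le_one
    (r₀ := R / 4) (r := 3 * R / 4) (by linarith) (by linarith) hχ hχe hχ1 hχ01 K
  obtain ⟨A₁, hA₁0, ε₂, hε₂, hA₁⟩ := exists_norm_integral_cutoff_sub_airyMoment_le le_rfl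
    (r₀ := R / 4) (r := 3 * R / 4) (by linarith) (by linarith) hχ hχe hχ1 hχ01 K
  have hvs : ContDiff ℝ ∞ fun s => (1 - χ s : ℂ) * g s :=
    (contDiff_const.sub (ofRealCLM.contDiff.comp hχ)).mul hg
  obtain ⟨C₂, hC₂0, ε₃, hε₃, hC₂⟩ := exists_norm_integral_scaledExp_le_of_pos (c := a)
    (d := -(R / 4)) (by linarith) hK hΘ hf
    (fun s hs => hpos s ⟨hs.1, by linarith [hs.2]⟩ (by linarith [hs.2])) hvs
  obtain ⟨C₃, hC₃0, ε₄, hε₄, hC₃⟩ := exists_norm_integral_scaledExp_le_of_pos (c := R / 4)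
    (d := b) (by linarith) hK hΘ hf
    (fun s hs => hpos s ⟨by linarith [hs.1], hs.2⟩ (by linarith [hs.1])) hvs
  have hχc := hχ.continuous
  have hgc := hg.continuous
  have hΘc : Continuous Θ := continuous_iff_continuousAt.2 fun s => (hΘ s).continuousAt
  refine ⟨2 * C₁ + C₂ + C₃ + ‖g 0‖ * A₀ + ‖deriv g 0‖ * A₁, by positivity,
    min 1 (min (min ε₁ ε₂) (min ε₃ ε₄)), by positivity, fun z ε hε hε₀ hz => ?_⟩
  have hε1 : ε ≤ 1 := hε₀.trans (min_le_left _ _)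
  have hεr := hε₀.trans (min_le_right _ _)
  have hεl := hεr.trans (min_le_left _ _)
  have hεr' := hεr.trans (min_le_right _ _)
  obtain ⟨b1, b2⟩ := hC₁ z ε hε hε1 hz
  have b3 := hA₀ z ε hε (hεl.trans (min_le_left _ _)) hz
  have b4 := hA₁ z ε hε (hεl.trans (min_le_right _ _)) hz
  have b5 := hC₂ z ε hε (hεr'.trans (min_le_left _ _)) hz
  have b6 := hC₃ z ε hε (hεr'.trans (min_le_right _ _)) hz
  have hE : Continuous (scaledExp Θ z ε) := by unfold scaledExp; fun_prop
  have hmain : ∫ s in a..b, χ s * g s * scaledExp Θ z ε s =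
      ∫ s in (-(3 * R / 4))..(3 * R / 4), χ s * g s * scaledExp Θ z ε s := by
    have hi : ∀ c d : ℝ, IntervalIntegrable (fun s => χ s * g s * scaledExp Θ z ε s) volume c d :=
      fun c d => Continuous.intervalIntegrable (by fun_prop) _ _
    rw [← intervalIntegral.integral_add_adjacent_intervals (hi a (-(3 * R / 4))) (hi _ b),
      ← intervalIntegral.integral_add_adjacent_intervals (hi (-(3 * R / 4)) (3 * R / 4)) (hi _ b)]
    have z1 : ∫ s in a..(-(3 * R / 4)), χ s * g s * scaledExp Θ z ε s = 0 := by
      rw [intervalIntegral.integral_congr (g := fun _ => 0), intervalIntegral.integral_zero]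
      intro s hs
      rw [uIcc_of_le (by linarith)] at hs
      have : χ s = 0 := hχ0 s (by rw [abs_of_neg (by linarith [hs.2])]; linarith [hs.2])
      simp [this]
    have z2 : ∫ s in (3 * R / 4)..b, χ s * g s * scaledExp Θ z ε s = 0 := by
      rw [intervalIntegral.integral_congr (g := fun _ => 0), intervalIntegral.integral_zero]
      intro s hs
      rw [uIcc_of_le (by linarith)] at hs
      have : χ s = 0 := hχ0 s (by rw [abs_of_pos (by linarith [hs.1])]; linarith [hs.1])
      simp [this]
    rw [z1, z2, zero_add, add_zero]
  have hrest : ∫ s in a..b, (1 - χ s : ℂ) * g s * scaledExp Θ z ε s =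
      (∫ s in a..(-(R / 4)), (1 - χ s : ℂ) * g s * scaledExp Θ z ε s) +
      ∫ s in (R / 4)..b, (1 - χ s : ℂ) * g s * scaledExp Θ z ε s := by
    have hi : ∀ c d : ℝ, IntervalIntegrable
        (fun s => (1 - χ s : ℂ) * g s * scaledExp Θ z ε s) volume c d :=
      fun c d => Continuous.intervalIntegrable (by fun_prop) _ _
    rw [← intervalIntegral.integral_add_adjacent_intervals (hi a (-(R / 4))) (hi _ b),
      ← intervalIntegral.integral_add_adjacent_intervals (hi (-(R / 4)) (R / 4)) (hi _ b)]
    have z1 : ∫ s in (-(R / 4))..(R / 4), (1 - χ s : ℂ) * g s * scaledExp Θ z ε s = 0 := by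
      rw [intervalIntegral.integral_congr (g := fun _ => 0), intervalIntegral.integral_zero]
      intro s hs
      rw [uIcc_of_le (by linarith)] at hs
      simp [hχ1 s (abs_le.2 hs)]
    rw [z1, zero_add]
  have hsplit : ∫ s in a..b, g s * scaledExp Θ z ε s =
      (∫ s in a..b, χ s * g s * scaledExp Θ z ε s) +
      ∫ s in a..b, (1 - χ s : ℂ) * g s * scaledExp Θ z ε s := by
    rw [← intervalIntegral.integral_add]
    · refine intervalIntegral.integral_congr fun s _ => ?_
      ring
    all_goals exact Continuous.intervalIntegrable (by fun_prop) _ _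
  have hAi : airyMoment 0 z + (-1) ^ 0 * conj (airyMoment 0 z) = 2 * Real.pi * airyAi z := by
    rw [airyAi_eq, pow_zero, one_mul, add_conj]
    push_cast
    field_simp
  have hAi' : airyMoment 1 z + (-1) ^ 1 * conj (airyMoment 1 z) =
      -(2 * Real.pi * I * airyAiDeriv z) := by
    rw [airyAiDeriv_eq, pow_one, neg_one_mul, ← sub_eq_add_neg, sub_conj]
    push_cast
    field_simp
  rw [hAi] at b3
  rw [hAi'] at b4
  rw [hsplit, hmain, hrest]
  set X := ∫ s in (-(3 * R / 4))..(3 * R / 4), χ s * g s * scaledExp Θ z ε s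
  set Y := ∫ s in (-(3 * R / 4))..(3 * R / 4),
    χ s * g s * scaledExp (fun s => s ^ 3 / 3) z ε s
  set Z₀ := ∫ s in (-(3 * R / 4))..(3 * R / 4),
    (s : ℂ) ^ 0 * χ s * scaledExp (fun s => s ^ 3 / 3) z ε s
  set Z₁ := ∫ s in (-(3 * R / 4))..(3 * R / 4),
    (s : ℂ) ^ 1 * χ s * scaledExp (fun s => s ^ 3 / 3) z ε s
  set U := ∫ s in a..(-(R / 4)), (1 - χ s : ℂ) * g s * scaledExp Θ z ε s
  set V := ∫ s in (R / 4)..b, (1 - χ s : ℂ) * g s * scaledExp Θ z ε s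
  have heq : X + (U + V) - 2 * Real.pi * ε *
      (g 0 * airyAi z - I * ε * deriv g 0 * airyAiDeriv z) =
      (X - Y) + (Y - (g 0 * Z₀ + deriv g 0 * Z₁)) + U + V +
      g 0 * (Z₀ - ε ^ (0 + 1) * (2 * Real.pi * airyAi z)) +
      deriv g 0 * (Z₁ - ε ^ (1 + 1) * -(2 * Real.pi * I * airyAiDeriv z)) := by ring
  rw [heq]
  have b3' := mul_le_mul_of_nonneg_left b3 (norm_nonneg (g 0))
  have b4' := mul_le_mul_of_nonneg_left b4 (norm_nonneg (deriv g 0))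
  rw [← norm_mul] at b3' b4'
  refine (norm_add_le _ _).trans ((add_le_add ((norm_add_le _ _).trans (add_le_add
    ((norm_add_le _ _).trans (add_le_add ((norm_add_le _ _).trans (add_le_add
    ((norm_add_le _ _).trans (add_le_add b1 b2)) b5)) b6)) b3')) b4').trans ?_)
  have t1 : 0 ≤ ε ^ 2 * ‖g 0‖ := by positivity
  have hS : 0 ≤ C₁ + C₂ + C₃ + ‖g 0‖ * A₀ + ‖deriv g 0‖ * A₁ := by positivity
  linarith [mul_nonneg hS t1]

/-! ### The dispersion relation -/

section Dispersion

variable {γ₁ γ₂ : ℝ}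

theorem auxC_arg_pos (hγ₁ : 0 < γ₁) (hγ : γ₁ < γ₂) (p : ℝ) :
    0 < γ₁ ^ 2 + γ₂ ^ 2 + 2 * γ₁ * γ₂ * Real.cos p := by
  have h := Real.neg_one_le_cos p
  have h2 : 0 < γ₁ * γ₂ := mul_pos hγ₁ (hγ₁.trans hγ)
  nlinarith [mul_nonneg h2.le (by linarith : 0 ≤ Real.cos p + 1), pow_pos (sub_pos.2 hγ) 2]

theorem auxC_pos (hγ₁ : 0 < γ₁) (hγ : γ₁ < γ₂) (p : ℝ) : 0 < auxC γ₁ γ₂ p :=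
  Real.sqrt_pos.2 (auxC_arg_pos hγ₁ hγ p)

theorem auxC_sq (hγ₁ : 0 < γ₁) (hγ : γ₁ < γ₂) (p : ℝ) :
    auxC γ₁ γ₂ p ^ 2 = γ₁ ^ 2 + γ₂ ^ 2 + 2 * γ₁ * γ₂ * Real.cos p :=
  Real.sq_sqrt (auxC_arg_pos hγ₁ hγ p).le

theorem omega₂_pos (hγ₁ : 0 < γ₁) (hγ : γ₁ < γ₂) (p : ℝ) : 0 < omega₂ γ₁ γ₂ p :=
  Real.sqrt_pos.2 (by linarith [auxC_pos hγ₁ hγ (2 * p)])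

theorem omega₂_sq (hγ₁ : 0 < γ₁) (hγ : γ₁ < γ₂) (p : ℝ) :
    omega₂ γ₁ γ₂ p ^ 2 = γ₁ + γ₂ + auxC γ₁ γ₂ (2 * p) :=
  Real.sq_sqrt (by linarith [auxC_pos hγ₁ hγ (2 * p)])

theorem contDiff_auxC (hγ₁ : 0 < γ₁) (hγ : γ₁ < γ₂) :
    ContDiff ℝ ∞ fun p => auxC γ₁ γ₂ (2 * p) := by
  have h : ContDiff ℝ ∞ fun p : ℝ => γ₁ ^ 2 + γ₂ ^ 2 + 2 * γ₁ * γ₂ * Real.cos (2 * p) :=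
    contDiff_const.add (contDiff_const.mul
      (Real.contDiff_cos.comp (contDiff_const.mul contDiff_id)))
  exact h.sqrt fun p => (auxC_arg_pos hγ₁ hγ (2 * p)).ne'

theorem contDiff_omega₂ (hγ₁ : 0 < γ₁) (hγ : γ₁ < γ₂) : ContDiff ℝ ∞ (omega₂ γ₁ γ₂) :=
  (contDiff_const.add (contDiff_auxC hγ₁ hγ)).sqrt fun p => by
    have := auxC_pos hγ₁ hγ (2 * p)
    linarith

theorem hasDerivAt_auxC (hγ₁ : 0 < γ₁) (hγ : γ₁ < γ₂) (p : ℝ) :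
    HasDerivAt (fun p => auxC γ₁ γ₂ (2 * p))
      (-(2 * γ₁ * γ₂ * Real.sin (2 * p)) / auxC γ₁ γ₂ (2 * p)) p := by
  have h := ((((hasDerivAt_id' p).const_mul 2).cos.const_mul (2 * γ₁ * γ₂)).const_add
    (γ₁ ^ 2 + γ₂ ^ 2)).sqrt (auxC_arg_pos hγ₁ hγ (2 * p)).ne'
  have hc := auxC_pos hγ₁ hγ (2 * p)
  refine h.congr_deriv ?_
  change _ / (2 * auxC γ₁ γ₂ (2 * p)) = _
  field_simp

theorem hasDerivAt_omega₂ (hγ₁ : 0 < γ₁) (hγ : γ₁ < γ₂) (p : ℝ) :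
    HasDerivAt (omega₂ γ₁ γ₂)
      (-(γ₁ * γ₂ * Real.sin (2 * p)) / (auxC γ₁ γ₂ (2 * p) * omega₂ γ₁ γ₂ p)) p := by
  have hc := auxC_pos hγ₁ hγ (2 * p)
  have hw := omega₂_pos hγ₁ hγ p
  have h := ((hasDerivAt_auxC hγ₁ hγ p).const_add (γ₁ + γ₂)).sqrt (by linarith)
  refine h.congr_deriv ?_
  change _ / (2 * omega₂ γ₁ γ₂ p) = _
  field_simp

theorem deriv_omega₂ (hγ₁ : 0 < γ₁) (hγ : γ₁ < γ₂) : deriv (omega₂ γ₁ γ₂) =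
    fun p => -(γ₁ * γ₂ * Real.sin (2 * p)) / (auxC γ₁ γ₂ (2 * p) * omega₂ γ₁ γ₂ p) :=
  funext fun p => (hasDerivAt_omega₂ hγ₁ hγ p).deriv

/-- The cubic polynomial in `C(2p)` whose sign is the sign of `ω₂''(p)`. -/
noncomputable def bendingPoly (γ₁ γ₂ c : ℝ) : ℝ :=
  2 * (γ₁ + γ₂) * (γ₂ - γ₁) ^ 2 - (γ₂ - γ₁) ^ 2 * c - c ^ 3

/-- Since `C(2p)` also decreases strictly on `[0, π/2]`, the composite increases there, so `ω₂''`
changes sign at most once. -/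
theorem bendingPoly_strictAnti (γ₁ γ₂ : ℝ) : StrictAnti (bendingPoly γ₁ γ₂) := by
  intro a b hab
  have h1 : a ^ 3 < b ^ 3 := Odd.strictMono_pow (by decide) hab
  have h2 := mul_le_mul_of_nonneg_left hab.le (sq_nonneg (γ₂ - γ₁))
  simp only [bendingPoly]
  linarith

/-- The cosine and the squared sine are polynomials in `C(2p)`. Over the common denominator `4 C³
ω₂³` the numerator contains the factor `ω₂⁴ = (γ₁ + γ₂ + C)²`, and the cofactor is `bendingPoly`. -/
theorem hasDerivAt_deriv_omega₂ (hγ₁ : 0 < γ₁) (hγ : γ₁ < γ₂) (p : ℝ) :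
    HasDerivAt (deriv (omega₂ γ₁ γ₂))
      (omega₂ γ₁ γ₂ p / (4 * auxC γ₁ γ₂ (2 * p) ^ 3) *
        bendingPoly γ₁ γ₂ (auxC γ₁ γ₂ (2 * p))) p := by
  rw [deriv_omega₂ hγ₁ hγ]
  have hc := auxC_pos hγ₁ hγ (2 * p)
  have hw := omega₂_pos hγ₁ hγ p
  have hc2 := auxC_sq hγ₁ hγ (2 * p)
  have hw2 := omega₂_sq hγ₁ hγ p
  have h := ((((hasDerivAt_id' p).const_mul 2).sin.const_mul (γ₁ * γ₂)).fun_neg).fun_div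
    ((hasDerivAt_auxC hγ₁ hγ p).fun_mul (hasDerivAt_omega₂ hγ₁ hγ p)) (mul_pos hc hw).ne'
  refine h.congr_deriv ?_
  have hsc := Real.sin_sq_add_cos_sq (2 * p)
  set c := auxC γ₁ γ₂ (2 * p) with hcdef
  set w := omega₂ γ₁ γ₂ p with hwdef
  set S := Real.sin (2 * p)
  set Q := Real.cos (2 * p)
  have hg : 2 * γ₁ * γ₂ * Q = c ^ 2 - γ₁ ^ 2 - γ₂ ^ 2 := by linarith
  have hs : (2 * γ₁ * γ₂ * S) ^ 2 = 4 * γ₁ ^ 2 * γ₂ ^ 2 - (c ^ 2 - γ₁ ^ 2 - γ₂ ^ 2) ^ 2 := by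
    rw [← hg]; linear_combination 4 * γ₁ ^ 2 * γ₂ ^ 2 * hsc
  have e1 : (-(γ₁ * γ₂ * (Q * (2 * 1))) * (c * w) - -(γ₁ * γ₂ * S) *
      (-(2 * γ₁ * γ₂ * S) / c * w + c * (-(γ₁ * γ₂ * S) / (c * w)))) / (c * w) ^ 2 =
      (-4 * (2 * γ₁ * γ₂ * Q) * c ^ 2 * w ^ 2 - 2 * (2 * γ₁ * γ₂ * S) ^ 2 * w ^ 2 -
        (2 * γ₁ * γ₂ * S) ^ 2 * c) / (4 * c ^ 3 * w ^ 3) := by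
    field_simp
    ring
  have e2 : w / (4 * c ^ 3) * bendingPoly γ₁ γ₂ c =
      ((w ^ 2) ^ 2 * bendingPoly γ₁ γ₂ c) / (4 * c ^ 3 * w ^ 3) := by
    field_simp
  rw [e1, e2, hg, hs, hw2, bendingPoly]
  congr 1
  ring

theorem iteratedDeriv_two_omega₂ (hγ₁ : 0 < γ₁) (hγ : γ₁ < γ₂) :
    iteratedDeriv 2 (omega₂ γ₁ γ₂) = fun p => omega₂ γ₁ γ₂ p / (4 * auxC γ₁ γ₂ (2 * p) ^ 3) *
        bendingPoly γ₁ γ₂ (auxC γ₁ γ₂ (2 * p)) := by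
  rw [iteratedDeriv_succ, iteratedDeriv_one]
  exact funext fun p => (hasDerivAt_deriv_omega₂ hγ₁ hγ p).deriv

theorem auxC_lt_auxC (hγ₁ : 0 < γ₁) (hγ : γ₁ < γ₂) {p p' : ℝ} (hp : 0 ≤ p) (hpp' : p < p')
    (hp' : p' ≤ Real.pi / 2) : auxC γ₁ γ₂ (2 * p') < auxC γ₁ γ₂ (2 * p) := by
  refine Real.sqrt_lt_sqrt (auxC_arg_pos hγ₁ hγ _).le ?_
  have h := Real.strictAntiOn_cos (a := 2 * p) (b := 2 * p') ⟨by linarith, by linarith⟩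
    ⟨by linarith, by linarith⟩ (by linarith)
  have h2 : 0 < 2 * γ₁ * γ₂ := by have := hγ₁.trans hγ; positivity
  linarith [mul_lt_mul_of_pos_left h h2]

theorem iteratedDeriv_two_omega₂_pos_iff (hγ₁ : 0 < γ₁) (hγ : γ₁ < γ₂) (p : ℝ) :
    0 < iteratedDeriv 2 (omega₂ γ₁ γ₂) p ↔ 0 < bendingPoly γ₁ γ₂ (auxC γ₁ γ₂ (2 * p)) := by
  have hc := auxC_pos hγ₁ hγ (2 * p)
  have hw := omega₂_pos hγ₁ hγ p
  rw [iteratedDeriv_two_omega₂ hγ₁ hγ]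
  exact mul_pos_iff_of_pos_left (by positivity)

theorem iteratedDeriv_two_omega₂_neg_iff (hγ₁ : 0 < γ₁) (hγ : γ₁ < γ₂) (p : ℝ) :
    iteratedDeriv 2 (omega₂ γ₁ γ₂) p < 0 ↔ bendingPoly γ₁ γ₂ (auxC γ₁ γ₂ (2 * p)) < 0 := by
  have hc := auxC_pos hγ₁ hγ (2 * p)
  have hw := omega₂_pos hγ₁ hγ p
  rw [iteratedDeriv_two_omega₂ hγ₁ hγ]
  have hpos : 0 < omega₂ γ₁ γ₂ p / (4 * auxC γ₁ γ₂ (2 * p) ^ 3) := by positivity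
  exact ⟨fun h => neg_of_mul_neg_right h hpos.le, mul_neg_of_pos_of_neg hpos⟩

theorem sin_two_mul_pos {p : ℝ} (hp : p ∈ Ioo 0 (Real.pi / 2)) : 0 < Real.sin (2 * p) :=
  Real.sin_pos_of_pos_of_lt_pi (by linarith [hp.1]) (by linarith [hp.2])

/-- The unique inflection point of the optical branch and its properties. -/
theorem exists_inflection (hγ₁ : 0 < γ₁) (hγ : γ₁ < γ₂) :
    ∃ pstar ∈ Ioo (0 : ℝ) (Real.pi / 2),
      iteratedDeriv 2 (omega₂ γ₁ γ₂) pstar = 0 ∧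
      (∀ p ∈ Ioo 0 pstar, iteratedDeriv 2 (omega₂ γ₁ γ₂) p < 0) ∧
      (∀ p ∈ Ioo pstar (Real.pi / 2), 0 < iteratedDeriv 2 (omega₂ γ₁ γ₂) p) ∧
      0 < cStar γ₁ γ₂ pstar ∧ 0 < qStar γ₁ γ₂ pstar ∧
      ∀ p ∈ Icc (-(Real.pi / 2)) (Real.pi / 2), p ≠ pstar →
        deriv (omega₂ γ₁ γ₂) pstar < deriv (omega₂ γ₁ γ₂) p := by
  have hγ₂ : 0 < γ₂ := hγ₁.trans hγ
  have hπ := Real.pi_pos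
  have hcc := (contDiff_auxC hγ₁ hγ).continuous
  have hcont : Continuous fun p => bendingPoly γ₁ γ₂ (auxC γ₁ γ₂ (2 * p)) := by
    unfold bendingPoly; fun_prop
  have h0 : bendingPoly γ₁ γ₂ (auxC γ₁ γ₂ (2 * 0)) < 0 := by
    have h1 : auxC γ₁ γ₂ (2 * 0) = γ₁ + γ₂ := by
      rw [auxC, mul_zero, Real.cos_zero,
        show γ₁ ^ 2 + γ₂ ^ 2 + 2 * γ₁ * γ₂ * 1 = (γ₁ + γ₂) ^ 2 by ring,
        Real.sqrt_sq (by positivity)]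
    rw [h1, bendingPoly]
    have : 2 * (γ₁ + γ₂) * (γ₂ - γ₁) ^ 2 - (γ₂ - γ₁) ^ 2 * (γ₁ + γ₂) - (γ₁ + γ₂) ^ 3 =
      -((γ₁ + γ₂) * (4 * γ₁ * γ₂)) := by ring
    rw [this]
    exact neg_neg_of_pos (by positivity)
  have h2 : 0 < bendingPoly γ₁ γ₂ (auxC γ₁ γ₂ (2 * (Real.pi / 2))) := by
    have h1 : auxC γ₁ γ₂ (2 * (Real.pi / 2)) = γ₂ - γ₁ := by
      rw [auxC, show 2 * (Real.pi / 2) = Real.pi by ring, Real.cos_pi,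
        show γ₁ ^ 2 + γ₂ ^ 2 + 2 * γ₁ * γ₂ * -1 = (γ₂ - γ₁) ^ 2 by ring,
        Real.sqrt_sq (by linarith)]
    rw [h1, bendingPoly]
    have : 2 * (γ₁ + γ₂) * (γ₂ - γ₁) ^ 2 - (γ₂ - γ₁) ^ 2 * (γ₂ - γ₁) - (γ₂ - γ₁) ^ 3 =
      4 * γ₁ * (γ₂ - γ₁) ^ 2 := by ring
    rw [this]
    have := sub_pos.2 hγ
    positivity
  -- At the ends `C` equals `γ₁ + γ₂` and `γ₂ - γ₁`, where the polynomial takes values of opposite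
  -- sign.
  obtain ⟨pstar, hp, hroot⟩ := intermediate_value_Ioo (by positivity : (0 : ℝ) ≤ Real.pi / 2)
    hcont.continuousOn ⟨h0, h2⟩
  simp only [] at hroot
  have hneg : ∀ p ∈ Ioo 0 pstar, iteratedDeriv 2 (omega₂ γ₁ γ₂) p < 0 := fun p hp' => by
    rw [iteratedDeriv_two_omega₂_neg_iff hγ₁ hγ, ← hroot]
    exact bendingPoly_strictAnti γ₁ γ₂ (auxC_lt_auxC hγ₁ hγ hp'.1.le hp'.2 hp.2.le)
  have hpos : ∀ p ∈ Ioo pstar (Real.pi / 2), 0 < iteratedDeriv 2 (omega₂ γ₁ γ₂) p :=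
    fun p hp' => by
      rw [iteratedDeriv_two_omega₂_pos_iff hγ₁ hγ, ← hroot]
      exact bendingPoly_strictAnti γ₁ γ₂ (auxC_lt_auxC hγ₁ hγ hp.1.le hp'.1 hp'.2.le)
  have hsin := sin_two_mul_pos hp
  have hc := auxC_pos hγ₁ hγ (2 * pstar)
  have hw := omega₂_pos hγ₁ hγ pstar
  have hcs : 0 < cStar γ₁ γ₂ pstar := by
    rw [cStar, (hasDerivAt_omega₂ hγ₁ hγ pstar).deriv, neg_div, neg_neg]
    positivity
  have hwc := (contDiff_infty_iff_deriv.1 (contDiff_omega₂ hγ₁ hγ)).2.continuous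
  have hdd : ∀ p, deriv (deriv (omega₂ γ₁ γ₂)) p = iteratedDeriv 2 (omega₂ γ₁ γ₂) p := fun p => by
    rw [iteratedDeriv_succ, iteratedDeriv_one]
  refine ⟨pstar, hp, ?_, hneg, hpos, hcs, ?_, ?_⟩
  · rw [iteratedDeriv_two_omega₂ hγ₁ hγ]
    simp only [hroot, mul_zero]
  · have hQ : DifferentiableAt ℝ
        (fun p => omega₂ γ₁ γ₂ p / (4 * auxC γ₁ γ₂ (2 * p) ^ 3)) pstar :=
      (hasDerivAt_omega₂ hγ₁ hγ pstar).differentiableAt.fun_div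
        (((hasDerivAt_auxC hγ₁ hγ pstar).differentiableAt.fun_pow 3).const_mul 4) (by positivity)
    have hcd := hasDerivAt_auxC hγ₁ hγ pstar
    have hP : HasDerivAt (fun p => bendingPoly γ₁ γ₂ (auxC γ₁ γ₂ (2 * p)))
        (((γ₂ - γ₁) ^ 2 + 3 * auxC γ₁ γ₂ (2 * pstar) ^ 2) *
          (2 * γ₁ * γ₂ * Real.sin (2 * pstar) / auxC γ₁ γ₂ (2 * pstar))) pstar :=
      (((hcd.const_mul ((γ₂ - γ₁) ^ 2)).const_sub
        (2 * (γ₁ + γ₂) * (γ₂ - γ₁) ^ 2)).fun_sub (hcd.fun_pow 3)).congr_deriv (by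
          push_cast; ring)
    -- At a zero of the polynomial only the product-rule term that differentiates it survives, so
    -- the prefactor need only be differentiable.
    have h3 := hQ.hasDerivAt.fun_mul hP
    rw [qStar, iteratedDeriv_succ, iteratedDeriv_two_omega₂ hγ₁ hγ, h3.deriv, hroot, mul_zero,
      zero_add]
    positivity
  · intro p hpI hne
    -- For `p ≤ 0` the sign of the sine gives `ω₂' ≥ 0 > -c*`. For `p > 0`, `ω₂'` decreases up to
    -- `p*` and increases afterwards.
    rcases le_or_gt p 0 with hp0 | hp0
    · have h4 : 0 ≤ deriv (omega₂ γ₁ γ₂) p := by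
        have hc := auxC_pos hγ₁ hγ (2 * p)
        have hw := omega₂_pos hγ₁ hγ p
        have hs : Real.sin (2 * p) ≤ 0 :=
          Real.sin_nonpos_of_nonpos_of_neg_pi_le (by linarith) (by linarith [hpI.1])
        rw [deriv_omega₂ hγ₁ hγ]
        refine div_nonneg ?_ (by positivity)
        have : γ₁ * γ₂ * Real.sin (2 * p) ≤ 0 :=
          mul_nonpos_of_nonneg_of_nonpos (by positivity) hs
        linarith
      rw [cStar] at hcs
      linarith
    · rcases lt_or_gt_of_ne hne with h | h
      · refine strictAntiOn_of_deriv_neg (convex_Icc 0 pstar) hwc.continuousOn (fun q hq => ?_)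
          ⟨hp0.le, h.le⟩ ⟨hp.1.le, le_rfl⟩ h
        rw [interior_Icc] at hq
        rw [hdd]; exact hneg q hq
      · refine strictMonoOn_of_deriv_pos (convex_Icc pstar (Real.pi / 2)) hwc.continuousOn
          (fun q hq => ?_) ⟨le_rfl, hp.2.le⟩ ⟨h.le, hpI.2⟩ h
        rw [interior_Icc] at hq
        rw [hdd]; exact hpos q hq

end Dispersion

/-! ### The semi-discrete Fourier transforms -/

theorem iteratedDeriv_const_mul_cexp (w c : ℂ) (m : ℕ) :
    iteratedDeriv m (fun p : ℝ => w * cexp (c * p)) = fun p : ℝ => w * c ^ m * cexp (c * p) := by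
  induction m with
  | zero => simp
  | succ m ih =>
    rw [iteratedDeriv_succ, ih]
    funext p
    have h : HasDerivAt (fun p : ℝ => c * (p : ℂ)) c p := by
      simpa using (hasDerivAt_id' p).ofReal_comp.const_mul c
    rw [(h.cexp.const_mul (w * c ^ m)).deriv]
    ring

/-- Multiplying by `k² ≤ 1 + x_k²` leaves two Schwartz seminorm bounds, of orders `m` and `m + 2`,
so the terms are `O(1/k²)`. The hypothesis covers the even and the odd sublattice at once. -/
theorem summable_abs_pow_mul_schwartz (W : SchwartzMap ℝ ℝ) {x : ℤ → ℝ}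
    (hx : ∀ k : ℤ, (k : ℝ) ^ 2 ≤ 1 + x k ^ 2) (m : ℕ) :
    Summable fun k => |x k| ^ m * |W (x k)| := by
  obtain ⟨C₁, -, h₁⟩ := W.decay m 0
  obtain ⟨C₂, -, h₂⟩ := W.decay (m + 2) 0
  simp only [norm_iteratedFDeriv_zero, Real.norm_eq_abs] at h₁ h₂
  refine Summable.of_norm_bounded_eventually (g := fun k : ℤ => (C₁ + C₂) * (1 / (k : ℝ) ^ 2))
    ((Real.summable_one_div_int_pow.2 one_lt_two).mul_left _) ?_
  filter_upwards [(Set.finite_singleton (0 : ℤ)).compl_mem_cofinite] with k hk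
  have hk0 : (k : ℝ) ≠ 0 := by exact_mod_cast hk
  have hk2 : 0 < (k : ℝ) ^ 2 := by positivity
  rw [Real.norm_eq_abs, abs_of_nonneg (by positivity), mul_one_div, le_div_iff₀ hk2]
  have h3 := h₁ (x k)
  have h4 := h₂ (x k)
  rw [pow_add, sq_abs] at h4
  calc |x k| ^ m * |W (x k)| * (k : ℝ) ^ 2 ≤ |x k| ^ m * |W (x k)| * (1 + x k ^ 2) :=
        mul_le_mul_of_nonneg_left (hx k) (by positivity)
    _ = |x k| ^ m * |W (x k)| + |x k| ^ m * x k ^ 2 * |W (x k)| := by ring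
    _ ≤ _ := add_le_add h3 h4

theorem contDiff_tsum_schwartz_mul_cexp (W : SchwartzMap ℝ ℝ) {x : ℤ → ℝ}
    (hx : ∀ k : ℤ, (k : ℝ) ^ 2 ≤ 1 + x k ^ 2) :
    ContDiff ℝ ∞ fun p : ℝ => ∑' k : ℤ, (W (x k) : ℂ) * cexp (-I * (p : ℂ) * (x k : ℂ)) := by
  have hrw : ∀ (k : ℤ), (fun p : ℝ => (W (x k) : ℂ) * cexp (-I * (p : ℂ) * (x k : ℂ))) =
      fun p : ℝ => (W (x k) : ℂ) * cexp ((-I * x k) * p) := fun k => by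
    funext p
    congr 2
    ring
  refine contDiff_tsum (N := ⊤) (v := fun m k => |x k| ^ m * |W (x k)|) (fun k => ?_)
    (fun m _ => summable_abs_pow_mul_schwartz W hx m) (fun m k p _ => ?_)
  · exact contDiff_const.mul ((((contDiff_const.mul ofRealCLM.contDiff)).mul contDiff_const).cexp)
  · rw [norm_iteratedFDeriv_eq_norm_iteratedDeriv, hrw, iteratedDeriv_const_mul_cexp]
    have h1 : ‖cexp (-I * x k * p)‖ = 1 := by
      rw [show -I * (x k : ℂ) * p = I * ((-(x k * p) : ℝ) : ℂ) by push_cast; ring]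
      exact norm_cexp_phase _
    rw [norm_mul, h1, norm_mul, norm_pow, norm_mul, norm_neg, norm_I, norm_real, norm_real,
      Real.norm_eq_abs, Real.norm_eq_abs]
    apply le_of_eq; ring

theorem tildeV_apply_zero (W : SchwartzMap ℝ ℝ) (p : ℝ) : tildeV W p 0 =
    ∑' k : ℤ, (W (2 * (k : ℝ)) : ℂ) * cexp (-I * (p : ℂ) * ((2 * (k : ℝ) : ℝ) : ℂ)) := by
  simp [tildeV]

theorem tildeV_apply_one (W : SchwartzMap ℝ ℝ) (p : ℝ) : tildeV W p 1 =
    ∑' k : ℤ, (W (2 * (k : ℝ) + 1) : ℂ) * cexp (-I * (p : ℂ) * ((2 * (k : ℝ) + 1 : ℝ) : ℂ)) := by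
  simp [tildeV]

theorem contDiff_tildeV (W : SchwartzMap ℝ ℝ) (i : Fin 2) :
    ContDiff ℝ ∞ fun p => tildeV W p i := by
  fin_cases i
  · simp only [Fin.zero_eta, tildeV_apply_zero]
    exact contDiff_tsum_schwartz_mul_cexp W fun k => by nlinarith [sq_nonneg (k : ℝ)]
  · simp only [Fin.mk_one, tildeV_apply_one]
    -- The required inequality is `3k² + 4k + 2 ≥ 0`, and three times the left side is `(3k + 2)² +
    -- 2`.
    exact contDiff_tsum_schwartz_mul_cexp W fun k => by nlinarith [sq_nonneg (3 * (k : ℝ) + 2)]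

/-- This rests on `W` being real valued; it is what links the two fronts. -/
theorem tildeV_neg (W : SchwartzMap ℝ ℝ) (p : ℝ) (i : Fin 2) :
    tildeV W (-p) i = conj (tildeV W p i) := by
  have key : ∀ w x : ℝ, (w : ℂ) * cexp (-I * ((-p : ℝ) : ℂ) * (x : ℂ)) =
      conj ((w : ℂ) * cexp (-I * (p : ℂ) * (x : ℂ))) := fun w x => by
    rw [map_mul, ← exp_conj, conj_ofReal]
    simp only [map_mul, map_neg, conj_I, conj_ofReal]
    congr 2
    push_cast
    ring
  fin_cases i
  · simp only [Fin.zero_eta, tildeV_apply_zero, conj_tsum, key]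
  · simp only [Fin.mk_one, tildeV_apply_one, conj_tsum, key]

/-! ### The spectral projection -/

section Projection

variable {γ₁ γ₂ : ℝ}

theorem applyB_apply (γ₁ γ₂ p : ℝ) (v : Fin 2 → ℂ) (j : Fin 2) :
    applyB γ₁ γ₂ p v j = matB γ₁ γ₂ p j 0 * v 0 + matB γ₁ γ₂ p j 1 * v 1 := by
  simp [applyB, Matrix.mulVec, dotProduct, Fin.sum_univ_two]

theorem matB_neg (γ₁ γ₂ p : ℝ) : matB γ₁ γ₂ (-p) = matB γ₁ γ₂ p := by
  simp [matB, auxJ, auxG, auxC]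

theorem contDiff_matB (hγ₁ : 0 < γ₁) (hγ : γ₁ < γ₂) (i j : Fin 2) :
    ContDiff ℝ ∞ fun p => matB γ₁ γ₂ p i j := by
  have hG : ContDiff ℝ ∞ fun p => auxG γ₁ γ₂ (2 * p) :=
    contDiff_const.add (contDiff_auxC hγ₁ hγ)
  have hcos := Real.contDiff_cos (n := ∞)
  have hγ₂ : 0 < γ₂ := hγ₁.trans hγ
  have hJ : ContDiff ℝ ∞ fun p => auxJ γ₁ γ₂ p :=
    (hG.pow 2).add (contDiff_const.mul (hcos.pow 2))
  have hJ0 : ∀ p, auxJ γ₁ γ₂ p ≠ 0 := fun p => by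
    have h1 : 0 < auxG γ₁ γ₂ (2 * p) := by
      have := auxC_pos hγ₁ hγ (2 * p)
      simp only [auxG]; linarith
    unfold auxJ
    positivity
  have hinv : ContDiff ℝ ∞ fun p => 1 / auxJ γ₁ γ₂ p := contDiff_const.div hJ hJ0
  fin_cases i <;> fin_cases j
  · exact hinv.mul (contDiff_const.mul (hcos.pow 2))
  · exact hinv.mul ((contDiff_const.mul hG).mul hcos).neg
  · exact hinv.mul ((contDiff_const.mul hG).mul hcos).neg
  · exact hinv.mul (hG.pow 2)

theorem contDiff_applyB_tildeV (hγ₁ : 0 < γ₁) (hγ : γ₁ < γ₂) (W : SchwartzMap ℝ ℝ) (j : Fin 2) :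
    ContDiff ℝ ∞ fun p => applyB γ₁ γ₂ p (tildeV W p) j := by
  simp only [applyB_apply]
  exact ((ofRealCLM.contDiff.comp (contDiff_matB hγ₁ hγ j 0)).mul (contDiff_tildeV W 0)).add
    ((ofRealCLM.contDiff.comp (contDiff_matB hγ₁ hγ j 1)).mul (contDiff_tildeV W 1))

theorem applyB_tildeV_neg (γ₁ γ₂ : ℝ) (W : SchwartzMap ℝ ℝ) (p : ℝ) (j : Fin 2) :
    applyB γ₁ γ₂ (-p) (tildeV W (-p)) j = conj (applyB γ₁ γ₂ p (tildeV W p) j) := by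
  simp only [applyB_apply, matB_neg, tildeV_neg, map_add, map_mul, conj_ofReal]

theorem omega₂_neg (γ₁ γ₂ p : ℝ) : omega₂ γ₁ γ₂ (-p) = omega₂ γ₁ γ₂ p := by
  simp [omega₂, auxC]

end Projection

/-! ### The even and odd parts of the transform near the inflection point -/

theorem deriv_tildeV_apply (W : SchwartzMap ℝ ℝ) (p : ℝ) (i : Fin 2) :
    deriv (tildeV W) p i = deriv (fun p => tildeV W p i) p := by
  rw [deriv_pi fun i => (contDiff_tildeV W i).differentiable (by simp) p]

/-- The coefficients 3, -3, 1 of the continuation sum to 1. For `η < 0` the deviation from `F 0` is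
therefore `-3` times that at `|η|` plus that at `2|η|`, which explains the interval `[0, 2]`. -/
theorem norm_threePointExt_sub_le {F : ℝ → Fin 2 → ℂ} {φ : ℝ → ℝ} {i : Fin 2}
    (hφ : ∀ η, 0 ≤ η → 0 ≤ φ η) (hF : ∀ η ∈ Icc (0 : ℝ) 2, ‖F η i - F 0 i‖ ≤ φ η) {η : ℝ}
    (hη : |η| ≤ 1) :
    ‖threePointExt F η i - F 0 i‖ ≤ 3 * φ |η| + φ (2 * |η|) := by
  have h0 := abs_nonneg η
  have p1 := hφ _ h0
  have p2 := hφ (2 * |η|) (by positivity)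
  by_cases h : 0 ≤ η
  · rw [threePointExt, if_pos h]
    have h1 := hF |η| ⟨h0, by linarith⟩
    rw [abs_of_nonneg h] at h1 p1 p2 ⊢
    linarith
  · have hneg : η < 0 := not_le.1 h
    have h1 := hF |η| ⟨h0, by linarith⟩
    have h2 := hF (2 * |η|) ⟨by positivity, by linarith⟩
    rw [threePointExt, if_neg h]
    have e1 : -η = |η| := (abs_of_neg hneg).symm
    have e2 : -2 * η = 2 * |η| := by rw [← e1]; ring
    rw [e1, e2]
    have e3 : ((3 : ℂ) • F 0 - (3 : ℂ) • F |η| + F (2 * |η|)) i - F 0 i =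
        -(3 * (F |η| i - F 0 i)) + (F (2 * |η|) i - F 0 i) := by
      simp only [Pi.add_apply, Pi.sub_apply, Pi.smul_apply, smul_eq_mul]
      ring
    rw [e3]
    refine (norm_add_le _ _).trans (add_le_add ?_ h2)
    rw [norm_neg, norm_mul, Complex.norm_ofNat]
    linarith

/-- Second-order Taylor expansion at `p*`: the linear terms cancel in the even part, leaving `O(η)`.
In the odd part, division by `√η` leaves `-(Ṽ⁰)'(p*)` and an error `O(√η)`. -/
theorem exists_norm_evenOdd_sub_le (W : SchwartzMap ℝ ℝ) (pstar : ℝ) (i : Fin 2) :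
    ∃ M, 0 ≤ M ∧ ∀ η, |η| ≤ 1 → ‖F₁ W pstar η i - tildeV W pstar i‖ ≤ M * |η| ∧
      ‖F₂ W pstar η i + deriv (tildeV W) pstar i‖ ≤ M * Real.sqrt |η| := by
  set v : ℝ → ℂ := fun s => tildeV W (s + pstar) i with hv
  have hvs : ContDiff ℝ ∞ v := (contDiff_tildeV W i).comp (contDiff_id.add contDiff_const)
  have hv0 : v 0 = tildeV W pstar i := by simp [hv]
  have hv1 : deriv v 0 = deriv (tildeV W) pstar i := by
    rw [deriv_tildeV_apply, hv, deriv_comp_add_const (fun p => tildeV W p i), zero_add]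
  obtain ⟨-, h₂, -, h₂s, -, hT⟩ := exists_taylor_two hvs
  obtain ⟨M, hM⟩ := (isCompact_Icc (a := (-2 : ℝ)) (b := 2)).exists_bound_of_continuousOn
    h₂s.continuous.continuousOn
  have hM0 : 0 ≤ M := (norm_nonneg _).trans (hM 0 (by norm_num))
  have hbd : ∀ η ∈ Icc (0 : ℝ) 2, ‖h₂ (Real.sqrt η)‖ ≤ M ∧ ‖h₂ (-Real.sqrt η)‖ ≤ M :=
    fun η hη => by
      have h1 := Real.sqrt_nonneg η
      have h2 : Real.sqrt η ≤ 2 := Real.sqrt_le_iff.2 ⟨by norm_num, by linarith [hη.2]⟩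
      exact ⟨hM _ ⟨by linarith, h2⟩, hM _ ⟨by linarith, by linarith⟩⟩
  have hsq : ∀ η : ℝ, 0 ≤ η → (Real.sqrt η : ℂ) ^ 2 = η := fun η hη => by
    rw [← ofReal_pow, Real.sq_sqrt hη]
  -- The factor 5 is `3 + 2` from the three-point continuation; for `F₂` the bound `√2 ≤ 2` is used.
  refine ⟨5 * M, by positivity, fun η hη => ⟨?_, ?_⟩⟩
  · have h := norm_threePointExt_sub_le (i := i) (φ := fun η => M * η)
      (F := fun η =>
        (1 / 2 : ℂ) • (tildeV W (-Real.sqrt η + pstar) + tildeV W (Real.sqrt η + pstar)))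
      (fun η hη => by positivity) (fun η hη => by
        obtain ⟨b1, b2⟩ := hbd η hη
        simp only [Pi.smul_apply, Pi.add_apply, smul_eq_mul]
        have e1 : tildeV W (-Real.sqrt η + pstar) i = v (-Real.sqrt η) := rfl
        have e2 : tildeV W (Real.sqrt η + pstar) i = v (Real.sqrt η) := rfl
        have e3 : tildeV W (-Real.sqrt 0 + pstar) i = v 0 := by simp [hv]
        have e4 : tildeV W (Real.sqrt 0 + pstar) i = v 0 := by simp [hv]
        rw [e1, e2, e3, e4, hT (-Real.sqrt η), hT (Real.sqrt η)]
        have e5 : (1 / 2 : ℂ) * (v 0 + ((-Real.sqrt η : ℝ) : ℂ) * deriv v 0 +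
            ((-Real.sqrt η : ℝ) : ℂ) ^ 2 * h₂ (-Real.sqrt η) +
            (v 0 + (Real.sqrt η : ℂ) * deriv v 0 + (Real.sqrt η : ℂ) ^ 2 * h₂ (Real.sqrt η))) -
            (1 / 2 : ℂ) * (v 0 + v 0) = (Real.sqrt η : ℂ) ^ 2 *
              ((h₂ (-Real.sqrt η) + h₂ (Real.sqrt η)) / 2) := by
          push_cast; ring
        rw [e5, hsq η hη.1, norm_mul, norm_real, Real.norm_eq_abs, abs_of_nonneg hη.1, mul_comm]
        refine mul_le_mul_of_nonneg_right ?_ hη.1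
        rw [norm_div, Complex.norm_ofNat]
        linarith [norm_add_le (h₂ (-Real.sqrt η)) (h₂ (Real.sqrt η))]) hη
    have e0 : ((1 / 2 : ℂ) • (tildeV W (-Real.sqrt 0 + pstar) +
        tildeV W (Real.sqrt 0 + pstar))) i = tildeV W pstar i := by
      simp only [Pi.smul_apply, Pi.add_apply, smul_eq_mul, Real.sqrt_zero, neg_zero, zero_add]
      ring
    simp only [e0] at h
    refine h.trans (le_of_eq ?_)
    ring
  · have h := norm_threePointExt_sub_le (i := i) (φ := fun η => M * Real.sqrt η)
      (F := fun η => if η = 0 then -deriv (tildeV W) pstar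
        else (1 / (2 * (Real.sqrt η : ℂ))) •
          (tildeV W (-Real.sqrt η + pstar) - tildeV W (Real.sqrt η + pstar)))
      (fun η hη => by positivity) (fun η hη => by
        rcases hη.1.eq_or_lt with h0 | h0
        · rw [← h0]; simp
        · obtain ⟨b1, b2⟩ := hbd η hη
          rw [if_neg h0.ne', if_pos rfl]
          have hs := Real.sqrt_pos.2 h0
          have hs' : (Real.sqrt η : ℂ) ≠ 0 := ofReal_ne_zero.2 hs.ne'
          simp only [Pi.smul_apply, Pi.sub_apply, Pi.neg_apply, smul_eq_mul, ← hv1]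
          have e1 : tildeV W (-Real.sqrt η + pstar) i = v (-Real.sqrt η) := rfl
          have e2 : tildeV W (Real.sqrt η + pstar) i = v (Real.sqrt η) := rfl
          rw [e1, e2, hT (-Real.sqrt η), hT (Real.sqrt η)]
          have e5 : 1 / (2 * (Real.sqrt η : ℂ)) * (v 0 + ((-Real.sqrt η : ℝ) : ℂ) * deriv v 0 +
              ((-Real.sqrt η : ℝ) : ℂ) ^ 2 * h₂ (-Real.sqrt η) -
              (v 0 + (Real.sqrt η : ℂ) * deriv v 0 + (Real.sqrt η : ℂ) ^ 2 * h₂ (Real.sqrt η))) -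
              -deriv v 0 = (Real.sqrt η : ℂ) * ((h₂ (-Real.sqrt η) - h₂ (Real.sqrt η)) / 2) := by
            push_cast
            field_simp
            ring
          rw [e5, norm_mul, norm_real, Real.norm_eq_abs, abs_of_pos hs, mul_comm]
          refine mul_le_mul_of_nonneg_right ?_ hs.le
          rw [norm_div, Complex.norm_ofNat]
          linarith [norm_sub_le (h₂ (-Real.sqrt η)) (h₂ (Real.sqrt η))]) hη
    simp only [if_true, Pi.neg_apply, sub_neg_eq_add] at h
    refine h.trans ?_
    have h2 : Real.sqrt (2 * |η|) ≤ 2 * Real.sqrt |η| := by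
      refine Real.sqrt_le_iff.2 ⟨by positivity, ?_⟩
      rw [mul_pow, Real.sq_sqrt (abs_nonneg η)]
      linarith [abs_nonneg η]
    linarith [mul_le_mul_of_nonneg_left h2 hM0]

/-! ### The amplitude -/

theorem norm_applyB_le (γ₁ γ₂ p : ℝ) {v : Fin 2 → ℂ} {A : ℝ} (hv : ∀ i, ‖v i‖ ≤ A) (j : Fin 2) :
    ‖applyB γ₁ γ₂ p v j‖ ≤ (|matB γ₁ γ₂ p j 0| + |matB γ₁ γ₂ p j 1|) * A := by
  rw [applyB_apply, add_mul]
  refine (norm_add_le _ _).trans (add_le_add ?_ ?_) <;>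
  · rw [norm_mul, norm_real, Real.norm_eq_abs]
    exact mul_le_mul_of_nonneg_left (hv _) (abs_nonneg _)

/-- The amplitude built from `F₁`, `F₂` agrees, up to higher order terms, with the one built from
the value and the derivative of `ℬ Ṽ⁰` at the inflection point. -/
theorem exists_norm_amplitude_sub_le {γ₁ γ₂ : ℝ} (hγ₁ : 0 < γ₁) (hγ : γ₁ < γ₂)
    (W : SchwartzMap ℝ ℝ) (pstar K A : ℝ) (hK : 0 ≤ K) (hA : 0 ≤ A) (j : Fin 2) :
    ∃ C, 0 ≤ C ∧ ∃ ε₀ > 0, ∀ (η ε : ℝ) (c₁ c₂ : ℂ), 0 < ε → ε ≤ ε₀ → |η| ≤ K * ε ^ 2 →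
      ‖c₁‖ ≤ A → ‖c₂‖ ≤ A →
      ‖applyB γ₁ γ₂ pstar (c₁ • F₁ W pstar η + (ε * c₂ : ℂ) • F₂ W pstar η) j -
        (c₁ * applyB γ₁ γ₂ pstar (tildeV W pstar) j -
          ε * c₂ * deriv (fun p => applyB γ₁ γ₂ p (tildeV W p) j) pstar)‖ ≤
        C * (ε * (‖tildeV W pstar‖ + ε)) := by
  obtain ⟨M₀, hM₀0, hM₀⟩ := exists_norm_evenOdd_sub_le W pstar 0
  obtain ⟨M₁, hM₁0, hM₁⟩ := exists_norm_evenOdd_sub_le W pstar 1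
  set M := max M₀ M₁ with hM
  have hM0 : 0 ≤ M := hM₀0.trans (le_max_left _ _)
  have hF : ∀ i : Fin 2, ∀ η, |η| ≤ 1 → ‖F₁ W pstar η i - tildeV W pstar i‖ ≤ M * |η| ∧
      ‖F₂ W pstar η i + deriv (tildeV W) pstar i‖ ≤ M * Real.sqrt |η| := by
    intro i η hη
    fin_cases i
    · exact ⟨(hM₀ η hη).1.trans (mul_le_mul_of_nonneg_right (le_max_left _ _) (abs_nonneg _)),
        (hM₀ η hη).2.trans (mul_le_mul_of_nonneg_right (le_max_left _ _) (Real.sqrt_nonneg _))⟩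
    · exact ⟨(hM₁ η hη).1.trans (mul_le_mul_of_nonneg_right (le_max_right _ _) (abs_nonneg _)),
        (hM₁ η hη).2.trans (mul_le_mul_of_nonneg_right (le_max_right _ _) (Real.sqrt_nonneg _))⟩
  set b' : Fin 2 → ℝ := fun i => deriv (fun p => matB γ₁ γ₂ p j i) pstar with hb'
  set β := |matB γ₁ γ₂ pstar j 0| + |matB γ₁ γ₂ pstar j 1| with hβ
  set β' := |b' 0| + |b' 1| with hβ'
  -- The extra term with `ℬ'(p*)` has no counterpart in the stated amplitude. It is proportional to
  -- `Ṽ⁰(p*)`, hence bounded by a multiple of `N`.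
  have hderiv : deriv (fun p => applyB γ₁ γ₂ p (tildeV W p) j) pstar =
      applyB γ₁ γ₂ pstar (deriv (tildeV W) pstar) j +
        (b' 0 * tildeV W pstar 0 + b' 1 * tildeV W pstar 1) := by
    have hB : ∀ i, HasDerivAt (fun p => ((matB γ₁ γ₂ p j i : ℝ) : ℂ)) (b' i : ℂ) pstar :=
      fun i => ((contDiff_matB hγ₁ hγ j i).differentiable (by simp) pstar).hasDerivAt.ofReal_comp
    have hV : ∀ i, HasDerivAt (fun p => tildeV W p i) (deriv (tildeV W) pstar i) pstar :=
      fun i => by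
        rw [deriv_tildeV_apply]
        exact ((contDiff_tildeV W i).differentiable (by simp) pstar).hasDerivAt
    simp only [applyB_apply]
    rw [(((hB 0).fun_mul (hV 0)).fun_add ((hB 1).fun_mul (hV 1))).deriv]
    ring
  refine ⟨β * (A * M * K + A * M * Real.sqrt K) + A * β', by positivity,
    min 1 (1 / (K + 1)), by positivity, ?_⟩
  intro η ε c₁ c₂ hε hε₀ hη hc₁ hc₂
  have hε1 : ε ≤ 1 := hε₀.trans (min_le_left _ _)
  have hη1 : |η| ≤ 1 := by
    refine hη.trans ?_
    have h1 := hε₀.trans (min_le_right _ _)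
    rw [le_div_iff₀ (by positivity)] at h1
    have h2 : ε ^ 2 ≤ ε := by nlinarith
    nlinarith [mul_le_mul_of_nonneg_left h2 hK]
  set N := ‖tildeV W pstar‖ with hN
  have hN0 : 0 ≤ N := norm_nonneg _
  have hVi : ∀ i, ‖tildeV W pstar i‖ ≤ N := fun i => norm_le_pi_norm _ i
  have hsqrt : Real.sqrt |η| ≤ Real.sqrt K * ε := by
    refine Real.sqrt_le_iff.2 ⟨by positivity, ?_⟩
    rwa [mul_pow, Real.sq_sqrt hK]
  set u : Fin 2 → ℂ := fun i => c₁ * (F₁ W pstar η i - tildeV W pstar i) +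
    ε * c₂ * (F₂ W pstar η i + deriv (tildeV W) pstar i) with hu
  have hui : ∀ i, ‖u i‖ ≤ (A * M * K + A * M * Real.sqrt K) * ε ^ 2 := fun i => by
    obtain ⟨h1, h2⟩ := hF i η hη1
    have nε : ‖(ε : ℂ)‖ = ε := by rw [norm_real, Real.norm_eq_abs, abs_of_pos hε]
    refine (norm_add_le _ _).trans ?_
    rw [norm_mul, norm_mul, norm_mul, nε]
    calc ‖c₁‖ * ‖F₁ W pstar η i - tildeV W pstar i‖ +
          ε * ‖c₂‖ * ‖F₂ W pstar η i + deriv (tildeV W) pstar i‖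
        ≤ A * (M * (K * ε ^ 2)) + ε * A * (M * (Real.sqrt K * ε)) := by
          refine add_le_add (mul_le_mul hc₁ (h1.trans (mul_le_mul_of_nonneg_left hη hM0))
            (norm_nonneg _) hA) (mul_le_mul (mul_le_mul_of_nonneg_left hc₂ hε.le)
            (h2.trans (mul_le_mul_of_nonneg_left hsqrt hM0)) (norm_nonneg _) (by positivity))
      _ = _ := by ring
  have heq : applyB γ₁ γ₂ pstar (c₁ • F₁ W pstar η + (ε * c₂ : ℂ) • F₂ W pstar η) j -
        (c₁ * applyB γ₁ γ₂ pstar (tildeV W pstar) j -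
          ε * c₂ * deriv (fun p => applyB γ₁ γ₂ p (tildeV W p) j) pstar) =
      applyB γ₁ γ₂ pstar u j +
        ε * c₂ * (b' 0 * tildeV W pstar 0 + b' 1 * tildeV W pstar 1) := by
    rw [hderiv]
    simp only [applyB_apply, hu, Pi.add_apply, Pi.smul_apply, smul_eq_mul]
    ring
  rw [heq]
  have h3 := norm_applyB_le γ₁ γ₂ pstar hui j
  have h4 : ‖(b' 0 : ℂ) * tildeV W pstar 0 + b' 1 * tildeV W pstar 1‖ ≤ β' * N := by
    rw [hβ', add_mul]
    refine (norm_add_le _ _).trans (add_le_add ?_ ?_) <;>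
    · rw [norm_mul, norm_real, Real.norm_eq_abs]
      exact mul_le_mul_of_nonneg_left (hVi _) (abs_nonneg _)
  have h5 : ‖(ε : ℂ) * c₂ * (b' 0 * tildeV W pstar 0 + b' 1 * tildeV W pstar 1)‖ ≤
      ε * A * (β' * N) := by
    rw [norm_mul, norm_mul, norm_real, Real.norm_eq_abs, abs_of_pos hε]
    exact mul_le_mul (mul_le_mul_of_nonneg_left hc₂ hε.le) h4 (norm_nonneg _) (by positivity)
  refine (norm_add_le _ _).trans ((add_le_add h3 h5).trans ?_)
  have t1 : 0 ≤ β * (A * M * K + A * M * Real.sqrt K) * (ε * N) := by positivity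
  have t2 : 0 ≤ A * β' * (ε * ε) := by positivity
  linarith

/-- Only `w.re` has to agree with `u.re`, so `w` may be the conjugate of `u`, as is needed at the
left front. -/
theorem FactorApprox.of_norm_sub_le {C μ ε N : ℝ} {u a w : ℂ} (hC : 0 ≤ C) (hμ : 0 < μ)
    (hε : 0 < ε) (hN : 0 ≤ N) (huw : u.re = w.re)
    (h : ‖w - 2 * ε * a‖ ≤ C * μ ^ (1 / 3 : ℝ) * (ε * (N + ε))) : FactorApprox C μ ε N u a := by
  have hre : (w - 2 * ε * a).re = u.re - 2 * ε * a.re := by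
    rw [huw, sub_re, mul_assoc, ← ofReal_ofNat, re_ofReal_mul, re_ofReal_mul]
    ring
  have h1 : |u.re - 2 * ε * a.re| ≤ C * μ ^ (1 / 3 : ℝ) * (ε * (N + ε)) := by
    rw [← hre]; exact (abs_re_le_norm _).trans h
  refine ⟨h1, fun κ hκ ha => ?_⟩
  have hNε : 0 < N + ε := by linarith
  have ha0 : 0 < ‖a‖ := (mul_pos hκ hNε).trans_le ha
  have hane : a ≠ 0 := norm_pos_iff.1 ha0
  have hm : 0 < μ ^ (1 / 3 : ℝ) := Real.rpow_pos_of_pos hμ _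
  set d : ℝ := u.re - 2 * ε * a.re with hd
  -- With this choice `a (1 + ρ)` is `a` plus a real number that corrects the real part exactly.
  refine ⟨((d / (2 * ε) : ℝ) : ℂ) / a, ?_, ?_⟩
  · rw [norm_div, norm_real, Real.norm_eq_abs, abs_div, abs_of_pos (by positivity : 0 < 2 * ε),
      div_le_iff₀ ha0, div_le_iff₀ (by positivity)]
    calc |d| ≤ C * μ ^ (1 / 3 : ℝ) * (ε * (N + ε)) := h1
      _ ≤ C * μ ^ (1 / 3 : ℝ) * ε * (N + ε) * 2 := by
          have : 0 ≤ C * μ ^ (1 / 3 : ℝ) * ε * (N + ε) := by positivity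
          linarith
      _ = C / κ * μ ^ (1 / 3 : ℝ) * (κ * (N + ε)) * (2 * ε) := by field_simp
      _ ≤ C / κ * μ ^ (1 / 3 : ℝ) * ‖a‖ * (2 * ε) := by gcongr
  · have e : a * (1 + ((d / (2 * ε) : ℝ) : ℂ) / a) = a + ((d / (2 * ε) : ℝ) : ℂ) := by
      rw [mul_add, mul_one, mul_div_cancel₀ _ hane]
    rw [e, add_re, ofReal_re, hd]
    field_simp
    ring

/-! ### The fronts -/

theorem cube_root_spec {a : ℝ} (ha : 0 < a) :
    0 < a ^ (1 / 3 : ℝ) ∧ (a ^ (1 / 3 : ℝ)) ^ 3 = a ∧ a ^ (2 / 3 : ℝ) = (a ^ (1 / 3 : ℝ)) ^ 2 := by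
  refine ⟨Real.rpow_pos_of_pos ha _, ?_, ?_⟩
  · rw [← Real.rpow_natCast, ← Real.rpow_mul ha.le]; norm_num
  · rw [← Real.rpow_natCast, ← Real.rpow_mul ha.le]; norm_num

/-- The scaled distance `y / (μ^{2/3} (q* t)^{1/3})` to the front. -/
noncomputable def frontVar (γ₁ γ₂ pstar μ t y : ℝ) : ℝ :=
  y / (μ ^ (2 / 3 : ℝ) * (qStar γ₁ γ₂ pstar * t) ^ (1 / 3 : ℝ))

section Scaling

variable {γ₁ γ₂ pstar μ t : ℝ}

theorem eps_pos (hq : 0 < qStar γ₁ γ₂ pstar) (hμ : 0 < μ) (ht : 0 < t) :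
    0 < eps γ₁ γ₂ pstar μ t :=
  Real.rpow_pos_of_pos (by positivity) _

theorem eps_eq (hq : 0 < qStar γ₁ γ₂ pstar) (hμ : 0 < μ) (ht : 0 < t) :
    eps γ₁ γ₂ pstar μ t = μ ^ (1 / 3 : ℝ) / (qStar γ₁ γ₂ pstar * t) ^ (1 / 3 : ℝ) :=
  Real.div_rpow hμ.le (by positivity) _

theorem eps_cube (hq : 0 < qStar γ₁ γ₂ pstar) (hμ : 0 < μ) (ht : 0 < t) :
    eps γ₁ γ₂ pstar μ t ^ 3 = μ / (qStar γ₁ γ₂ pstar * t) :=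
  (cube_root_spec (by positivity)).2.1

theorem eps_le (hq : 0 < qStar γ₁ γ₂ pstar) (hμ : 0 < μ) {t₀ : ℝ} (ht₀ : 0 < t₀) (ht : t₀ ≤ t) :
    eps γ₁ γ₂ pstar μ t ≤ μ ^ (1 / 3 : ℝ) / (qStar γ₁ γ₂ pstar * t₀) ^ (1 / 3 : ℝ) := by
  rw [eps_eq hq hμ (ht₀.trans_le ht)]
  have hm := (cube_root_spec hμ).1
  have h0 := (cube_root_spec (mul_pos hq ht₀)).1
  gcongr

/-- Identifies the linear term of the phase: `z s / ε = y s / μ`. -/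
theorem frontVar_div_eps (hq : 0 < qStar γ₁ γ₂ pstar) (hμ : 0 < μ) (ht : 0 < t) (y : ℝ) :
    frontVar γ₁ γ₂ pstar μ t y / eps γ₁ γ₂ pstar μ t = y / μ := by
  obtain ⟨m0, m3, m2⟩ := cube_root_spec hμ
  obtain ⟨Q0, -, -⟩ := cube_root_spec (mul_pos hq ht)
  rw [frontVar, eps_eq hq hμ ht, m2]
  set m := μ ^ (1 / 3 : ℝ)
  rw [← m3]
  field_simp

/-- Shows that the argument `y / (q* t)` of `F₁` and `F₂` is of order `ε²` for bounded `z`. -/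
theorem frontVar_mul_eps_sq (hq : 0 < qStar γ₁ γ₂ pstar) (hμ : 0 < μ) (ht : 0 < t) (y : ℝ) :
    frontVar γ₁ γ₂ pstar μ t y * eps γ₁ γ₂ pstar μ t ^ 2 = y / (qStar γ₁ γ₂ pstar * t) := by
  obtain ⟨m0, m3, m2⟩ := cube_root_spec hμ
  obtain ⟨Q0, Q3, -⟩ := cube_root_spec (mul_pos hq ht)
  rw [frontVar, eps_eq hq hμ ht, m2]
  set Q := (qStar γ₁ γ₂ pstar * t) ^ (1 / 3 : ℝ)
  rw [← Q3]
  field_simp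

theorem abs_frontVar_le (hq : 0 < qStar γ₁ γ₂ pstar) (hμ : 0 < μ) {t₀ K y : ℝ} (ht₀ : 0 < t₀)
    (ht : t₀ ≤ t) (hy : |y| ≤ K * μ ^ (2 / 3 : ℝ)) :
    |frontVar γ₁ γ₂ pstar μ t y| ≤ K / (qStar γ₁ γ₂ pstar * t₀) ^ (1 / 3 : ℝ) := by
  have ht' : 0 < t := ht₀.trans_le ht
  have hm : 0 < μ ^ (2 / 3 : ℝ) := Real.rpow_pos_of_pos hμ _
  have h0 := (cube_root_spec (mul_pos hq ht₀)).1
  have h1 : (qStar γ₁ γ₂ pstar * t₀) ^ (1 / 3 : ℝ) ≤ (qStar γ₁ γ₂ pstar * t) ^ (1 / 3 : ℝ) := by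
    gcongr
  have hQ := (cube_root_spec (mul_pos hq ht')).1
  have hK : 0 ≤ K := nonneg_of_mul_nonneg_left ((abs_nonneg y).trans hy) hm
  rw [frontVar, abs_div, abs_of_pos (mul_pos hm hQ), div_le_div_iff₀ (by positivity) h0]
  calc |y| * (qStar γ₁ γ₂ pstar * t₀) ^ (1 / 3 : ℝ) ≤
        K * μ ^ (2 / 3 : ℝ) * (qStar γ₁ γ₂ pstar * t) ^ (1 / 3 : ℝ) := by gcongr
    _ = _ := by ring

end Scaling

/-- Airy asymptotics at the right front for a general smooth amplitude. -/
theorem exists_norm_integral_sub_front_le {γ₁ γ₂ : ℝ} (hγ₁ : 0 < γ₁) (hγ : γ₁ < γ₂) {pstar : ℝ}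
    (hp : pstar ∈ Ioo (0 : ℝ) (Real.pi / 2)) (hp2 : iteratedDeriv 2 (omega₂ γ₁ γ₂) pstar = 0)
    (hq : 0 < qStar γ₁ γ₂ pstar)
    (hmin : ∀ p ∈ Icc (-(Real.pi / 2)) (Real.pi / 2), p ≠ pstar →
        deriv (omega₂ γ₁ γ₂) pstar < deriv (omega₂ γ₁ γ₂) p)
    {g : ℝ → ℂ} (hg : ContDiff ℝ ∞ g) {t₀ K : ℝ} (ht₀ : 0 < t₀) (hK : 0 ≤ K) :
    ∃ C, 0 ≤ C ∧ ∃ μ₀ > 0, ∀ μ t x : ℝ, 0 < μ → μ < μ₀ → t₀ ≤ t →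
      |x - cStar γ₁ γ₂ pstar * t| ≤ K * μ ^ (2 / 3 : ℝ) →
      ‖(1 / (Real.pi : ℂ)) * (∫ p in (-(Real.pi / 2))..(Real.pi / 2),
          g p * cexp (I * (((p * x + omega₂ γ₁ γ₂ p * t) / μ : ℝ) : ℂ))) -
        2 * (eps γ₁ γ₂ pstar μ t : ℂ) * (cexp (I * ((Phi₁ γ₁ γ₂ pstar x t / μ : ℝ) : ℂ)) *
          (g pstar * airyAi (frontVar γ₁ γ₂ pstar μ t (x - cStar γ₁ γ₂ pstar * t)) -
            I * (eps γ₁ γ₂ pstar μ t : ℂ) * deriv g pstar *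
              airyAiDeriv (frontVar γ₁ γ₂ pstar μ t (x - cStar γ₁ γ₂ pstar * t))))‖ ≤
        C * (eps γ₁ γ₂ pstar μ t ^ 2 * ‖g pstar‖ + eps γ₁ γ₂ pstar μ t ^ 3) := by
  set q := qStar γ₁ γ₂ pstar with hqdef
  set c := cStar γ₁ γ₂ pstar with hcdef
  have hω := contDiff_omega₂ hγ₁ hγ
  have hω' : ContDiff ℝ ∞ (deriv (omega₂ γ₁ γ₂)) := (contDiff_infty_iff_deriv.1 hω).2
  -- Subtracting the tangent line at `p*` and dividing by `q* = ω₂'''(p*)/2` normalizes the third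
  -- derivative at 0 to 2.
  set Θ : ℝ → ℝ := fun s => (omega₂ γ₁ γ₂ (s + pstar) - omega₂ γ₁ γ₂ pstar + c * s) / q with hΘ
  set f : ℝ → ℝ := fun s => (deriv (omega₂ γ₁ γ₂) (s + pstar) + c) / q with hf
  have hΘd : ∀ s, HasDerivAt Θ (f s) s := fun s => by
    have h1 : HasDerivAt (fun s => omega₂ γ₁ γ₂ (s + pstar))
        (deriv (omega₂ γ₁ γ₂) (s + pstar)) s :=
      (hω.differentiable (by simp) (s + pstar)).hasDerivAt.comp_add_const s pstar
    exact (((h1.sub_const (omega₂ γ₁ γ₂ pstar)).fun_add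
      ((hasDerivAt_id' s).const_mul c)).div_const q).congr_deriv (by simp only [hf]; ring)
  have hfs : ContDiff ℝ ∞ f :=
    ((hω'.comp (contDiff_id.add contDiff_const)).add contDiff_const).div_const q
  have hf' : deriv f = fun s => deriv (deriv (omega₂ γ₁ γ₂)) (s + pstar) / q := funext fun s => by
    have h1 : HasDerivAt (fun s => deriv (omega₂ γ₁ γ₂) (s + pstar))
        (deriv (deriv (omega₂ γ₁ γ₂)) (s + pstar)) s :=
      (hω'.differentiable (by simp) (s + pstar)).hasDerivAt.comp_add_const s pstar
    exact ((h1.add_const c).div_const q).deriv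
  have hi2 : iteratedDeriv 2 (omega₂ γ₁ γ₂) = deriv (deriv (omega₂ γ₁ γ₂)) := by
    rw [iteratedDeriv_succ, iteratedDeriv_one]
  have hi3 : iteratedDeriv 3 (omega₂ γ₁ γ₂) = deriv (deriv (deriv (omega₂ γ₁ γ₂))) := by
    rw [iteratedDeriv_succ, hi2]
  have hf2 : deriv (deriv f) 0 = 2 := by
    rw [hf', deriv_div_const, deriv_comp_add_const (deriv (deriv (omega₂ γ₁ γ₂))), zero_add,
      ← hi3, div_eq_iff hq.ne', hqdef, qStar]
    ring
  have hgs : ContDiff ℝ ∞ fun s => g (s + pstar) := hg.comp (contDiff_id.add contDiff_const)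
  set L := K / (q * t₀) ^ (1 / 3 : ℝ) with hL
  have hL0 : 0 ≤ L := by positivity
  obtain ⟨C, hC0, ε₀, hε₀, hC⟩ := exists_norm_integral_sub_airy_le
    (a := -(Real.pi / 2) - pstar) (b := Real.pi / 2 - pstar) (K := L)
    (by linarith [hp.1, Real.pi_pos]) (by linarith [hp.2]) hL0 hΘd
    (by simp [hΘ]) hfs (by simp [hf, hcdef, cStar]) (by simp only [hf', ← hi2, zero_add, hp2, zero_div])
    hf2 (fun s hs hs0 => by
      have h1 := hmin (s + pstar) ⟨by linarith [hs.1], by linarith [hs.2]⟩ (by simpa using hs0)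
      refine div_pos ?_ hq
      rw [hcdef, cStar]
      linarith) hgs
  -- Since `ε³ = μ / (q t)` and `t ≥ t₀`, this bound on `μ` is equivalent to an `ε` below `ε₀` at
  -- the worst time `t₀`.
  refine ⟨C, hC0, q * t₀ * ε₀ ^ 3, by positivity, fun μ t x hμ hμ₀ ht hx => ?_⟩
  have ht' : 0 < t := ht₀.trans_le ht
  set ε := eps γ₁ γ₂ pstar μ t with hεdef
  have hε : 0 < ε := eps_pos hq hμ ht'
  have hε3 : ε ^ 3 = μ / (q * t) := eps_cube hq hμ ht'
  have hεle : ε ≤ ε₀ := by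
    refine le_of_pow_le_pow_left₀ three_ne_zero hε₀.le ?_
    rw [hε3, div_le_iff₀ (by positivity)]
    calc μ ≤ q * t₀ * ε₀ ^ 3 := hμ₀.le
      _ ≤ q * t * ε₀ ^ 3 := by gcongr
      _ = _ := by ring
  set y := x - c * t with hy
  set z := frontVar γ₁ γ₂ pstar μ t y with hz
  have hzε : z / ε = y / μ := frontVar_div_eps hq hμ ht' y
  have h := hC z ε hε hεle (abs_frontVar_le hq hμ ht₀ ht hx)
  rw [zero_add, deriv_comp_add_const g, zero_add] at h
  set E := cexp (I * ((Phi₁ γ₁ γ₂ pstar x t / μ : ℝ) : ℂ)) with hE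
  have hEn : ‖E‖ = 1 := norm_cexp_phase _
  have hint : ∫ p in (-(Real.pi / 2))..(Real.pi / 2),
      g p * cexp (I * (((p * x + omega₂ γ₁ γ₂ p * t) / μ : ℝ) : ℂ)) =
      E * ∫ s in (-(Real.pi / 2) - pstar)..(Real.pi / 2 - pstar),
        g (s + pstar) * scaledExp Θ z ε s := by
    rw [← intervalIntegral.integral_const_mul]
    have h1 := intervalIntegral.integral_comp_add_right
      (a := -(Real.pi / 2) - pstar) (b := Real.pi / 2 - pstar)
      (fun p => g p * cexp (I * (((p * x + omega₂ γ₁ γ₂ p * t) / μ : ℝ) : ℂ))) pstar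
    rw [sub_add_cancel, sub_add_cancel] at h1
    rw [← h1]
    refine intervalIntegral.integral_congr fun s _ => ?_
    have h2 : ((s + pstar) * x + omega₂ γ₁ γ₂ (s + pstar) * t) / μ =
        Phi₁ γ₁ γ₂ pstar x t / μ + (z * (s / ε) + Θ s / ε ^ 3) := by
      rw [show z * (s / ε) = z / ε * s by ring, hzε, hε3, hΘ, hy, Phi₁]
      field_simp
      ring
    simp only [h2, scaledExp, hE]
    rw [ofReal_add, mul_add, exp_add]
    ring
  rw [hint]
  set X := ∫ s in (-(Real.pi / 2) - pstar)..(Real.pi / 2 - pstar),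
    g (s + pstar) * scaledExp Θ z ε s
  have hπ : (Real.pi : ℂ) ≠ 0 := ofReal_ne_zero.2 Real.pi_ne_zero
  have e1 : 1 / (Real.pi : ℂ) * (E * X) - 2 * ε * (E * (g pstar * airyAi z -
      I * ε * deriv g pstar * airyAiDeriv z)) = E * (1 / (Real.pi : ℂ)) *
      (X - 2 * Real.pi * ε * (g pstar * airyAi z - I * ε * deriv g pstar * airyAiDeriv z)) := by
    field_simp
  rw [e1, norm_mul, norm_mul, hEn, one_mul, norm_div, norm_one, norm_real, Real.norm_eq_abs,
    abs_of_pos Real.pi_pos]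
  have h3 : 1 / Real.pi ≤ 1 := by
    rw [div_le_one Real.pi_pos]; linarith [Real.pi_gt_three]
  calc 1 / Real.pi * _ ≤ 1 * (C * (ε ^ 2 * ‖g pstar‖ + ε ^ 3)) :=
        mul_le_mul h3 h (norm_nonneg _) zero_le_one
    _ = _ := one_mul _

/-- Reflection `p ↦ -p` in the integral representing the optical part. -/
theorem Iopt_eq_reflect (γ₁ γ₂ : ℝ) (W : SchwartzMap ℝ ℝ) (μ x t : ℝ) (j : Fin 2) :
    Iopt γ₁ γ₂ W μ x t j = (1 / (Real.pi : ℂ)) * ∫ p in (-(Real.pi / 2))..(Real.pi / 2),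
      conj (applyB γ₁ γ₂ p (tildeV W p) j) *
        cexp (I * (((p * -x + omega₂ γ₁ γ₂ p * t) / μ : ℝ) : ℂ)) := by
  have h := intervalIntegral.integral_comp_neg (a := -(Real.pi / 2)) (b := Real.pi / 2)
    fun p => applyB γ₁ γ₂ p (tildeV W p) j *
      cexp (I * (((p * x + omega₂ γ₁ γ₂ p * t) / μ : ℝ) : ℂ))
  rw [neg_neg] at h
  rw [Iopt, ← h]
  congr 1
  refine intervalIntegral.integral_congr fun p _ => ?_
  simp only [applyB_tildeV_neg, omega₂_neg]
  rw [show -p * x = p * -x by ring]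

section Fronts

variable {γ₁ γ₂ pstar : ℝ}

/-- Complex form of the asymptotics at both fronts; at the left one for the conjugate. -/
theorem exists_norm_Iopt_sub_amp_le (hγ₁ : 0 < γ₁) (hγ : γ₁ < γ₂)
    (hp : pstar ∈ Ioo (0 : ℝ) (Real.pi / 2)) (hp2 : iteratedDeriv 2 (omega₂ γ₁ γ₂) pstar = 0)
    (hq : 0 < qStar γ₁ γ₂ pstar)
    (hmin : ∀ p ∈ Icc (-(Real.pi / 2)) (Real.pi / 2), p ≠ pstar →
        deriv (omega₂ γ₁ γ₂) pstar < deriv (omega₂ γ₁ γ₂) p)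
    (W : SchwartzMap ℝ ℝ) {t₀ K : ℝ} (ht₀ : 0 < t₀) (hK : 0 ≤ K) (j : Fin 2) :
    ∃ C, 0 ≤ C ∧ ∃ μ₀ > 0, ∀ μ t x : ℝ, 0 < μ → μ < μ₀ → t₀ ≤ t →
      (|x - cStar γ₁ γ₂ pstar * t| ≤ K * μ ^ (2 / 3 : ℝ) →
        ‖Iopt γ₁ γ₂ W μ x t j - 2 * (eps γ₁ γ₂ pstar μ t : ℂ) *
          ampRight γ₁ γ₂ W pstar μ x t j‖ ≤
        C * μ ^ (1 / 3 : ℝ) * (eps γ₁ γ₂ pstar μ t *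
          (‖tildeV W pstar‖ + eps γ₁ γ₂ pstar μ t))) ∧
      (|x + cStar γ₁ γ₂ pstar * t| ≤ K * μ ^ (2 / 3 : ℝ) →
        ‖conj (Iopt γ₁ γ₂ W μ x t j) - 2 * (eps γ₁ γ₂ pstar μ t : ℂ) *
          ampLeft γ₁ γ₂ W pstar μ x t j‖ ≤
        C * μ ^ (1 / 3 : ℝ) * (eps γ₁ γ₂ pstar μ t *
          (‖tildeV W pstar‖ + eps γ₁ γ₂ pstar μ t))) := by
  set q := qStar γ₁ γ₂ pstar with hqdef
  set c := cStar γ₁ γ₂ pstar with hcdef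
  set g : ℝ → ℂ := fun p => applyB γ₁ γ₂ p (tildeV W p) j with hgdef
  have hg : ContDiff ℝ ∞ g := contDiff_applyB_tildeV hγ₁ hγ W j
  have hgc : ContDiff ℝ ∞ fun p => conj (g p) := conjCLE.contDiff.comp hg
  have hgc' : deriv (fun p => conj (g p)) pstar = conj (deriv g pstar) :=
    (conjCLE.hasFDerivAt.comp_hasDerivAt pstar
      (hg.differentiable (by simp) pstar).hasDerivAt).deriv
  set L := K / (q * t₀) ^ (1 / 3 : ℝ) with hL
  have hL0 : 0 ≤ L := by positivity
  obtain ⟨A, hA⟩ := exists_abs_airyAi_le L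
  have hA0 : 0 ≤ A := (abs_nonneg _).trans (hA 0 (by simpa using hL0)).1
  obtain ⟨C₁, hC₁0, μ₁, hμ₁, hC₁⟩ :=
    exists_norm_integral_sub_front_le hγ₁ hγ hp hp2 hq hmin hg ht₀ hK
  obtain ⟨C₂, hC₂0, μ₂, hμ₂, hC₂⟩ :=
    exists_norm_integral_sub_front_le hγ₁ hγ hp hp2 hq hmin hgc ht₀ hK
  obtain ⟨C₃, hC₃0, ε₀, hε₀, hC₃⟩ := exists_norm_amplitude_sub_le hγ₁ hγ W pstar L A hL0 hA0 j
  set β := |matB γ₁ γ₂ pstar j 0| + |matB γ₁ γ₂ pstar j 1| with hβ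
  set N := ‖tildeV W pstar‖ with hN
  have hN0 : 0 ≤ N := norm_nonneg _
  have hgN : ‖g pstar‖ ≤ β * N := norm_applyB_le γ₁ γ₂ pstar (fun i => norm_le_pi_norm _ i) j
  set D := (C₁ + C₂) * (β + 1) + 2 * C₃ with hD
  have hQ0 := (cube_root_spec (mul_pos hq ht₀)).1
  refine ⟨D / (q * t₀) ^ (1 / 3 : ℝ), by positivity, min (min μ₁ μ₂) (q * t₀ * ε₀ ^ 3),
    by positivity, fun μ t x hμ hμ₀ ht => ?_⟩
  have ht' : 0 < t := ht₀.trans_le ht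
  have hμa := hμ₀.trans_le (min_le_left _ _)
  have hμb := hμ₀.trans_le (min_le_right _ _)
  set ε := eps γ₁ γ₂ pstar μ t with hεdef
  have hε : 0 < ε := eps_pos hq hμ ht'
  have hε3 : ε ^ 3 = μ / (q * t) := eps_cube hq hμ ht'
  have hεle : ε ≤ ε₀ := by
    refine le_of_pow_le_pow_left₀ three_ne_zero hε₀.le ?_
    rw [hε3, div_le_iff₀ (by positivity)]
    calc μ ≤ q * t₀ * ε₀ ^ 3 := hμb.le
      _ ≤ q * t * ε₀ ^ 3 := by gcongr
      _ = _ := by ring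
  have hεμ := eps_le hq hμ ht₀ ht
  rw [← hεdef, ← hqdef] at hεμ
  -- Each error term contains `ε · ε (N + ε)` up to constants; the spare `ε` is exchanged for
  -- `μ^{1/3} / (q t₀)^{1/3}`.
  have hfinal : ∀ C' : ℝ, C' = C₁ ∨ C' = C₂ →
      C' * (ε ^ 2 * ‖g pstar‖ + ε ^ 3) + 2 * ε * (C₃ * (ε * (N + ε))) ≤
      D / (q * t₀) ^ (1 / 3 : ℝ) * μ ^ (1 / 3 : ℝ) * (ε * (N + ε)) := by
    intro C' hC'
    have h1 : 0 ≤ C' ∧ C' ≤ C₁ + C₂ := by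
      rcases hC' with rfl | rfl <;> exact ⟨by assumption, by linarith⟩
    calc C' * (ε ^ 2 * ‖g pstar‖ + ε ^ 3) + 2 * ε * (C₃ * (ε * (N + ε)))
        ≤ (C₁ + C₂) * (ε ^ 2 * (β * N) + ε ^ 3) + 2 * ε * (C₃ * (ε * (N + ε))) := by
          have := h1.2
          gcongr
      _ ≤ D * ε * (ε * (N + ε)) := by
          have t1 : 0 ≤ (C₁ + C₂) * (ε ^ 2 * N) := by positivity
          have t2 : 0 ≤ (C₁ + C₂) * (β * ε ^ 3) := by positivity
          rw [hD]
          linarith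
      _ ≤ D * (μ ^ (1 / 3 : ℝ) / (q * t₀) ^ (1 / 3 : ℝ)) * (ε * (N + ε)) := by gcongr
      _ = _ := by ring
  have nε : ‖(2 * ε : ℂ)‖ = 2 * ε := by
    rw [norm_mul, Complex.norm_ofNat, norm_real, Real.norm_eq_abs, abs_of_pos hε]
  have nreal : ∀ r : ℝ, ‖(r : ℂ)‖ = |r| := fun r => by rw [norm_real, Real.norm_eq_abs]
  constructor
  · intro hx
    have h1 := hC₁ μ t x hμ (hμa.trans_le (min_le_left _ _)) ht hx
    set y := x - c * t with hy
    set z := frontVar γ₁ γ₂ pstar μ t y with hz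
    have hzL : |z| ≤ L := abs_frontVar_le hq hμ ht₀ ht hx
    have hzy : z * ε ^ 2 = y / (q * t) := frontVar_mul_eps_sq hq hμ ht' y
    obtain ⟨hA1, hA2⟩ := hA z hzL
    have h2 := hC₃ (-(y / (q * t))) ε (airyAi z) (I * airyAiDeriv z) hε hεle
      (by rw [abs_neg, ← hzy, abs_mul, abs_of_pos (by positivity : 0 < ε ^ 2)]; gcongr)
      (by rw [nreal]; exact hA1) (by rw [norm_mul, norm_I, one_mul, nreal]; exact hA2)
    set E := cexp (I * ((Phi₁ γ₁ γ₂ pstar x t / μ : ℝ) : ℂ)) with hE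
    have hEn : ‖E‖ = 1 := norm_cexp_phase _
    have hamp : ampRight γ₁ γ₂ W pstar μ x t j = E * applyB γ₁ γ₂ pstar
        ((airyAi z : ℂ) • F₁ W pstar (-(y / (q * t))) +
          (ε * (I * airyAiDeriv z) : ℂ) • F₂ W pstar (-(y / (q * t)))) j := by
      rw [show (ε * (I * airyAiDeriv z) : ℂ) = I * ε * airyAiDeriv z by ring]
      rfl
    rw [hamp]
    set P := applyB γ₁ γ₂ pstar ((airyAi z : ℂ) • F₁ W pstar (-(y / (q * t))) +
          (ε * (I * airyAiDeriv z) : ℂ) • F₂ W pstar (-(y / (q * t)))) j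
    have e1 : Iopt γ₁ γ₂ W μ x t j - 2 * ε * (E * P) =
        (Iopt γ₁ γ₂ W μ x t j - 2 * ε * (E * (g pstar * airyAi z -
          I * ε * deriv g pstar * airyAiDeriv z))) - 2 * ε * (E * (P - (airyAi z * g pstar -
          ε * (I * airyAiDeriv z) * deriv g pstar))) := by ring
    rw [e1]
    refine (norm_sub_le _ _).trans (le_trans (add_le_add h1 ?_) (hfinal C₁ (Or.inl rfl)))
    rw [norm_mul, nε, norm_mul, hEn, one_mul]
    exact mul_le_mul_of_nonneg_left h2 (by positivity)
  · intro hx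
    have hx' : |-x - c * t| ≤ K * μ ^ (2 / 3 : ℝ) := by
      rwa [show -x - c * t = -(x + c * t) by ring, abs_neg]
    -- By reflection the left front at `x` is the right front at `-x` with amplitude `conj g`.
    -- Conjugating the estimate brings back `g` and turns `Φ₁(-x)` into `-Φ₁(-x) = Φ₂(x)`.
    have h1 := hC₂ μ t (-x) hμ (hμa.trans_le (min_le_right _ _)) ht hx'
    rw [hgc', RCLike.norm_conj] at h1
    set y := x + c * t with hy
    set z := frontVar γ₁ γ₂ pstar μ t y with hz
    have hzneg : frontVar γ₁ γ₂ pstar μ t (-x - c * t) = -z := by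
      rw [hz, frontVar, frontVar, ← neg_div, hy]
      congr 1
      ring
    have hzL : |-z| ≤ L := by rw [abs_neg]; exact abs_frontVar_le hq hμ ht₀ ht hx
    have hzy : z * ε ^ 2 = y / (q * t) := frontVar_mul_eps_sq hq hμ ht' y
    obtain ⟨hA1, hA2⟩ := hA (-z) hzL
    have h2 := hC₃ (y / (q * t)) ε (airyAi (-z)) (-(I * airyAiDeriv (-z))) hε hεle
      (by
        rw [← hzy, abs_mul, abs_of_pos (by positivity : 0 < ε ^ 2)]
        rw [abs_neg] at hzL
        gcongr)
      (by rw [nreal]; exact hA1) (by rw [norm_neg, norm_mul, norm_I, one_mul, nreal]; exact hA2)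
    rw [← hcdef, hzneg, ← Iopt_eq_reflect, ← RCLike.norm_conj] at h1
    set E := cexp (I * ((Phi₂ γ₁ γ₂ pstar x t / μ : ℝ) : ℂ)) with hE
    have hEn : ‖E‖ = 1 := norm_cexp_phase _
    have hEc : conj (cexp (I * ((Phi₁ γ₁ γ₂ pstar (-x) t / μ : ℝ) : ℂ))) = E := by
      rw [← exp_conj, map_mul, conj_I, conj_ofReal, hE, Phi₁, Phi₂]
      congr 1
      push_cast
      ring
    have hamp : ampLeft γ₁ γ₂ W pstar μ x t j = E * applyB γ₁ γ₂ pstar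
        ((airyAi (-z) : ℂ) • F₁ W pstar (y / (q * t)) +
          (ε * (-(I * airyAiDeriv (-z))) : ℂ) • F₂ W pstar (y / (q * t))) j := by
      rw [show (ε * (-(I * airyAiDeriv (-z))) : ℂ) = -(I * ε * airyAiDeriv (-z)) by ring,
        neg_smul, ← sub_eq_add_neg]
      rfl
    rw [hamp]
    set P := applyB γ₁ γ₂ pstar ((airyAi (-z) : ℂ) • F₁ W pstar (y / (q * t)) +
          (ε * (-(I * airyAiDeriv (-z))) : ℂ) • F₂ W pstar (y / (q * t))) j
    simp only [map_sub, map_mul, conj_conj, conj_ofReal, conj_I, hEc, map_ofNat] at h1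
    have e1 : conj (Iopt γ₁ γ₂ W μ x t j) - 2 * ε * (E * P) =
        (conj (Iopt γ₁ γ₂ W μ x t j) - 2 * ε * (E * (g pstar * airyAi (-z) -
          -I * ε * deriv g pstar * airyAiDeriv (-z)))) - 2 * ε * (E * (P -
          (airyAi (-z) * g pstar - ε * (-(I * airyAiDeriv (-z))) * deriv g pstar))) := by ring
    rw [e1]
    refine (norm_sub_le _ _).trans (le_trans (add_le_add h1 ?_) (hfinal C₂ (Or.inr rfl)))
    rw [norm_mul, nε, norm_mul, hEn, one_mul]
    exact mul_le_mul_of_nonneg_left h2 (by positivity)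

end Fronts

end DiatomicLattice

/-! ### Assembly: both fronts and both components -/

open DiatomicLattice in
theorem mainTheorem9 (γ₁ γ₂ : ℝ) (hγ₁ : 0 < γ₁) (hγ : γ₁ < γ₂) :
    ∃ pstar ∈ Set.Ioo (0 : ℝ) (Real.pi / 2),
      iteratedDeriv 2 (omega₂ γ₁ γ₂) pstar = 0 ∧
      (∀ p ∈ Set.Ioo 0 pstar, iteratedDeriv 2 (omega₂ γ₁ γ₂) p < 0) ∧
      (∀ p ∈ Set.Ioo pstar (Real.pi / 2), 0 < iteratedDeriv 2 (omega₂ γ₁ γ₂) p) ∧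
      0 < cStar γ₁ γ₂ pstar ∧
      0 < qStar γ₁ γ₂ pstar ∧
      ∀ (W : SchwartzMap ℝ ℝ) (t₀ t₁ K : ℝ), 0 < t₀ → t₀ ≤ t₁ → 0 < K →
        ∃ C > 0, ∃ μ₀ > 0, ∀ μ : ℝ, 0 < μ → μ < μ₀ → ∀ t ∈ Set.Icc t₀ t₁, ∀ x : ℝ,
          (|x - cStar γ₁ γ₂ pstar * t| ≤ K * μ ^ (2 / 3 : ℝ) → ∀ j : Fin 2,
            FactorApprox C μ (eps γ₁ γ₂ pstar μ t) ‖tildeV W pstar‖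
              (Iopt γ₁ γ₂ W μ x t j) (ampRight γ₁ γ₂ W pstar μ x t j)) ∧
          (|x + cStar γ₁ γ₂ pstar * t| ≤ K * μ ^ (2 / 3 : ℝ) → ∀ j : Fin 2,
            FactorApprox C μ (eps γ₁ γ₂ pstar μ t) ‖tildeV W pstar‖
              (Iopt γ₁ γ₂ W μ x t j) (ampLeft γ₁ γ₂ W pstar μ x t j)) := by
  obtain ⟨pstar, hp, hp2, hneg, hpos, hc, hq, hmin⟩ := exists_inflection hγ₁ hγ
  refine ⟨pstar, hp, hp2, hneg, hpos, hc, hq, fun W t₀ t₁ K ht₀ _ hK => ?_⟩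
  have key := exists_norm_Iopt_sub_amp_le hγ₁ hγ hp hp2 hq hmin W ht₀ hK.le
  choose C hC0 μ₀ hμ₀ h using key
  -- The sum serves both components, and the added 1 makes the constant strictly positive.
  refine ⟨C 0 + C 1 + 1, by linarith [hC0 0, hC0 1], min (μ₀ 0) (μ₀ 1),
    lt_min (hμ₀ 0) (hμ₀ 1), fun μ hμ hμlt t ht x => ?_⟩
  have ht' : 0 < t := ht₀.trans_le ht.1
  have hε := eps_pos hq hμ ht'
  have hCj : ∀ j, C j ≤ C 0 + C 1 + 1 := fun j => by
    fin_cases j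
    · simp only [Fin.zero_eta]; linarith [hC0 1]
    · simp only [Fin.mk_one]; linarith [hC0 0]
  have hμj : ∀ j, μ < μ₀ j := fun j => by
    fin_cases j
    · exact hμlt.trans_le (min_le_left _ _)
    · exact hμlt.trans_le (min_le_right _ _)
  have hmono : ∀ j, C j * μ ^ (1 / 3 : ℝ) * (eps γ₁ γ₂ pstar μ t *
      (‖tildeV W pstar‖ + eps γ₁ γ₂ pstar μ t)) ≤ (C 0 + C 1 + 1) * μ ^ (1 / 3 : ℝ) *
      (eps γ₁ γ₂ pstar μ t * (‖tildeV W pstar‖ + eps γ₁ γ₂ pstar μ t)) := fun j => by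
    have := hCj j
    have := Real.rpow_pos_of_pos hμ (1 / 3)
    gcongr
  exact ⟨fun hx j => FactorApprox.of_norm_sub_le (by linarith [hC0 0, hC0 1]) hμ hε
      (norm_nonneg _) rfl (((h j μ t x hμ (hμj j) ht.1).1 hx).trans (hmono j)),
    fun hx j => FactorApprox.of_norm_sub_le (by linarith [hC0 0, hC0 1]) hμ hε
      (norm_nonneg _) (Complex.conj_re _).symm
      (((h j μ t x hμ (hμj j) ht.1).2 hx).trans (hmono j))⟩
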